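/- Let $\Omega=(0,1)$, $T=3$, $Q=\Omega\times(0,T)$, $\Sigma=\{0,1\}\times(0,T)$, $c_1(x)=\sqrt2\,\sin\pi x$, and let $Y$ be the space of $y\in H^{2,1}(Q)$ (i.e. $y,y_x,y_{xx},\dot y\in L^2(Q)$) with $y=0$ on $\Sigma$. Let $\hat y_d(t)=\tfrac32e^t$ on $(0,\log2)$, $3$ on $(\log2,1)$, $4-t$ on $(1,3)$, and let $y_d(x,t)=\hat y_d(t)c_1(x)$. Consider the problem of minimizing $$\tfrac12\int_Q(y-y_d)^2\,dx\,dt+\tfrac12\int_\Omega(y(x,T)-c_1(x))^2\,dx$$ over scalar controls $u\in L^2(0,T)$, $\check u\le u\le\hat u$ a.e., $\check u=-1$, $\hat u=\pi^2+1$, subject to $\dot y-y_{xx}=uy$ in $Q$, $y=0$ on $\Sigma$, $y(\cdot,0)=c_1$, and to $g(y(\cdot,t)):=\int_\Omega c_1(x)y(x,t)\,dx-2\le0$ for $t\in[0,T]$. (This is the problem with state equation $\dot y-\Delta y+\gamma y^3=f+y(b_0+ub)$ and control cost $\alpha\int u$, for $\gamma=0$, $f=0$, $b_0=0$, $b=1$,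 $\alpha=0$.) Let $$\bar u=\hat u\ \text{on }(0,\log2),\qquad \bar u=\pi^2\ \text{on }(\log2,2),\qquad \bar u=\pi^2-1/\hat y_d\ \text{on }(2,3),$$ and $\bar y(x,t)=\bar y_1(t)c_1(x)$ with $\bar y_1=e^t$, $2$, $4-t$ on these three intervals respectively. Notation. $Az=-z_{xx}-\bar u z$. $BV(0,T)_{0,+}$ is the set of nondecreasing right-continuous functions on $[0,T]$ vanishing at $T$, identified with the nonnegative finite measures $d\mu$ on $[0,T]$. $\Lambda_1$ is the set of pairs $(p,\mu)\in L^\infty(0,T;H^1_0(\Omega))\times BV(0,T)_{0,+}$ such that $\int_{[0,T]} g(\bar y(\cdot,t))\,d\mu(t)=0$; $p$ is the costate, i.e. for some $p_0\in H^{-1}(\Omega)$ and all $z\in Y$, $$\int_Q p(\dot z+Az)\,dx\,dt+\langle p_0,z(\cdot,0)\rangle=\int_{[0,T]}\int_\Omega c_1z\,dx\,d\mu(t)+\int_Q(\bar y-y_d)z\,dx\,dt+\int_\Omega(\bar y(x,T)-c_1(x))z(x,T)\,dx;$$ and the switching function $\Psi^p(t)=\int_\Omega\bar y p\,dx$ is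 in $L^\infty(0,T)$ with $\int_0^T\Psi^p(u-\bar u)\,dt\ge0$ for all $u\in L^2(0,T)$ with $\check u\le u\le\hat u$ a.e. For $(p,\mu)\in\Lambda_1$, $p+c_1\mu\in Y$, which gives a meaning to $p(\cdot,t)$ for every $t\in[0,T]$. For $w\in L^2(0,T)$, $\zeta[w]\in Y$ is the solution of $\dot\zeta+A\zeta=B^1w$, $\zeta(\cdot,0)=0$, where $B^1=-fb+2\bar y_xb_x+\bar yb_{xx}-2\gamma\bar y^3b$ (which is $0$ here). With $S(t)=\int_\Omega p\bar y\,dx$, the quadratic form is $$\widehat{\mathcal Q}[p,\mu](\zeta,w,h)=\int_0^T\Big[\int_\Omega(\zeta+\bar yw)^2dx-\dot S w^2+2w\int_\Omega\big(\zeta(\bar y-y_d+c_1\dot\mu)-pB^1w\big)dx\Big]dt+\int_\Omega\big[(\zeta(x,T)+\bar y(x,T)h)^2+2h\,p(x,T)\zeta(x,T)\big]dx+S(T)h^2.$$ An arc is a maximal open subinterval of $(0,T)$ on which each of the two control bounds and the state constraint is either active a.e. or inactive a.e. $PC_2^*$ is the set of $(\zeta[w],w,h)\in Y\times L^2(0,T)\times\mathbb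 R$ such that: $w$ is constant on each arc where a control bound is active, this constant being $0$ on the first arc and $h$ on the last one (if a bound is active there); $w(t)\int_\Omega c_1\bar y\,dx=-\int_\Omega c_1\zeta\,dx$ on each arc where the state constraint is active; and $\int_\Omega c_1(\zeta(\cdot,T)+\bar y(\cdot,T)h)\,dx=0$ if the state constraint is active at $T$ and $d\mu$ has an atom at $T$ for some $(p,\mu)\in\Lambda_1$. A quadratic form $q$ on a normed space is a Legendre form if it is weakly lower semicontinuous, $q(tx)=t^2q(x)$ for $t>0$, and $x_\ell\rightharpoonup x$, $q(x_\ell)\to q(x)$ imply $x_\ell\to x$. **Lemma.** $\bar y$ is in $Y$ and is the unique state associated with $\bar u$; for each $w\in L^2(0,T)$ there is a unique $\zeta[w]$; and the hypotheses of the second order sufficient condition hold at $(\bar u,\bar y)$, namely: 1. (setting) the contact sets of the two control bounds (up to null sets) and of the state constraint are, up to a finite set, finite unions of maximal arcs; there are $\varepsilon>0$ and $u\in L^2(0,T)$ with $\check u\le u\le\hat u$ a.e. such that $g(\bar y(\cdot,t))+\int_\Omega c_1z(\cdot,t)\,dx<-\varepsilon$ on $[0,T]$, where $z\in Y$, $\dot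 z+Az=(u-\bar u)\bar y$, $z(\cdot,0)=0$; no control bound is active on an arc where the state constraint is, and $|\int_\Omega c_1\bar y\,dx|\ge a>0$ a.e. there, for a constant $a$; $g(\bar y(\cdot,t))\le-k\,\mathrm{dist}(t,I^C)$ on $[0,T]$ for some $k>0$, where $I^C=\{t\in[0,T]: g(\bar y(\cdot,t))=0\}$; $|\bar u-\check u|,|\bar u-\hat u|\ge\delta>0$ a.e. where no bound is active; for some $r>2$ the initial state and the final target are in $W^{1,r}_0\cap W^{2,r}(\Omega)$, $y_d,f\in L^\infty(Q)$ and $b_0,b\in W^{2,\infty}(\Omega)$ (moreover $c_1\in H^2(\Omega)\cap H^1_0(\Omega)$); and $\bar u$ has left and right limits at the end points of arcs in $(0,T)$; 2. (strict complementarity) in the interior relative to $[0,T]$ of the contact set of the lower (resp. upper) control bound, $\max_{\Lambda_1}\Psi^p(t)>0$ (resp. $\min_{\Lambda_1}\Psi^p(t)<0$), and $\operatorname{supp}d\mu=I^C$ for some $(p,\mu)\in\Lambda_1$; 3. $(\bar u,\bar y)$ is admissible, and the multiplier exists and is unique: $\Lambda_1$ has exactly one element; 4. for each $(p,\mu)\in\Lambda_1$,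 $\widehat{\mathcal Q}[p,\mu]$ is a Legendre form on the space $\{(\zeta[w],w,h): w\in L^2(0,T),\ h\in\mathbb R\}$, with the norm of $Y\times L^2(0,T)\times\mathbb R$; 5. (uniform positivity) there is $\rho>0$ such that, for all $(\zeta,w,h)\in PC_2^*$, $$\max_{(p,\mu)\in\Lambda_1}\widehat{\mathcal Q}[p,\mu](\zeta,w,h)\ge\rho\,(\|w\|_2^2+|h|^2).$$ -/

import Mathlib

open MeasureTheory Set Filter Topology
open scoped ContDiff ENNReal

noncomputable section

namespace HeatControl

/-! ### Function spaces on `Ω = (0,1)` and `Q = Ω × (0,T)` -/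

/-- The spatial domain `Ω = (0,1)`. -/
def Om : Set ℝ := Ioo 0 1

/-- The space-time cylinder; a point of `ℝ × ℝ` is `(x, t)`. -/
def Cyl (T : ℝ) : Set (ℝ × ℝ) := Om ×ˢ Ioo 0 T

abbrev L2Om : Type := Lp ℝ 2 (volume.restrict Om)
abbrev L2T (T : ℝ) : Type := Lp ℝ 2 (volume.restrict (Ioo 0 T))
abbrev L2Q (T : ℝ) : Type := Lp ℝ 2 (volume.restrict (Cyl T))

/-- Partial derivatives in `x` and in `t` of a test function on `ℝ × ℝ`. -/
def ddx (φ : ℝ × ℝ → ℝ) (q : ℝ × ℝ) : ℝ := fderiv ℝ φ q (1, 0)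
def ddt (φ : ℝ × ℝ → ℝ) (q : ℝ × ℝ) : ℝ := fderiv ℝ φ q (0, 1)

/-- A function that is square integrable on a set times a continuous function is integrable on
a bounded subset. -/
theorem integrable_pair {X : Type*} [PseudoMetricSpace X] [ProperSpace X] [MeasurableSpace X]
    [BorelSpace X] {μ : Measure X} [IsFiniteMeasureOnCompacts μ] {S : Set X}
    (hS : MeasurableSet S) (hb : Bornology.IsBounded S)
    (F : Lp ℝ 2 (μ.restrict S)) {φ : X → ℝ} (hφ : Continuous φ) :
    Integrable (fun q => F q * φ q) (μ.restrict S) := by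
  have hc : IsCompact (closure S) := hb.isCompact_closure
  have : IsFiniteMeasure (μ.restrict S) :=
    ⟨by
      rw [Measure.restrict_apply_univ]
      exact (measure_mono subset_closure).trans_lt hc.measure_lt_top⟩
  obtain ⟨C, hC⟩ := hc.exists_bound_of_continuousOn hφ.continuousOn
  have h1 : Integrable F (μ.restrict S) := (Lp.memLp F).integrable (by norm_num)
  refine h1.mul_bdd (c := C) hφ.aestronglyMeasurable ?_
  filter_upwards [ae_restrict_mem hS] with q hq using hC q (subset_closure hq)

theorem pair_add {X : Type*} [PseudoMetricSpace X] [ProperSpace X] [MeasurableSpace X]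
    [BorelSpace X] {μ : Measure X} [IsFiniteMeasureOnCompacts μ] {S : Set X}
    (hS : MeasurableSet S) (hb : Bornology.IsBounded S)
    (F G : Lp ℝ 2 (μ.restrict S)) {φ : X → ℝ} (hφ : Continuous φ) :
    ∫ q in S, (F + G) q * φ q ∂μ = (∫ q in S, F q * φ q ∂μ) + ∫ q in S, G q * φ q ∂μ := by
  rw [← integral_add (integrable_pair hS hb F hφ) (integrable_pair hS hb G hφ)]
  refine integral_congr_ae ?_
  filter_upwards [Lp.coeFn_add F G] with q hq
  rw [hq, Pi.add_apply, add_mul]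

theorem pair_smul {X : Type*} [MeasurableSpace X] {μ : Measure X} {S : Set X}
    (a : ℝ) (F : Lp ℝ 2 (μ.restrict S)) (φ : X → ℝ) :
    ∫ q in S, (a • F) q * φ q ∂μ = a * ∫ q in S, F q * φ q ∂μ := by
  rw [← integral_const_mul]
  refine integral_congr_ae ?_
  filter_upwards [Lp.coeFn_smul a F] with q hq
  rw [hq, Pi.smul_apply, smul_eq_mul, mul_assoc]

theorem pair_zero {X : Type*} [MeasurableSpace X] {μ : Measure X} {S : Set X} (φ : X → ℝ) :
    ∫ q in S, (0 : Lp ℝ 2 (μ.restrict S)) q * φ q ∂μ = 0 := by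
  have h := pair_smul (0 : ℝ) (0 : Lp ℝ 2 (μ.restrict S)) φ
  simpa using h

theorem measurableSet_Om : MeasurableSet Om := measurableSet_Ioo
theorem isBounded_Om : Bornology.IsBounded Om := Metric.isBounded_Ioo 0 1
theorem measurableSet_Cyl (T : ℝ) : MeasurableSet (Cyl T) :=
  measurableSet_Ioo.prod measurableSet_Ioo
theorem isBounded_Cyl (T : ℝ) : Bornology.IsBounded (Cyl T) :=
  (Metric.isBounded_Ioo 0 1).prod (Metric.isBounded_Ioo 0 T)

theorem continuous_ddx {φ : ℝ × ℝ → ℝ} (h : ContDiff ℝ ∞ φ) : Continuous (ddx φ) :=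
  (h.continuous_fderiv (by simp)).clm_apply continuous_const
theorem continuous_ddt {φ : ℝ × ℝ → ℝ} (h : ContDiff ℝ ∞ φ) : Continuous (ddt φ) :=
  (h.continuous_fderiv (by simp)).clm_apply continuous_const

/-- `H¹₀(Ω)`, as the Hilbert space of pairs `(ψ, ψ')` in `L²(Ω)²`. The smooth test functions do
not have to vanish at the endpoints, so the identity says at the same time that `ψ'` is the weak
derivative of `ψ` and that the trace of `ψ` on `∂Ω` is zero. -/
def H10 : Submodule ℝ (PiLp 2 (fun _ : Fin 2 => L2Om)) where
  carrier := {F | ∀ φ : ℝ → ℝ, ContDiff ℝ ∞ φ →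
    ∫ x in Om, F 0 x * deriv φ x = -∫ x in Om, F 1 x * φ x}
  zero_mem' := by
    intro φ _
    simp only [PiLp.zero_apply, pair_zero, neg_zero]
  add_mem' := by
    intro F G hF hG φ hφ
    have hd : Continuous (deriv φ) := hφ.continuous_deriv (by simp)
    simp only [PiLp.add_apply]
    rw [pair_add measurableSet_Om isBounded_Om _ _ hd,
      pair_add measurableSet_Om isBounded_Om _ _ hφ.continuous, hF φ hφ, hG φ hφ]
    ring
  smul_mem' := by
    intro a F hF φ hφ
    simp only [PiLp.smul_apply]
    rw [pair_smul, pair_smul, hF φ hφ]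
    ring

/-- The state space `Y = {y ∈ H^{2,1}(Q) ; y = 0 a.e. on Σ}`, as the Hilbert space of quadruples
`(y, y_x, y_xx, y_t)` in `L²(Q)⁴`. In the first identity the test functions are arbitrary on the
lateral boundary `Σ`: it says that `y_x` is the weak derivative of `y` and that the trace of `y` on
`Σ` is zero (Green's formula). In the two others the test functions vanish on the part of the
boundary that produces a boundary term: these are the usual weak derivatives. -/
def Y (T : ℝ) : Submodule ℝ (PiLp 2 (fun _ : Fin 4 => L2Q T)) where
  carrier := {F | ∀ φ : ℝ × ℝ → ℝ, ContDiff ℝ ∞ φ →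
    (∫ q in Cyl T, F 0 q * ddx φ q = -∫ q in Cyl T, F 1 q * φ q) ∧
    ((∀ t, φ (0, t) = 0 ∧ φ (1, t) = 0) →
      ∫ q in Cyl T, F 1 q * ddx φ q = -∫ q in Cyl T, F 2 q * φ q) ∧
    ((∀ x, φ (x, 0) = 0 ∧ φ (x, T) = 0) →
      ∫ q in Cyl T, F 0 q * ddt φ q = -∫ q in Cyl T, F 3 q * φ q)}
  zero_mem' := by
    intro φ _
    simp only [PiLp.zero_apply, pair_zero, neg_zero, implies_true, and_self]
  add_mem' := by
    intro F G hF hG φ hφ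
    obtain ⟨f1, f2, f3⟩ := hF φ hφ
    obtain ⟨g1, g2, g3⟩ := hG φ hφ
    have hx := continuous_ddx hφ
    have ht := continuous_ddt hφ
    simp only [PiLp.add_apply]
    refine ⟨?_, fun h => ?_, fun h => ?_⟩
    · rw [pair_add (measurableSet_Cyl T) (isBounded_Cyl T) _ _ hx,
        pair_add (measurableSet_Cyl T) (isBounded_Cyl T) _ _ hφ.continuous, f1, g1]
      ring
    · rw [pair_add (measurableSet_Cyl T) (isBounded_Cyl T) _ _ hx,
        pair_add (measurableSet_Cyl T) (isBounded_Cyl T) _ _ hφ.continuous, f2 h, g2 h]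
      ring
    · rw [pair_add (measurableSet_Cyl T) (isBounded_Cyl T) _ _ ht,
        pair_add (measurableSet_Cyl T) (isBounded_Cyl T) _ _ hφ.continuous, f3 h, g3 h]
      ring
  smul_mem' := by
    intro a F hF φ hφ
    obtain ⟨f1, f2, f3⟩ := hF φ hφ
    simp only [PiLp.smul_apply]
    refine ⟨?_, fun h => ?_, fun h => ?_⟩
    · rw [pair_smul, pair_smul, f1]
      ring
    · rw [pair_smul, pair_smul, f2 h]
      ring
    · rw [pair_smul, pair_smul, f3 h]
      ring

/-- The function `y` and its derivatives `y_x`, `y_xx`, `y_t` (defined a.e. on `Q`). -/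
def fn {T : ℝ} (y : Y T) (q : ℝ × ℝ) : ℝ := y.1 0 q
def fnx {T : ℝ} (y : Y T) (q : ℝ × ℝ) : ℝ := y.1 1 q
def fnxx {T : ℝ} (y : Y T) (q : ℝ × ℝ) : ℝ := y.1 2 q
def fnt {T : ℝ} (y : Y T) (q : ℝ × ℝ) : ℝ := y.1 3 q

/-- The value `y(·,t) ∈ L²(Ω)`, for `t ∈ [0,T]`, of the representative of `y` in `C([0,T];L²(Ω))`
(defined for a.e. `x`). Since `s ↦ y(x,s)` is absolutely continuous for a.e. `x`, one has
`T y(x,T) = ∫_0^T (y(x,s) + s y_t(x,s)) ds` and `y(x,t) = y(x,T) - ∫_t^T y_t(x,s) ds`. -/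
def valueAt {T : ℝ} (y : Y T) (t x : ℝ) : ℝ :=
  T⁻¹ * (∫ s in Ioo 0 T, (fn y (x, s) + s * fnt y (x, s))) - ∫ s in Ioo t T, fnt y (x, s)

/-- `L^∞(0,T;H¹₀(Ω))`, the space of the costates. -/
abbrev CostateSpace (T : ℝ) : Type := Lp H10 ∞ (volume.restrict (Ioo 0 T))

/-- `p(x,t)` and `p_x(x,t)`, for a.e. `t` and a.e. `x`. -/
def cval {T : ℝ} (p : CostateSpace T) (t x : ℝ) : ℝ := (p t).1 0 x
def cvalx {T : ℝ} (p : CostateSpace T) (t x : ℝ) : ℝ := (p t).1 1 x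

/-- Sobolev spaces on `Ω`: `g` is the weak derivative of `f`; `W^{2,p}(Ω)`; `W^{1,p}_0(Ω)`. -/
def HasWeakDeriv (f g : ℝ → ℝ) : Prop :=
  ∀ φ : ℝ → ℝ, ContDiff ℝ ∞ φ → φ 0 = 0 → φ 1 = 0 →
    ∫ x in Om, f x * deriv φ x = -∫ x in Om, g x * φ x

def MemW2 (p : ℝ≥0∞) (f : ℝ → ℝ) : Prop :=
  ∃ g h : ℝ → ℝ, MemLp f p (volume.restrict Om) ∧ MemLp g p (volume.restrict Om) ∧
    MemLp h p (volume.restrict Om) ∧ HasWeakDeriv f g ∧ HasWeakDeriv g h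

def MemW10 (p : ℝ≥0∞) (f : ℝ → ℝ) : Prop :=
  ∃ g : ℝ → ℝ, MemLp f p (volume.restrict Om) ∧ MemLp g p (volume.restrict Om) ∧
    ∀ φ : ℝ → ℝ, ContDiff ℝ ∞ φ → ∫ x in Om, f x * deriv φ x = -∫ x in Om, g x * φ x

/-! ### The control problem -/

/-- Data of the problem on `Ω = (0,1)` with a scalar control and one state constraint:
state equation `y_t - y_xx + γ y³ = f + y (b0 + u b)`, `y = 0` on `Σ`, `y(·,0) = y0`;
control bounds `ulo ≤ u ≤ uhi`; state constraint `∫ c y(·,t) + d ≤ 0` on `[0,T]`; cost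
`½ ∫_Q (y - yd)² + ½ ∫_Ω (y(·,T) - ydT)² + α ∫_0^T u`. -/
structure Data where
  T : ℝ
  γ : ℝ
  f : ℝ × ℝ → ℝ
  b0 : ℝ → ℝ
  b : ℝ → ℝ
  y0 : ℝ → ℝ
  ulo : ℝ
  uhi : ℝ
  c : ℝ → ℝ
  d : ℝ
  α : ℝ
  yd : ℝ × ℝ → ℝ
  ydT : ℝ → ℝ

variable (D : Data)

def Uad (u : ℝ → ℝ) : Prop :=
  MemLp u 2 (volume.restrict (Ioo 0 D.T)) ∧
    ∀ᵐ t ∂volume.restrict (Ioo 0 D.T), D.ulo ≤ u t ∧ u t ≤ D.uhi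

/-- `y` is a solution in `Y` of the state equation with control `u`. -/
def IsState (u : ℝ → ℝ) (y : Y D.T) : Prop :=
  (∀ᵐ q ∂volume.restrict (Cyl D.T), fnt y q - fnxx y q + D.γ * fn y q ^ 3 =
      D.f q + fn y q * (D.b0 q.1 + u q.2 * D.b q.1)) ∧
    ∀ᵐ x ∂volume.restrict Om, valueAt y 0 x = D.y0 x

/-- The state constraint function `t ↦ g(y(·,t))`. -/
def gfun (y : Y D.T) (t : ℝ) : ℝ := (∫ x in Om, D.c x * valueAt y t x) + D.d

/-- The trajectory `(u,y)` is admissible. -/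
def IsAdmissible (u : ℝ → ℝ) (y : Y D.T) : Prop :=
  Uad D u ∧ IsState D u y ∧ ∀ t ∈ Icc 0 D.T, gfun D y t ≤ 0

/-- `A z = -Δz + 3 γ ȳ² z - (b0 + ū b) z`. -/
def opA (u : ℝ → ℝ) (y z : Y D.T) (q : ℝ × ℝ) : ℝ :=
  -fnxx z q + 3 * D.γ * fn y q ^ 2 * fn z q - (D.b0 q.1 + u q.2 * D.b q.1) * fn z q

/-- `z = z[v]`, the solution of the linearized state equation. -/
def IsLin (u : ℝ → ℝ) (y : Y D.T) (v : ℝ → ℝ) (z : Y D.T) : Prop :=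
  (∀ᵐ q ∂volume.restrict (Cyl D.T), fnt z q + opA D u y z q = v q.2 * D.b q.1 * fn y q) ∧
    ∀ᵐ x ∂volume.restrict Om, valueAt z 0 x = 0

/-! ### Multipliers -/

/-- `BV(0,T)_{0,+}`: nondecreasing right-continuous functions on `[0,T]` that vanish at `T`,
extended by constants outside `[0,T]`. The constant value on `(-∞,0)` is `μ(0-)`, so that the
associated Stieltjes measure `dμ` runs through all nonnegative finite measures on `[0,T]`. -/
def MemBV0 (T : ℝ) (μ : StieltjesFunction ℝ) : Prop :=
  (∀ t, T ≤ t → μ t = 0) ∧ ∀ s t, s < 0 → t < 0 → μ s = μ t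

/-- The costate equation for `(β, μ)`, where `p0` is in `H^{-1}(Ω)`, the dual of `H¹₀(Ω)`; the
element `ψ` of `H¹₀(Ω)` is `z(·,0)`. -/
def IsCostate (u : ℝ → ℝ) (y : Y D.T) (β : ℝ) (p : CostateSpace D.T)
    (μ : StieltjesFunction ℝ) : Prop :=
  ∃ p0 : H10 →L[ℝ] ℝ, ∀ (z : Y D.T) (ψ : H10),
    (∀ᵐ x ∂volume.restrict Om, ψ.1 0 x = valueAt z 0 x) →
    (∫ t in Ioo 0 D.T, ∫ x in Om, cval p t x * (fnt z (x, t) + opA D u y z (x, t))) + p0 ψ =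
      (∫ t in Icc 0 D.T, (∫ x in Om, D.c x * valueAt z t x) ∂μ.measure)
      + β * (∫ q in Cyl D.T, (fn y q - D.yd q) * fn z q)
      + β * ∫ x in Om, (valueAt y D.T x - D.ydT x) * valueAt z D.T x

/-- The switching function `Ψ(t) = β α + ∫ b ȳ(·,t) P(·,t)`. -/
def switching (y : Y D.T) (β : ℝ) (P : ℝ → ℝ → ℝ) (t : ℝ) : ℝ :=
  β * D.α + ∫ x in Om, D.b x * valueAt y t x * P t x

/-- `(β, p, μ)` is a generalized Lagrange multiplier. -/
def IsMultiplier (u : ℝ → ℝ) (y : Y D.T) (β : ℝ) (p : CostateSpace D.T)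
    (μ : StieltjesFunction ℝ) : Prop :=
  0 ≤ β ∧ MemBV0 D.T μ ∧
  (∫ t in Icc 0 D.T, gfun D y t ∂μ.measure) = 0 ∧
  IsCostate D u y β p μ ∧
  (β ≠ 0 ∨ μ.measure ≠ 0) ∧
  MemLp (switching D y β (cval p)) ∞ (volume.restrict (Ioo 0 D.T)) ∧
  ∀ u' : ℝ → ℝ, Uad D u' →
    0 ≤ ∫ t in Ioo 0 D.T, switching D y β (cval p) t * (u' t - u t)

/-- `Λ₁`, the set of pairs `(p, μ)` such that `(1, p, μ)` is a multiplier. -/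
def Multipliers (u : ℝ → ℝ) (y : Y D.T) : Set (CostateSpace D.T × StieltjesFunction ℝ) :=
  {m | IsMultiplier D u y 1 m.1 m.2}

/-- `p¹ = p + c μ`, as an element of `Y`. -/
def IsAltCostate (p : CostateSpace D.T) (μ : StieltjesFunction ℝ) (p1 : Y D.T) : Prop :=
  ∀ᵐ t ∂volume.restrict (Ioo 0 D.T), ∀ᵐ x ∂volume.restrict Om,
    fn p1 (x, t) = cval p t x + D.c x * μ t

open Classical in
/-- The value `p(·,t) = p¹(·,t) - c μ(t)` of the costate at every `t ∈ [0,T]`, where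
`p¹ = p + c μ` belongs to `Y`. -/
def costateAt (p : CostateSpace D.T) (μ : StieltjesFunction ℝ) (t x : ℝ) : ℝ :=
  if h : ∃ p1 : Y D.T, IsAltCostate D p μ p1 then valueAt h.choose t x - D.c x * μ t else 0

/-! ### Contact sets and arcs -/

def lowerActive (u : ℝ → ℝ) (t : ℝ) : Prop := u t = D.ulo
def upperActive (u : ℝ → ℝ) (t : ℝ) : Prop := u t = D.uhi
def stateActive (y : Y D.T) (t : ℝ) : Prop := gfun D y t = 0

/-- The contact set `I^C` of the state constraint. -/
def contactC (y : Y D.T) : Set ℝ := {t ∈ Icc 0 D.T | stateActive D y t}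

/-- `R` holds almost everywhere on `(a,b)`. -/
def AEOn (R : ℝ → Prop) (a b : ℝ) : Prop := ∀ᵐ t ∂volume.restrict (Ioo a b), R t

/-- `(a,b)` is maximal among the open subintervals of `[0,T]` with property `E`. -/
def IsMaxInterval (T : ℝ) (E : ℝ → ℝ → Prop) (a b : ℝ) : Prop :=
  0 ≤ a ∧ a < b ∧ b ≤ T ∧ E a b ∧
    ∀ a' b', 0 ≤ a' → a' ≤ a → b ≤ b' → b' ≤ T → E a' b' → a' = a ∧ b' = b

/-- The finite arc property for the control bound with activity predicate `R` (its contact set is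
defined up to a null set). -/
def FiniteArcsBound (R : ℝ → Prop) : Prop :=
  ∃ 𝒜 : Set (ℝ × ℝ), 𝒜.Finite ∧ (∀ I ∈ 𝒜, IsMaxInterval D.T (AEOn R) I.1 I.2) ∧
    ∀ᵐ t ∂volume.restrict (Icc 0 D.T), R t ↔ ∃ I ∈ 𝒜, t ∈ Ioo I.1 I.2

/-- The finite arc property for the state constraint. -/
def FiniteArcsState (y : Y D.T) : Prop :=
  ∃ 𝒜 : Set (ℝ × ℝ), 𝒜.Finite ∧
    (∀ I ∈ 𝒜, IsMaxInterval D.T (fun a b => Ioo a b ⊆ contactC D y) I.1 I.2) ∧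
    (symmDiff (contactC D y) (⋃ I ∈ 𝒜, Ioo I.1 I.2)).Finite

/-- Each of the three constraints is either active a.e. or inactive a.e. on `(a,b)`. -/
def ConstantActivity (u : ℝ → ℝ) (y : Y D.T) (a b : ℝ) : Prop :=
  (AEOn (lowerActive D u) a b ∨ AEOn (fun t => ¬ lowerActive D u t) a b) ∧
  (AEOn (upperActive D u) a b ∨ AEOn (fun t => ¬ upperActive D u t) a b) ∧
  (AEOn (stateActive D y) a b ∨ AEOn (fun t => ¬ stateActive D y t) a b)

/-- `(a,b)` is one of the arcs `(τ_k, τ_{k+1})`: a maximal arc with constant active constraints.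
Its end points are junction points. -/
def IsArc (u : ℝ → ℝ) (y : Y D.T) (a b : ℝ) : Prop :=
  IsMaxInterval D.T (ConstantActivity D u y) a b

/-- A control bound is active on the arc `(a,b)`, i.e. `B_k` is not empty. -/
def boundArc (u : ℝ → ℝ) (a b : ℝ) : Prop :=
  AEOn (lowerActive D u) a b ∨ AEOn (upperActive D u) a b

/-- `M(t) = ∫ b c ȳ(·,t)`. -/
def Mfun (y : Y D.T) (t : ℝ) : ℝ := ∫ x in Om, D.b x * D.c x * valueAt y t x

/-- The standing assumptions on the setting. -/
def Standing : Prop :=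
  0 < D.T ∧ 0 ≤ D.γ ∧ D.ulo < D.uhi ∧ MemW2 2 D.c ∧ MemW10 2 D.c

/-- The assumptions on the control structure, the qualification and the regularity of the data. -/
structure SettingHypothesis (u : ℝ → ℝ) (y : Y D.T) : Prop where
  /-- finite maximal arc property -/
  arcs : FiniteArcsBound D (lowerActive D u) ∧ FiniteArcsBound D (upperActive D u) ∧
    FiniteArcsState D y
  /-- qualification -/
  qualified : ∃ ε > 0, ∃ u' : ℝ → ℝ, Uad D u' ∧ ∃ z : Y D.T,
    IsLin D u y (fun t => u' t - u t) z ∧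
    ∀ t ∈ Icc 0 D.T, gfun D y t + (∫ x in Om, D.c x * valueAt z t x) < -ε
  /-- on each arc there are at least as many free controls as active state constraints -/
  card : ∀ a b, IsArc D u y a b → AEOn (stateActive D y) a b → ¬ boundArc D u a b
  /-- uniform local controllability -/
  controllable : ∃ α > 0, ∀ a b, IsArc D u y a b → AEOn (stateActive D y) a b →
    ¬ boundArc D u a b → AEOn (fun t => α ≤ |Mfun D y t|) a b
  /-- discontinuity of the derivative of the state constraint at the junction points -/
  sharp : ∃ k > 0, ∀ t ∈ Icc 0 D.T, gfun D y t ≤ -k * Metric.infDist t (contactC D y)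
  /-- uniform distance to the control bounds when they are not active -/
  away : ∃ δ > 0, ∀ᵐ t ∂volume.restrict (Icc 0 D.T),
    ¬ lowerActive D u t → ¬ upperActive D u t → δ ≤ |u t - D.ulo| ∧ δ ≤ |u t - D.uhi|
  /-- regularity of the data, with an exponent `r > n + 1 = 2` -/
  regular : ∃ r : ℝ, 2 < r ∧
    MemW10 (ENNReal.ofReal r) D.y0 ∧ MemW2 (ENNReal.ofReal r) D.y0 ∧
    MemW10 (ENNReal.ofReal r) D.ydT ∧ MemW2 (ENNReal.ofReal r) D.ydT ∧
    MemLp D.yd ∞ (volume.restrict (Cyl D.T)) ∧ MemLp D.f ∞ (volume.restrict (Cyl D.T)) ∧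
    MemW2 ∞ D.b0 ∧ MemW2 ∞ D.b
  /-- left and right limits of the control at the junction points in `(0,T)` -/
  limits : ∀ a b, IsArc D u y a b → ∀ τ, (τ = a ∨ τ = b) → τ ∈ Ioo 0 D.T →
    (∃ l, Tendsto u (𝓝[<] τ) (𝓝 l)) ∧ ∃ l, Tendsto u (𝓝[>] τ) (𝓝 l)

/-- The interior relative to `[0,T]` of the contact set, defined up to a null set, with activity
predicate `R`. It contains `0` (resp. `T`) if the contact set contains an interval starting at `0`
(resp. ending at `T`). -/
def contactInterior (R : ℝ → Prop) : Set ℝ :=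
  {t ∈ Icc 0 D.T | ∃ ε > 0, ∀ᵐ s ∂volume.restrict (Ioo (t - ε) (t + ε) ∩ Ioo 0 D.T), R s}

/-- Strict complementarity for the control bounds and for the state constraint. -/
structure StrictComplementarity (u : ℝ → ℝ) (y : Y D.T) : Prop where
  lower : ∀ t ∈ contactInterior D (lowerActive D u), ∃ r,
    IsGreatest ((fun m => switching D y 1 (costateAt D m.1 m.2) t) '' Multipliers D u y) r ∧ 0 < r
  upper : ∀ t ∈ contactInterior D (upperActive D u), ∃ r,
    IsLeast ((fun m => switching D y 1 (costateAt D m.1 m.2) t) '' Multipliers D u y) r ∧ r < 0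
  state : ∃ m ∈ Multipliers D u y, m.2.measure.support = contactC D y

/-! ### Goh transform -/

/-- `B¹ = -f b + 2 ∇ȳ·∇b + ȳ Δb - 2 γ ȳ³ b`. -/
def B1 (y : Y D.T) (q : ℝ × ℝ) : ℝ :=
  -D.f q * D.b q.1 + 2 * fnx y q * deriv D.b q.1 + fn y q * deriv (deriv D.b) q.1
    - 2 * D.γ * fn y q ^ 3 * D.b q.1

/-- `ζ = ζ[w]`: `ζ_t + A ζ = B¹ w` in `Q`, `ζ = 0` on `Σ`, `ζ(·,0) = 0`. -/
def IsGoh (u : ℝ → ℝ) (y : Y D.T) (w : L2T D.T) (ζ : Y D.T) : Prop :=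
  (∀ᵐ q ∂volume.restrict (Cyl D.T), fnt ζ q + opA D u y ζ q = B1 D y q * w q.2) ∧
    ∀ᵐ x ∂volume.restrict Om, valueAt ζ 0 x = 0

theorem restrict_Cyl (T : ℝ) : (volume.restrict (Cyl T) : Measure (ℝ × ℝ)) =
    (volume.restrict Om).prod (volume.restrict (Ioo 0 T)) := by
  rw [Measure.prod_restrict]
  rfl

theorem ae_sections {T : ℝ} {R : ℝ × ℝ → Prop} (h : ∀ᵐ q ∂volume.restrict (Cyl T), R q) :
    ∀ᵐ x ∂volume.restrict Om, ∀ᵐ s ∂volume.restrict (Ioo 0 T), R (x, s) := by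
  rw [restrict_Cyl] at h
  exact Measure.ae_ae_of_ae_prod h

theorem ae_snd {T : ℝ} {R : ℝ → Prop} (h : ∀ᵐ t ∂volume.restrict (Ioo 0 T), R t) :
    ∀ᵐ q ∂volume.restrict (Cyl T), R q.2 := by
  rw [restrict_Cyl]
  exact Measure.quasiMeasurePreserving_snd.ae h

theorem integrable_sections_aux {T : ℝ} {g : ℝ × ℝ → ℝ}
    (h : Integrable g (volume.restrict (Cyl T))) :
    ∀ᵐ x ∂volume.restrict Om, Integrable (fun s => g (x, s)) (volume.restrict (Ioo 0 T)) := by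
  rw [restrict_Cyl] at h
  exact h.prod_right_ae

theorem integrable_sections {T : ℝ} (F : L2Q T) :
    ∀ᵐ x ∂volume.restrict Om, Integrable (fun s => F (x, s)) (volume.restrict (Ioo 0 T)) := by
  refine integrable_sections_aux (g := fun q => F q) ?_
  simpa using integrable_pair (measurableSet_Cyl T) (isBounded_Cyl T) F
    (continuous_const (y := (1 : ℝ)))

theorem integrable_sections_mul {T : ℝ} (F : L2Q T) :
    ∀ᵐ x ∂volume.restrict Om,
      Integrable (fun s => s * F (x, s)) (volume.restrict (Ioo 0 T)) := by
  have h : Integrable (fun q => F q * q.2) (volume.restrict (Cyl T)) :=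
    integrable_pair (measurableSet_Cyl T) (isBounded_Cyl T) F continuous_snd
  filter_upwards [integrable_sections_aux h] with x hx
  simpa only [mul_comm] using hx

/-- Evaluation at time `0` is linear, up to null sets. -/
theorem at_zero_add {T : ℝ} (y z : Y T) :
    ∀ᵐ x ∂volume.restrict Om, valueAt (y + z) 0 x = valueAt y 0 x + valueAt z 0 x := by
  filter_upwards [integrable_sections (y.1 0), integrable_sections (z.1 0),
    integrable_sections (y.1 3), integrable_sections (z.1 3),
    integrable_sections_mul (y.1 3), integrable_sections_mul (z.1 3),
    ae_sections (Lp.coeFn_add (y.1 0) (z.1 0)), ae_sections (Lp.coeFn_add (y.1 3) (z.1 3))]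
    with x h1 h2 h3 h4 h5 h6 h7 h8
  have e1 : ∫ s in Ioo 0 T, fnt (y + z) (x, s) =
      (∫ s in Ioo 0 T, fnt y (x, s)) + ∫ s in Ioo 0 T, fnt z (x, s) := by
    rw [← integral_add (by exact h3) (by exact h4)]
    exact integral_congr_ae h8
  have e2 : ∫ s in Ioo 0 T, (fn (y + z) (x, s) + s * fnt (y + z) (x, s)) =
      (∫ s in Ioo 0 T, (fn y (x, s) + s * fnt y (x, s))) +
        ∫ s in Ioo 0 T, (fn z (x, s) + s * fnt z (x, s)) := by
    rw [← integral_add (by exact h1.add h5) (by exact h2.add h6)]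
    refine integral_congr_ae ?_
    filter_upwards [h7, h8] with s a b
    have a' : fn (y + z) (x, s) = fn y (x, s) + fn z (x, s) := a
    have b' : fnt (y + z) (x, s) = fnt y (x, s) + fnt z (x, s) := b
    rw [a', b']
    ring
  simp only [valueAt, e1, e2]
  ring

theorem at_zero_smul {T : ℝ} (a : ℝ) (y : Y T) :
    ∀ᵐ x ∂volume.restrict Om, valueAt (a • y) 0 x = a * valueAt y 0 x := by
  filter_upwards [ae_sections (Lp.coeFn_smul a (y.1 0)), ae_sections (Lp.coeFn_smul a (y.1 3))]
    with x h7 h8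
  have e1 : ∫ s in Ioo 0 T, fnt (a • y) (x, s) = a * ∫ s in Ioo 0 T, fnt y (x, s) := by
    rw [← integral_const_mul]
    exact integral_congr_ae h8
  have e2 : ∫ s in Ioo 0 T, (fn (a • y) (x, s) + s * fnt (a • y) (x, s)) =
      a * ∫ s in Ioo 0 T, (fn y (x, s) + s * fnt y (x, s)) := by
    rw [← integral_const_mul]
    refine integral_congr_ae ?_
    filter_upwards [h7, h8] with s k l
    have k' : fn (a • y) (x, s) = a * fn y (x, s) := k
    have l' : fnt (a • y) (x, s) = a * fnt y (x, s) := l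
    rw [k', l']
    ring
  simp only [valueAt, e1, e2]
  ring

/-- The space `{(ζ[w], w, h)}`, a subspace of `Y × L²(0,T) × ℝ`. -/
def GohSpace (u : ℝ → ℝ) (y : Y D.T) : Submodule ℝ (Y D.T × L2T D.T × ℝ) where
  carrier := {e | IsGoh D u y e.2.1 e.1}
  zero_mem' := by
    have z0 := at_zero_smul (0 : ℝ) (0 : Y D.T)
    refine ⟨?_, ?_⟩
    · filter_upwards [Lp.coeFn_zero ℝ 2 (volume.restrict (Cyl D.T)),
        ae_snd (Lp.coeFn_zero ℝ 2 (volume.restrict (Ioo 0 D.T)))] with q h1 h2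
      have k0 : fn (0 : Y D.T) q = 0 := h1
      have k2 : fnxx (0 : Y D.T) q = 0 := h1
      have k3 : fnt (0 : Y D.T) q = 0 := h1
      have kw : ((0 : L2T D.T) : ℝ → ℝ) q.2 = 0 := h2
      change fnt (0 : Y D.T) q + opA D u y 0 q = B1 D y q * ((0 : L2T D.T) : ℝ → ℝ) q.2
      simp only [opA, k0, k2, k3, kw]
      ring
    · filter_upwards [z0] with x hx
      simpa using hx
  add_mem' := by
    rintro ⟨ζ, w, h⟩ ⟨ζ', w', h'⟩ ⟨a1, a2⟩ ⟨b1, b2⟩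
    refine ⟨?_, ?_⟩
    · filter_upwards [a1, b1, Lp.coeFn_add (ζ.1 0) (ζ'.1 0), Lp.coeFn_add (ζ.1 2) (ζ'.1 2),
        Lp.coeFn_add (ζ.1 3) (ζ'.1 3), ae_snd (Lp.coeFn_add w w')] with q h1 h2 h3 h4 h5 h6
      have k0 : fn (ζ + ζ') q = fn ζ q + fn ζ' q := h3
      have k2 : fnxx (ζ + ζ') q = fnxx ζ q + fnxx ζ' q := h4
      have k3 : fnt (ζ + ζ') q = fnt ζ q + fnt ζ' q := h5
      have kw : (w + w' : L2T D.T) q.2 = w q.2 + w' q.2 := h6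
      change fnt (ζ + ζ') q + opA D u y (ζ + ζ') q = B1 D y q * (w + w' : L2T D.T) q.2
      simp only [opA] at h1 h2
      simp only [opA, k0, k2, k3, kw]
      linear_combination h1 + h2
    · filter_upwards [a2, b2, at_zero_add ζ ζ'] with x h1 h2 h3
      change valueAt (ζ + ζ') 0 x = 0
      rw [h3]
      change valueAt ζ 0 x = 0 at h1
      change valueAt ζ' 0 x = 0 at h2
      rw [h1, h2, add_zero]
  smul_mem' := by
    rintro a ⟨ζ, w, h⟩ ⟨a1, a2⟩
    refine ⟨?_, ?_⟩
    · filter_upwards [a1, Lp.coeFn_smul a (ζ.1 0), Lp.coeFn_smul a (ζ.1 2),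
        Lp.coeFn_smul a (ζ.1 3), ae_snd (Lp.coeFn_smul a w)] with q h1 h3 h4 h5 h6
      have k0 : fn (a • ζ) q = a * fn ζ q := h3
      have k2 : fnxx (a • ζ) q = a * fnxx ζ q := h4
      have k3 : fnt (a • ζ) q = a * fnt ζ q := h5
      have kw : (a • w : L2T D.T) q.2 = a * w q.2 := h6
      change fnt (a • ζ) q + opA D u y (a • ζ) q = B1 D y q * (a • w : L2T D.T) q.2
      simp only [opA] at h1
      simp only [opA, k0, k2, k3, kw]
      linear_combination a * h1
    · filter_upwards [a2, at_zero_smul a ζ] with x h1 h3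
      change valueAt (a • ζ) 0 x = 0
      rw [h3]
      change valueAt ζ 0 x = 0 at h1
      rw [h1, mul_zero]

/-- `S(t) = ∫ b² p(·,t) ȳ(·,t)`. -/
def Sfun (y : Y D.T) (p : CostateSpace D.T) (μ : StieltjesFunction ℝ) (t : ℝ) : ℝ :=
  ∫ x in Om, D.b x ^ 2 * costateAt D p μ t x * valueAt y t x

/-- The integrand `q̂_I(t)` of the transformed quadratic form; `κ = 1 - 6 γ ȳ p`. -/
def hatqI (y : Y D.T) (p : CostateSpace D.T) (μ : StieltjesFunction ℝ)
    (ζ : Y D.T) (w : L2T D.T) (t : ℝ) : ℝ :=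
  (∫ x in Om, (1 - 6 * D.γ * fn y (x, t) * cval p t x) *
      (fn ζ (x, t) + fn y (x, t) * D.b x * w t) ^ 2)
  - deriv (Sfun D y p μ) t * w t ^ 2
  + 2 * w t * ∫ x in Om,
      (fn ζ (x, t) * (-deriv (deriv D.b) x * cval p t x - 2 * deriv D.b x * cvalx p t x
          + D.b x * (fn y (x, t) - D.yd (x, t)) + D.b x * D.c x * deriv μ t)
        - D.b x * cval p t x * B1 D y (x, t) * w t)

/-- The final term `q̂_T` of the transformed quadratic form. -/
def hatqT (y : Y D.T) (p : CostateSpace D.T) (μ : StieltjesFunction ℝ) (ζ : Y D.T) (h : ℝ) : ℝ :=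
  (∫ x in Om, ((valueAt ζ D.T x + valueAt y D.T x * h * D.b x) ^ 2
      + 2 * h * D.b x * costateAt D p μ D.T x * valueAt ζ D.T x))
    + h ^ 2 * Sfun D y p μ D.T

/-- The quadratic form `Q̂[p,μ](ζ,w,h)`. -/
def hatQ (y : Y D.T) (p : CostateSpace D.T) (μ : StieltjesFunction ℝ)
    (e : Y D.T × L2T D.T × ℝ) : ℝ :=
  (∫ t in Ioo 0 D.T, hatqI D y p μ e.1 e.2.1 t) + hatqT D y p μ e.1 e.2.2

/-- The cone `PC₂*`. -/
structure MemPC2star (u : ℝ → ℝ) (y : Y D.T) (e : Y D.T × L2T D.T × ℝ) : Prop where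
  goh : IsGoh D u y e.2.1 e.1
  /-- `w` is constant on each arc where a control bound is active -/
  const : ∀ a b, IsArc D u y a b → boundArc D u a b → ∃ k, AEOn (fun t => e.2.1 t = k) a b
  /-- the linearized state constraint is active on the arcs where the state constraint is -/
  state : ∀ a b, IsArc D u y a b → AEOn (stateActive D y) a b →
    AEOn (fun t => Mfun D y t * e.2.1 t = -∫ x in Om, D.c x * fn e.1 (x, t)) a b
  /-- `w = 0` on the first arc if a control bound is active there -/
  first : ∀ b, IsArc D u y 0 b → boundArc D u 0 b → AEOn (fun t => e.2.1 t = 0) 0 b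
  /-- `w = h` on the last arc if a control bound is active there -/
  last : ∀ a, IsArc D u y a D.T → boundArc D u a D.T → AEOn (fun t => e.2.1 t = e.2.2) a D.T
  /-- final condition if the state constraint is active at `T` and `dμ` has an atom at `T` -/
  jump : ∀ m ∈ Multipliers D u y, D.T ∈ contactC D y → 0 < m.2.measure {D.T} →
    ∫ x in Om, D.c x * (valueAt e.1 D.T x + valueAt y D.T x * D.b x * e.2.2) = 0

/-- `q` is a Legendre form on the normed space `W`: a quadratic form, weakly lower
semicontinuous, positively homogeneous of degree `2`, and such that weak convergence together with
convergence of the values implies strong convergence. -/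
def IsLegendreForm {W : Type*} [NormedAddCommGroup W] [NormedSpace ℝ W] (q : W → ℝ) : Prop :=
  (∃ B : QuadraticForm ℝ W, ∀ x, B x = q x) ∧
  LowerSemicontinuous (fun x : WeakSpace ℝ W => q ((toWeakSpace ℝ W).symm x)) ∧
  (∀ (x : W) (t : ℝ), 0 < t → q (t • x) = t ^ 2 * q x) ∧
  ∀ (s : ℕ → W) (x : W),
    Tendsto (fun n => toWeakSpace ℝ W (s n)) atTop (𝓝 (toWeakSpace ℝ W x)) →
    Tendsto (fun n => q (s n)) atTop (𝓝 (q x)) → Tendsto s atTop (𝓝 x)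

/-- Condition (a): feasibility and existence of a multiplier, Legendre property, and uniform
positivity on `PC₂*`. -/
structure SufficientCondition (u : ℝ → ℝ) (y : Y D.T) : Prop where
  feasible : IsAdmissible D u y ∧ (Multipliers D u y).Nonempty
  legendre : ∀ m ∈ Multipliers D u y,
    IsLegendreForm (fun e : GohSpace D u y => hatQ D y m.1 m.2 e.1)
  positive : ∃ ρ > 0, ∀ e, MemPC2star D u y e → ∃ r,
    IsGreatest ((fun m => hatQ D y m.1 m.2 e) '' Multipliers D u y) r ∧
      ρ * (‖e.2.1‖ ^ 2 + |e.2.2| ^ 2) ≤ r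

end HeatControl

/-! ### The example -/

namespace HeatExample

/-- The normalized first eigenfunction of the Dirichlet Laplacian. -/
def c1 (x : ℝ) : ℝ := √2 * Real.sin (Real.pi * x)

def ydhat (t : ℝ) : ℝ :=
  if t < Real.log 2 then 1.5 * Real.exp t else if t < 1 then 3 else 4 - t

def data : HeatControl.Data where
  T := 3
  γ := 0
  f := fun _ => 0
  b0 := fun _ => 0
  b := fun _ => 1
  y0 := c1
  ulo := -1
  uhi := Real.pi ^ 2 + 1
  c := c1
  d := -2
  α := 0
  yd := fun q => ydhat q.2 * c1 q.1
  ydT := c1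

def ubar (t : ℝ) : ℝ :=
  if t < Real.log 2 then Real.pi ^ 2 + 1
  else if t < 2 then Real.pi ^ 2
  else Real.pi ^ 2 - 1 / ydhat t

def ybar1 (t : ℝ) : ℝ :=
  if t < Real.log 2 then Real.exp t else if t < 2 then 2 else 4 - t

end HeatExample

end

namespace HeatControl

/-! ### Integration on an interval -/

/-! The example lives in one Fourier mode. The control depends on time only, so the equation
decouples along the sine basis. The initial state, the targets and the constraint involve only `c1`,
for which `-c1'' = π² c1` and `∫ c1² = 1`. What remains is the scalar equation `y' = (u - π²) y`
with the constraint `y ≤ 2`, and `ybar1` solves it. The other modes matter only for uniqueness: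
along each sine, the coefficient of a solution of the homogeneous linearized equation, or of the
difference of two costates with the same `μ`, satisfies a homogeneous Volterra equation with bounded
coefficient. It vanishes by Gronwall, and the sines are complete (`ae_eq_zero_of_integral_ek`). This
gives the unique state and, because `B¹ = 0`, also `ζ[w] = 0` for every `w` (`isGoh_iff`).

The multiplier is found backwards in time. Let `p1` be the first coefficient of the costate. Its
adjoint equation is `(p1 + μ)' = ŷ_d - ȳ1 - (ū - π²) p1`, with terminal value `0` because the
trajectory ends at the target. On `(log 2, 3)` no control bound is active, so `p1 = 0` (`cmom_sign`)
and `μ' = ŷ_d - ȳ1`, that is `1`, `2 - t`, `0` on `(log 2, 1)`, `(1, 2)`, `(2, 3)`. On `(0, log 2)`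
the state constraint is inactive, so `μ` is constant (`multiplier_const`) and `p1' = e^t / 2 - p1`.
The only freedom left is an atom of `dμ` at `log 2`. Since `p1 + μ` is continuous, such an atom
would make `p1` positive just before `log 2`, against the sign imposed by the upper bound
(`multiplier_unique`). Hence `p1 = (e^t - 4 e^{-t}) / 4 < 0` there, which is strict complementarity
for the control.

With `ζ = 0` and `p(T) = 0` the quadratic form collapses to `∫ (ȳ1² - S') w² + h²`, where `S = ȳ1
p1` is `(e^{2t} - 4) / 4` on the first arc and `0` afterwards. The coefficient of `w²` is therefore
`e^{2t} / 2`, then `ȳ1²`, and lies between `1/4` and `4` (`hatQ_eq`). The form is the square of a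
Hilbert norm equivalent to that of `(w, h)`; this gives the Legendre property and uniform positivity
on the whole space, not just on the cone. -/

theorem integrableOn_Icc_of_Ioo {a b : ℝ} {f : ℝ → ℝ} (h : IntegrableOn f (Ioo a b)) :
    IntegrableOn f (Icc a b) :=
  (integrableOn_Icc_iff_integrableOn_Ioo).2 h

/-- Fubini on the triangle `s < t`. The inner interval is half-open because `ν` may have atoms; for
a Stieltjes measure it yields `μ T - μ s` exactly. -/
theorem integral_mul_primitive {T : ℝ} (ν : Measure ℝ) [SFinite ν] {f g : ℝ → ℝ}
    (hf : IntegrableOn f (Ioo 0 T)) (hg : IntegrableOn g (Icc 0 T) ν) :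
    ∫ t in Icc 0 T, g t * (∫ s in Ioo 0 t, f s) ∂ν =
      ∫ s in Ioo 0 T, f s * ∫ t in Ioc s T, g t ∂ν := by
  have hm : MeasurableSet {z : ℝ × ℝ | z.2 < z.1} := measurableSet_lt measurable_snd measurable_fst
  have hF : Integrable ({z : ℝ × ℝ | z.2 < z.1}.indicator (fun z => g z.1 * f z.2))
      ((ν.restrict (Icc 0 T)).prod (volume.restrict (Ioo 0 T))) :=
    (hg.mul_prod hf).indicator hm
  have h := integral_integral_swap
    (f := fun t s => {z : ℝ × ℝ | z.2 < z.1}.indicator (fun z => g z.1 * f z.2) (t, s)) hF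
  calc _ = ∫ t in Icc 0 T, (∫ s in Ioo 0 T,
        {z : ℝ × ℝ | z.2 < z.1}.indicator (fun z => g z.1 * f z.2) (t, s)) ∂ν := by
        refine setIntegral_congr_fun measurableSet_Icc fun t ht => ?_
        have e : (fun s => {z : ℝ × ℝ | z.2 < z.1}.indicator (fun z => g z.1 * f z.2) (t, s)) =
            (Iio t).indicator (fun s => g t * f s) := by
          ext s
          simp [indicator]
        rw [e, setIntegral_indicator measurableSet_Iio, integral_const_mul]
        congr 3
        ext s
        simp only [mem_inter_iff, mem_Ioo, mem_Iio]
        have := ht.2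
        grind
    _ = ∫ s in Ioo 0 T, ∫ t in Icc 0 T,
        {z : ℝ × ℝ | z.2 < z.1}.indicator (fun z => g z.1 * f z.2) (t, s) ∂ν := h
    _ = _ := by
        refine setIntegral_congr_fun measurableSet_Ioo fun s hs => ?_
        have e : (fun t => {z : ℝ × ℝ | z.2 < z.1}.indicator (fun z => g z.1 * f z.2) (t, s)) =
            (Ioi s).indicator (fun t => f s * g t) := by
          ext t
          simp [indicator, mul_comm]
        rw [e, setIntegral_indicator measurableSet_Ioi, integral_const_mul]
        congr 3
        ext t
        simp only [mem_inter_iff, mem_Icc, mem_Ioi, mem_Ioc]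
        have := hs.1
        grind

/-- Integration by parts in integral form. -/
theorem integral_mul_primitive_volume {T : ℝ} {f g : ℝ → ℝ}
    (hf : IntegrableOn f (Ioo 0 T)) (hg : IntegrableOn g (Ioo 0 T)) :
    ∫ t in Ioo 0 T, g t * (∫ s in Ioo 0 t, f s) =
      ∫ s in Ioo 0 T, f s * ∫ t in Ioo s T, g t := by
  rw [← integral_Icc_eq_integral_Ioo,
    integral_mul_primitive volume hf (integrableOn_Icc_of_Ioo hg)]
  simp only [integral_Ioc_eq_integral_Ioo]

theorem setIntegral_Ioo_eq {a b : ℝ} (h : a ≤ b) (f : ℝ → ℝ) :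
    ∫ s in Ioo a b, f s = ∫ s in a..b, f s := by
  rw [intervalIntegral.integral_of_le h, integral_Ioc_eq_integral_Ioo]

theorem setIntegral_Ioo_add {T t : ℝ} (ht : t ∈ Icc 0 T) {f : ℝ → ℝ}
    (hf : IntegrableOn f (Ioo 0 T)) :
    (∫ s in Ioo 0 t, f s) + ∫ s in Ioo t T, f s = ∫ s in Ioo 0 T, f s := by
  have h : IntervalIntegrable f volume 0 T := by
    rwa [intervalIntegrable_iff_integrableOn_Ioo_of_le (ht.1.trans ht.2)]
  rw [setIntegral_Ioo_eq ht.1, setIntegral_Ioo_eq ht.2, setIntegral_Ioo_eq (ht.1.trans ht.2)]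
  refine intervalIntegral.integral_add_adjacent_intervals (h.mono_set ?_) (h.mono_set ?_) <;>
    rw [uIcc_of_le (by linarith [ht.1, ht.2]), uIcc_of_le (by linarith [ht.1, ht.2])] <;>
    refine Icc_subset_Icc ?_ ?_ <;> linarith [ht.1, ht.2]

theorem continuousOn_primitive_Ioo {T : ℝ} {f : ℝ → ℝ} (hf : IntegrableOn f (Ioo 0 T)) :
    ContinuousOn (fun t => ∫ s in Ioo 0 t, f s) (Icc 0 T) := by
  simp only [← integral_Ioc_eq_integral_Ioo]
  exact intervalIntegral.continuousOn_primitive (integrableOn_Icc_of_Ioo hf)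

theorem integral_primitive_eq {T : ℝ} {f : ℝ → ℝ} (hf : IntegrableOn f (Ioo 0 T)) :
    ∫ s in Ioo 0 T, (∫ r in Ioo s T, f r) = ∫ s in Ioo 0 T, s * f s := by
  have h := integral_mul_primitive_volume (T := T) (f := fun _ => 1) (g := f) (by simp) hf
  simp only [one_mul] at h
  rw [← h]
  refine setIntegral_congr_fun measurableSet_Ioo fun t ht => ?_
  simp [ht.1.le, mul_comm]

/-- `Z` is a primitive of `ζ` on `[0,T]`. -/
def IsPrimitive (T : ℝ) (Z ζ : ℝ → ℝ) : Prop :=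
  IntegrableOn ζ (Ioo 0 T) ∧ ∀ t ∈ Icc 0 T, Z t = Z 0 + ∫ s in Ioo 0 t, ζ s

theorem IsPrimitive.continuousOn {T : ℝ} {Z ζ : ℝ → ℝ} (h : IsPrimitive T Z ζ) :
    ContinuousOn Z (Icc 0 T) :=
  (continuousOn_const.add (continuousOn_primitive_Ioo h.1)).congr h.2

theorem IsPrimitive.integrableOn {T : ℝ} {Z ζ : ℝ → ℝ} (h : IsPrimitive T Z ζ) :
    IntegrableOn Z (Ioo 0 T) :=
  (h.continuousOn.integrableOn_Icc).mono_set Ioo_subset_Icc_self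

theorem IsPrimitive.eq_sub {T : ℝ} (hT : 0 ≤ T) {Z ζ : ℝ → ℝ} (h : IsPrimitive T Z ζ) {t : ℝ}
    (ht : t ∈ Icc 0 T) : Z t = Z T - ∫ s in Ioo t T, ζ s := by
  rw [h.2 t ht, h.2 T ⟨hT, le_rfl⟩, ← setIntegral_Ioo_add ht h.1]
  ring

/-- The exceptional set allows piecewise formulas to be differentiated between their junctions only;
continuity bridges the junctions. -/
theorem isPrimitive_of_hasDerivAt {T : ℝ} {Z ζ : ℝ → ℝ} {S : Set ℝ}
    (hS : S.Countable) (hc : ContinuousOn Z (Icc 0 T))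
    (hd : ∀ t ∈ Ioo 0 T \ S, HasDerivAt Z (ζ t) t) (hi : IntegrableOn ζ (Ioo 0 T)) :
    IsPrimitive T Z ζ := by
  refine ⟨hi, fun t ht => ?_⟩
  rw [setIntegral_Ioo_eq ht.1, integral_eq_of_hasDerivAt_off_countable_of_le Z ζ ht.1 hS
    (hc.mono (Icc_subset_Icc_right ht.2)) (fun x hx => hd x ⟨⟨hx.1.1, hx.1.2.trans_le ht.2⟩, hx.2⟩)]
  · ring
  · rw [intervalIntegrable_iff_integrableOn_Ioo_of_le ht.1]
    exact hi.mono_set (Ioo_subset_Ioo_right ht.2)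

theorem isPrimitive_deriv {T : ℝ} {θ : ℝ → ℝ} (hθ : ContDiff ℝ ∞ θ) :
    IsPrimitive T θ (deriv θ) := by
  refine isPrimitive_of_hasDerivAt countable_empty hθ.continuous.continuousOn
    (fun t _ => (hθ.differentiable (by simp) t).hasDerivAt) ?_
  exact ((hθ.continuous_deriv (by simp)).integrableOn_Icc).mono_set Ioo_subset_Icc_self

/-- Integration by parts for absolutely continuous functions. It reduces to Fubini, so no pointwise
derivative is needed. -/
theorem IsPrimitive.integral_mul {T : ℝ} (hT : 0 ≤ T) {Z ζ W w : ℝ → ℝ} (hZ : IsPrimitive T Z ζ)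
    (hW : IsPrimitive T W w) :
    ∫ t in Ioo 0 T, Z t * w t = Z T * W T - Z 0 * W 0 - ∫ t in Ioo 0 T, ζ t * W t := by
  have e0 : ∫ t in Ioo 0 T, w t = W T - W 0 := by rw [hW.2 T ⟨hT, le_rfl⟩]; ring
  have e1 : ∫ t in Ioo 0 T, ζ t = Z T - Z 0 := by rw [hZ.2 T ⟨hT, le_rfl⟩]; ring
  have h := integral_mul_primitive_volume hZ.1 hW.1
  have cg : IntegrableOn (fun t => w t * ∫ s in Ioo 0 t, ζ s) (Ioo 0 T) := by
    refine (IntegrableOn.continuousOn_mul (g := fun t => ∫ s in Ioo 0 t, ζ s)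
      (K := Icc 0 T) (continuousOn_primitive_Ioo hZ.1)
      (integrableOn_Icc_of_Ioo hW.1) isCompact_Icc).congr_fun (fun t _ => mul_comm _ _)
      measurableSet_Icc |>.mono_set Ioo_subset_Icc_self
  have cW : IntegrableOn (fun t => ζ t * W t) (Ioo 0 T) :=
    (IntegrableOn.continuousOn_mul hW.continuousOn
      (integrableOn_Icc_of_Ioo hZ.1) isCompact_Icc).congr_fun
      (fun t _ => mul_comm _ _) measurableSet_Icc |>.mono_set Ioo_subset_Icc_self
  have l : ∫ t in Ioo 0 T, Z t * w t =
      Z 0 * (W T - W 0) + ∫ t in Ioo 0 T, w t * ∫ s in Ioo 0 t, ζ s := by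
    rw [← e0, ← integral_const_mul, ← integral_add (hW.1.const_mul _) cg]
    refine setIntegral_congr_fun measurableSet_Ioo fun t ht => ?_
    simp only [hZ.2 t (Ioo_subset_Icc_self ht)]
    ring
  have r : ∫ s in Ioo 0 T, ζ s * ∫ t in Ioo s T, w t =
      W T * (Z T - Z 0) - ∫ t in Ioo 0 T, ζ t * W t := by
    rw [← e1, ← integral_const_mul, ← integral_sub (hZ.1.const_mul _) cW]
    refine setIntegral_congr_fun measurableSet_Ioo fun t ht => ?_
    simp only [hW.eq_sub hT (Ioo_subset_Icc_self ht)]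
    ring
  rw [l, h, r]
  ring

/-- Functions that have the same integrals against smooth functions agree almost everywhere. -/
theorem ae_eq_zero_of_integral_smooth {a b : ℝ} {f : ℝ → ℝ} (hf : IntegrableOn f (Ioo a b))
    (h : ∀ η : ℝ → ℝ, ContDiff ℝ ∞ η → HasCompactSupport η → tsupport η ⊆ Ioo a b →
      ∫ t in Ioo a b, f t * η t = 0) :
    ∀ᵐ t ∂volume.restrict (Ioo a b), f t = 0 := by
  rw [ae_restrict_iff' measurableSet_Ioo]
  refine isOpen_Ioo.ae_eq_zero_of_integral_contDiff_smul_eq_zero hf.locallyIntegrableOn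
    fun η h1 h2 h3 => ?_
  rw [← h η h1 h2 h3, ← setIntegral_eq_integral_of_forall_compl_eq_zero (s := Ioo a b)]
  · simp [mul_comm]
  · intro x hx
    rw [image_eq_zero_of_notMem_tsupport (fun h => hx (h3 h)), zero_smul]

theorem contDiff_primitive {η : ℝ → ℝ} (h : ContDiff ℝ ∞ η) :
    ContDiff ℝ ∞ (fun t => ∫ s in (0 : ℝ)..t, η s) := by
  rw [contDiff_infty_iff_deriv]
  have hd : ∀ t, HasDerivAt (fun t => ∫ s in (0 : ℝ)..t, η s) (η t) t := fun t =>
    intervalIntegral.integral_hasDerivAt_right (h.continuous.intervalIntegrable _ _)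
      (h.continuous.stronglyMeasurableAtFilter _ _) h.continuous.continuousAt
  exact ⟨fun t => (hd t).differentiableAt, by rwa [show deriv _ = η from funext fun t => (hd t).deriv]⟩

/-- The representative of a function with an integrable weak derivative. -/
theorem ae_eq_of_weakDeriv {T : ℝ} (hT : 0 < T) {m n : ℝ → ℝ} (hm : IntegrableOn m (Ioo 0 T))
    (hn : IntegrableOn n (Ioo 0 T))
    (h : ∀ θ : ℝ → ℝ, ContDiff ℝ ∞ θ → θ 0 = 0 → θ T = 0 →
      ∫ t in Ioo 0 T, m t * deriv θ t = -∫ t in Ioo 0 T, n t * θ t) :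
    ∀ᵐ t ∂volume.restrict (Ioo 0 T),
      m t = T⁻¹ * (∫ s in Ioo 0 T, (m s + s * n s)) - ∫ s in Ioo t T, n s := by
  set V : ℝ → ℝ := fun t => T⁻¹ * (∫ s in Ioo 0 T, (m s + s * n s)) - ∫ s in Ioo t T, n s with hV
  have hsn : IntegrableOn (fun s => s * n s) (Ioo 0 T) :=
    (IntegrableOn.continuousOn_mul (g := fun s => s) continuousOn_id
      (integrableOn_Icc_of_Ioo hn) isCompact_Icc).mono_set Ioo_subset_Icc_self
  have hP : IsPrimitive T V n := by
    refine ⟨hn, fun t ht => ?_⟩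
    simp only [hV]
    rw [← setIntegral_Ioo_add ht hn]
    ring
  -- The additive constant in `V` is the one that gives `V` the same mean as `m`.
  have hi : ∫ t in Ioo 0 T, V t = ∫ t in Ioo 0 T, m t := by
    have c : IntegrableOn (fun t => ∫ s in Ioo t T, n s) (Ioo 0 T) := by
      refine ((integrableOn_const (C := ∫ s in Ioo 0 T, n s) (by simp)).sub
        ((continuousOn_primitive_Ioo hn).integrableOn_Icc.mono_set Ioo_subset_Icc_self)).congr_fun
        (fun t ht => ?_) measurableSet_Ioo
      have := setIntegral_Ioo_add (Ioo_subset_Icc_self ht) hn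
      simp only [Pi.sub_apply]
      linarith
    simp only [hV]
    rw [integral_sub (integrable_const _) c, integral_primitive_eq hn, integral_add hm hsn]
    rw [setIntegral_const]
    simp only [measureReal_def, Real.volume_Ioo, sub_zero, ENNReal.toReal_ofReal hT.le, smul_eq_mul]
    rw [mul_inv_cancel_left₀ hT.ne']
    ring
  have hd : IntegrableOn (fun t => m t - V t) (Ioo 0 T) := hm.sub hP.integrableOn
  have key := ae_eq_zero_of_integral_smooth hd fun η hη _ _ => by
    set A := ∫ s in (0 : ℝ)..T, η s with hA
    -- The linear correction makes `θ` vanish at `T` too, so it is admissible in the weak identity.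
    -- Then `η = θ' + A / T`, and the constant is harmless by `hi`.
    set θ : ℝ → ℝ := fun t => (∫ s in (0 : ℝ)..t, η s) - T⁻¹ * A * t with hθ
    have hd' : ∀ t, HasDerivAt θ (η t - T⁻¹ * A) t := fun t => by
      have := (intervalIntegral.integral_hasDerivAt_right (hη.continuous.intervalIntegrable 0 t)
        (hη.continuous.stronglyMeasurableAtFilter _ _) hη.continuous.continuousAt)
      have h2 := this.sub ((hasDerivAt_id t).const_mul (T⁻¹ * A))
      rw [mul_one] at h2
      exact h2
    have hθs : ContDiff ℝ ∞ θ := (contDiff_primitive hη).sub (contDiff_const.mul contDiff_id)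
    have t0 : θ 0 = 0 := by simp [hθ]
    have tT : θ T = 0 := by simp only [hθ, ← hA]; field_simp; ring
    have e1 := h θ hθs t0 tT
    have e2 := hP.integral_mul hT.le (isPrimitive_deriv (T := T) hθs)
    rw [t0, tT] at e2
    have hdb : ∀ t, deriv θ t = η t - T⁻¹ * A := fun t => (hd' t).deriv
    have cθ : ContinuousOn (deriv θ) (Icc 0 T) := (hθs.continuous_deriv (by simp)).continuousOn
    have im : IntegrableOn (fun t => m t * deriv θ t) (Ioo 0 T) :=
      (IntegrableOn.mul_continuousOn (integrableOn_Icc_of_Ioo hm) cθ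
        isCompact_Icc).mono_set Ioo_subset_Icc_self
    have iV : IntegrableOn (fun t => V t * deriv θ t) (Ioo 0 T) :=
      (IntegrableOn.mul_continuousOn (integrableOn_Icc_of_Ioo hP.integrableOn) cθ
        isCompact_Icc).mono_set Ioo_subset_Icc_self
    calc ∫ t in Ioo 0 T, (m t - V t) * η t
        = ∫ t in Ioo 0 T, ((m t * deriv θ t - V t * deriv θ t) + (T⁻¹ * A) * (m t - V t)) := by
          refine integral_congr_ae (Eventually.of_forall fun t => ?_)
          simp only [hdb]
          ring
      _ = 0 := by
          rw [integral_add (f := fun t => m t * deriv θ t - V t * deriv θ t) (im.sub iV)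
            (hd.const_mul _), integral_sub im iV, integral_const_mul,
            integral_sub hm hP.integrableOn, hi, e1, e2]
          ring
  filter_upwards [key] with t ht
  simp only [hV] at ht
  linarith

/-! ### Homogeneous Volterra equations -/

/-- Gronwall: the primitive `g` of `a f` is continuous and equals `f` almost everywhere, so `|g t| ≤
C ∫₀ᵗ |g|`. The inequality is applied to `∫₀ᵗ |g|`, whose right derivative is `|g|`. -/
theorem volterra_forward {T C : ℝ} {f a : ℝ → ℝ} (hf : IntegrableOn f (Ioo 0 T))
    (ha : AEStronglyMeasurable a (volume.restrict (Ioo 0 T))) (hC : ∀ t ∈ Ioo 0 T, |a t| ≤ C)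
    (h : ∀ᵐ t ∂volume.restrict (Ioo 0 T), f t = ∫ s in Ioo 0 t, a s * f s) :
    ∀ᵐ t ∂volume.restrict (Ioo 0 T), f t = 0 := by
  set g : ℝ → ℝ := fun t => ∫ s in Ioo 0 t, a s * f s with hg
  have haf : IntegrableOn (fun s => a s * f s) (Ioo 0 T) := by
    refine hf.bdd_mul (c := C) ha ?_
    filter_upwards [ae_restrict_mem measurableSet_Ioo] with t ht using hC t ht
  have hgc : ContinuousOn g (Icc 0 T) := continuousOn_primitive_Ioo haf
  have hga : ContinuousOn (fun t => |g t|) (Icc 0 T) := hgc.abs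
  have hgi : IntegrableOn (fun t => |g t|) (Ioo 0 T) :=
    hga.integrableOn_Icc.mono_set Ioo_subset_Icc_self
  have hfg : ∀ t ∈ Icc 0 T, ∫ s in Ioo 0 t, |f s| = ∫ s in Ioo 0 t, |g s| := fun t ht => by
    refine integral_congr_ae ?_
    filter_upwards [ae_restrict_of_ae_restrict_of_subset (Ioo_subset_Ioo_right ht.2) h] with s hs
    rw [hs]
  have hle : ∀ t ∈ Icc 0 T, |g t| ≤ C * ∫ s in Ioo 0 t, |g s| := fun t ht => by
    rw [← hfg t ht, ← integral_const_mul]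
    have hsub : Ioo 0 t ⊆ Ioo 0 T := Ioo_subset_Ioo_right ht.2
    refine (abs_integral_le_integral_abs).trans
      (setIntegral_mono_on (haf.mono_set hsub).abs ((hf.mono_set hsub).abs.const_mul C)
        measurableSet_Ioo fun s hs => ?_)
    rw [abs_mul]
    exact mul_le_mul_of_nonneg_right (hC s (hsub hs)) (abs_nonneg _)
  have hF : ∀ t ∈ Icc 0 T, ‖∫ s in Ioo 0 t, |g s|‖ ≤ gronwallBound 0 C 0 (t - 0) := by
    refine norm_le_gronwallBound_of_norm_deriv_right_le (f' := fun t => |g t|)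
      (continuousOn_primitive_Ioo hgi) (fun t ht => ?_) (by simp) fun t ht => ?_
    · have hi : IntervalIntegrable (fun t => |g t|) volume 0 t := by
        rw [intervalIntegrable_iff_integrableOn_Ioo_of_le ht.1]
        exact hgi.mono_set (Ioo_subset_Ioo_right ht.2.le)
      have hcw : ContinuousWithinAt (fun t => |g t|) (Ici t) t :=
        (hga t ⟨ht.1, ht.2.le⟩).mono_of_mem_nhdsWithin
          (mem_of_superset (Ico_mem_nhdsGE ht.2) fun s hs => ⟨ht.1.trans hs.1, hs.2.le⟩)
      have hd := intervalIntegral.integral_hasDerivWithinAt_right (s := Ici t) (t := Ioi t) hi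
        ⟨Ioc t T, Ioc_mem_nhdsGT ht.2,
          (hga.mono fun s hs => ⟨ht.1.trans hs.1.le, hs.2⟩).aestronglyMeasurable
            measurableSet_Ioc⟩ (hcw.mono Ioi_subset_Ici_self)
      refine hd.congr (fun s hs => setIntegral_Ioo_eq (ht.1.trans hs) _) (setIntegral_Ioo_eq ht.1 _)
    · rw [Real.norm_eq_abs, abs_abs, add_zero, Real.norm_eq_abs,
        abs_of_nonneg (setIntegral_nonneg measurableSet_Ioo fun s _ => abs_nonneg _)]
      exact hle t ⟨ht.1, ht.2.le⟩
  have hg0 : ∀ t ∈ Icc 0 T, g t = 0 := fun t ht => by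
    have h1 := hF t ht
    rw [gronwallBound_ε0_δ0, norm_le_zero_iff] at h1
    have h2 := hle t ht
    rw [h1, mul_zero] at h2
    exact abs_nonpos_iff.1 h2
  filter_upwards [h, ae_restrict_mem measurableSet_Ioo] with t h1 h2
  rw [h1]
  exact hg0 t (Ioo_subset_Icc_self h2)

theorem setIntegral_reflect (T a b : ℝ) (f : ℝ → ℝ) :
    ∫ s in Ioo a b, f (T - s) = ∫ s in Ioo (T - b) (T - a), f s := by
  have h := (Measure.measurePreserving_sub_left volume T).setIntegral_preimage_emb
    (measurableEmbedding_subLeft T) f (Ioo (T - b) (T - a))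
  rw [← h]
  congr 2
  ext s
  simp only [mem_Ioo, mem_preimage]
  grind

theorem ae_reflect {T : ℝ} {p : ℝ → Prop} (h : ∀ᵐ t ∂volume.restrict (Ioo 0 T), p t) :
    ∀ᵐ t ∂volume.restrict (Ioo 0 T), p (T - t) := by
  have h1 := ((Measure.measurePreserving_sub_left volume T).restrict_preimage_emb
    (measurableEmbedding_subLeft T) (Ioo 0 T)).quasiMeasurePreserving.ae h
  have e : (fun s => T - s) ⁻¹' Ioo 0 T = Ioo 0 T := by
    ext s
    simp only [mem_Ioo, mem_preimage]
    grind
  rwa [e] at h1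

/-- The reflection `t ↦ T - t` preserves Lebesgue measure on `(0,T)` and exchanges this equation
with the forward one. -/
theorem volterra_backward {T C : ℝ} {f a : ℝ → ℝ} (hf : IntegrableOn f (Ioo 0 T))
    (ha : AEStronglyMeasurable a (volume.restrict (Ioo 0 T))) (hC : ∀ t ∈ Ioo 0 T, |a t| ≤ C)
    (h : ∀ᵐ t ∂volume.restrict (Ioo 0 T), f t = ∫ s in Ioo t T, a s * f s) :
    ∀ᵐ t ∂volume.restrict (Ioo 0 T), f t = 0 := by
  have e : (fun s => T - s) ⁻¹' Ioo 0 T = Ioo 0 T := by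
    ext s
    simp only [mem_Ioo, mem_preimage]
    grind
  have mp := (Measure.measurePreserving_sub_left volume T).restrict_preimage_emb
    (measurableEmbedding_subLeft T) (Ioo 0 T)
  rw [e] at mp
  have key := volterra_forward (f := fun t => f (T - t)) (a := fun t => a (T - t)) (C := C)
    ((mp.integrable_comp_emb (measurableEmbedding_subLeft T)).2 hf)
    (ha.comp_measurePreserving mp) (fun t ht => hC _ (by constructor <;> linarith [ht.1, ht.2])) ?_
  · filter_upwards [ae_reflect key] with t ht
    simpa using ht
  · filter_upwards [ae_reflect h] with t ht
    rw [ht, setIntegral_reflect T 0 t (fun s => a s * f s)]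
    simp

end HeatControl

namespace HeatExample
open HeatControl

/-! ### The eigenfunctions of the Dirichlet Laplacian on `(0,1)` -/

noncomputable def ek (k : ℕ) (x : ℝ) : ℝ := √2 * Real.sin (k * Real.pi * x)

theorem c1_eq : c1 = ek 1 := by
  funext x
  simp [c1, ek]

theorem ek_zero (k : ℕ) : ek k 0 = 0 := by simp [ek]

theorem ek_one (k : ℕ) : ek k 1 = 0 := by simp [ek]

theorem contDiff_ek (k : ℕ) : ContDiff ℝ ∞ (ek k) :=
  contDiff_const.mul (Real.contDiff_sin.comp (contDiff_const.mul contDiff_id))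

theorem deriv_ek (k : ℕ) : deriv (ek k) = fun x => √2 * (k * Real.pi) * Real.cos (k * Real.pi * x) := by
  funext x
  have h : HasDerivAt (ek k) (√2 * (Real.cos (k * Real.pi * x) * (k * Real.pi * 1))) x :=
    (((hasDerivAt_id x).const_mul (k * Real.pi)).sin).const_mul √2
  rw [h.deriv]
  ring

theorem deriv_deriv_ek (k : ℕ) : deriv (deriv (ek k)) = fun x => -(k * Real.pi) ^ 2 * ek k x := by
  funext x
  rw [deriv_ek]
  have h : HasDerivAt (fun x : ℝ => √2 * (k * Real.pi) * Real.cos (k * Real.pi * x))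
      (√2 * (k * Real.pi) * (-Real.sin (k * Real.pi * x) * (k * Real.pi * 1))) x :=
    (((hasDerivAt_id x).const_mul (k * Real.pi)).cos).const_mul _
  rw [h.deriv, ek]
  ring

theorem contDiff_c1 : ContDiff ℝ ∞ c1 := c1_eq ▸ contDiff_ek 1

theorem continuous_c1 : Continuous c1 := contDiff_c1.continuous

theorem integral_c1_sq : ∫ x in Om, c1 x * c1 x = 1 := by
  have h : ∀ x : ℝ, c1 x * c1 x = 2 * Real.sin (Real.pi * x) ^ 2 := fun x => by
    have : √2 * √2 = (2 : ℝ) := Real.mul_self_sqrt (by norm_num)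
    simp only [c1]
    linear_combination Real.sin (Real.pi * x) ^ 2 * this
  simp only [h, Om]
  rw [setIntegral_Ioo_eq zero_le_one, intervalIntegral.integral_const_mul,
    intervalIntegral.integral_comp_mul_left (fun x => Real.sin x ^ 2) Real.pi_ne_zero, integral_sin_sq]
  simp
  field_simp

/-- A square integrable function that is orthogonal to all eigenfunctions vanishes. -/
theorem ae_eq_zero_of_integral_ek {F : ℝ → ℝ} (hF : IntegrableOn F Om)
    (h : ∀ k, ∫ x in Om, ek k x * F x = 0) : ∀ᵐ x ∂volume.restrict Om, F x = 0 := by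
  set G : ℝ → ℝ := fun x => F x * Real.sin (Real.pi * x) with hG
  have hint : ∀ φ : ℝ → ℝ, Continuous φ → IntegrableOn (fun x => F x * φ x) Om := fun φ hφ =>
    (IntegrableOn.mul_continuousOn (integrableOn_Icc_of_Ioo hF) hφ.continuousOn
      isCompact_Icc).mono_set Ioo_subset_Icc_self
  -- Induction on `n` with `sin (kθ) cos θ = (sin ((k+1)θ) + sin ((k-1)θ)) / 2`, where `θ = πx`. The
  -- index `k = 0` is split off so that `k - 1` stays a natural number.
  have hmon : ∀ n k : ℕ, ∫ x in Om, F x * (Real.sin (k * Real.pi * x) * Real.cos (Real.pi * x) ^ n)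
      = 0 := by
    intro n
    induction n with
    | zero =>
      intro k
      have h2 : (√2 : ℝ) ≠ 0 := by simp
      have h1 := h k
      have e : ∀ x, ek k x * F x = √2 * (F x * (Real.sin (k * Real.pi * x) *
          Real.cos (Real.pi * x) ^ 0)) := fun x => by simp only [ek]; ring
      simp only [e, integral_const_mul] at h1
      exact (mul_eq_zero.1 h1).resolve_left h2
    | succ n ih =>
      intro k
      rcases k with _ | k
      · simp
      · have e : ∀ x, F x * (Real.sin (((k + 1 : ℕ) : ℝ) * Real.pi * x) * Real.cos (Real.pi * x) ^ (n + 1))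
            = 2⁻¹ * (F x * (Real.sin (((k + 2 : ℕ) : ℝ) * Real.pi * x) * Real.cos (Real.pi * x) ^ n))
            + 2⁻¹ * (F x * (Real.sin ((k : ℝ) * Real.pi * x) * Real.cos (Real.pi * x) ^ n)) := by
          intro x
          have s1 : Real.sin (((k + 2 : ℕ) : ℝ) * Real.pi * x) =
              Real.sin (((k + 1 : ℕ) : ℝ) * Real.pi * x + Real.pi * x) := by
            congr 1
            push_cast
            ring
          have s2 : Real.sin ((k : ℝ) * Real.pi * x) =
              Real.sin (((k + 1 : ℕ) : ℝ) * Real.pi * x - Real.pi * x) := by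
            congr 1
            push_cast
            ring
          rw [s1, s2, Real.sin_add, Real.sin_sub]
          ring
        simp only [e]
        rw [integral_add ((hint _ (by fun_prop)).const_mul _) ((hint _ (by fun_prop)).const_mul _),
          integral_const_mul, integral_const_mul, ih, ih]
        simp
  -- Only `k = 1` of `hmon` is used from here on; the other indices served the induction.
  have hpoly : ∀ p : Polynomial ℝ, ∫ x in Om, G x * p.eval (Real.cos (Real.pi * x)) = 0 := by
    intro p
    have e : ∀ x, G x * p.eval (Real.cos (Real.pi * x)) = ∑ i ∈ Finset.range (p.natDegree + 1),
        p.coeff i * (F x * (Real.sin ((1 : ℕ) * Real.pi * x) * Real.cos (Real.pi * x) ^ i)) := by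
      intro x
      rw [Polynomial.eval_eq_sum_range, Finset.mul_sum]
      refine Finset.sum_congr rfl fun i _ => ?_
      simp only [hG, Nat.cast_one, one_mul]
      ring
    simp only [e]
    rw [integral_finsetSum _ fun i _ => (hint _ (by fun_prop)).const_mul _]
    refine Finset.sum_eq_zero fun i _ => ?_
    rw [integral_const_mul, hmon, mul_zero]
  have hGi : IntegrableOn G Om := hint _ (by fun_prop)
  -- On `[0,1]` the map `x ↦ cos (πx)` has the continuous inverse `arccos / π`, so a continuous `η`
  -- is a continuous function of `cos (πx)`, and Weierstrass approximates it by polynomials in `cos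
  -- (πx)`.
  have hcont : ∀ η : ℝ → ℝ, Continuous η → ∫ x in Om, G x * η x = 0 := by
    intro η hη
    have hGη : IntegrableOn (fun x => G x * η x) Om :=
      (IntegrableOn.mul_continuousOn (integrableOn_Icc_of_Ioo hGi) hη.continuousOn
        isCompact_Icc).mono_set Ioo_subset_Icc_self
    set A := ∫ x in Om, |G x| with hA
    have hA0 : 0 ≤ A := setIntegral_nonneg measurableSet_Om fun x _ => abs_nonneg _
    have hb : ∀ ε > 0, |∫ x in Om, G x * η x| ≤ ε * A := by
      intro ε hε
      obtain ⟨p, hp⟩ := exists_polynomial_near_of_continuousOn (-1) 1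
        (fun y => η (Real.arccos y / Real.pi))
        (hη.comp (Real.continuous_arccos.div_const _)).continuousOn ε hε
      have hGp : IntegrableOn (fun x => G x * p.eval (Real.cos (Real.pi * x))) Om :=
        (IntegrableOn.mul_continuousOn (integrableOn_Icc_of_Ioo hGi)
          (Continuous.continuousOn (by fun_prop)) isCompact_Icc).mono_set Ioo_subset_Icc_self
      have e : ∫ x in Om, G x * η x =
          ∫ x in Om, (G x * η x - G x * p.eval (Real.cos (Real.pi * x))) := by
        rw [integral_sub hGη hGp, hpoly, sub_zero]
      rw [e, hA, ← integral_const_mul]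
      refine abs_integral_le_integral_abs.trans (setIntegral_mono_on (hGη.sub hGp).abs
        (hGi.abs.const_mul ε) measurableSet_Om fun x hx => ?_)
      have hx' : x ∈ Ioo (0 : ℝ) 1 := hx
      have h1 := hp (Real.cos (Real.pi * x)) ⟨Real.neg_one_le_cos _, Real.cos_le_one _⟩
      rw [Real.arccos_cos (by have := Real.pi_pos; nlinarith [hx'.1])
        (by have := Real.pi_pos; nlinarith [hx'.2]), mul_div_cancel_left₀ _ Real.pi_ne_zero] at h1
      rw [← mul_sub, abs_mul, abs_sub_comm, mul_comm]
      exact mul_le_mul_of_nonneg_right h1.le (abs_nonneg _)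
    by_contra hne
    have hpos : 0 < |∫ x in Om, G x * η x| := abs_pos.2 hne
    -- This `ε` makes `ε * A` smaller than the integral itself; `A + 1` avoids a division by zero.
    have := hb (|∫ x in Om, G x * η x| / (2 * (A + 1))) (by positivity)
    have h2 : |∫ x in Om, G x * η x| / (2 * (A + 1)) * A < |∫ x in Om, G x * η x| := by
      rw [div_mul_eq_mul_div, div_lt_iff₀ (by positivity)]
      nlinarith
    linarith
  have hG0 := ae_eq_zero_of_integral_smooth hGi fun η hη _ _ => hcont η hη.continuous
  have hG1 : ∀ᵐ x ∂volume.restrict Om, G x = 0 := hG0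
  filter_upwards [hG1, ae_restrict_mem measurableSet_Om] with x hx hm
  have hm' : x ∈ Ioo (0 : ℝ) 1 := hm
  -- The weight `sin (πx)` is positive inside the interval and can be divided out.
  have hs : 0 < Real.sin (Real.pi * x) := Real.sin_pos_of_pos_of_lt_pi
    (mul_pos Real.pi_pos hm'.1) (by have := Real.pi_pos; nlinarith [hm'.2])
  exact (mul_eq_zero.1 hx).resolve_right hs.ne'

end HeatExample

namespace HeatControl

/-! ### The space `Y` -/

theorem setIntegral_Cyl {T : ℝ} {F : ℝ × ℝ → ℝ} (h : IntegrableOn F (Cyl T)) :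
    ∫ q in Cyl T, F q = ∫ x in Om, ∫ t in Ioo 0 T, F (x, t) := by
  unfold IntegrableOn at h
  rw [restrict_Cyl] at h ⊢
  exact integral_prod _ h

theorem setIntegral_Cyl_symm {T : ℝ} {F : ℝ × ℝ → ℝ} (h : IntegrableOn F (Cyl T)) :
    ∫ q in Cyl T, F q = ∫ t in Ioo 0 T, ∫ x in Om, F (x, t) := by
  unfold IntegrableOn at h
  rw [restrict_Cyl] at h ⊢
  exact integral_prod_symm _ h

theorem ae_sections_symm {T : ℝ} {R : ℝ × ℝ → Prop} (h : ∀ᵐ q ∂volume.restrict (Cyl T), R q) :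
    ∀ᵐ t ∂volume.restrict (Ioo 0 T), ∀ᵐ x ∂volume.restrict Om, R (x, t) := by
  rw [restrict_Cyl, ← Measure.prod_swap] at h
  exact Measure.ae_ae_of_ae_prod (ae_of_ae_map measurable_swap.aemeasurable h)

theorem integrableOn_Cyl_right {T : ℝ} {F : ℝ × ℝ → ℝ} (h : IntegrableOn F (Cyl T)) :
    IntegrableOn (fun t => ∫ x in Om, F (x, t)) (Ioo 0 T) := by
  unfold IntegrableOn at h
  rw [restrict_Cyl] at h
  exact h.integral_prod_right

theorem integrableOn_Cyl_left {T : ℝ} {F : ℝ × ℝ → ℝ} (h : IntegrableOn F (Cyl T)) :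
    IntegrableOn (fun x => ∫ t in Ioo 0 T, F (x, t)) Om := by
  unfold IntegrableOn at h
  rw [restrict_Cyl] at h
  exact h.integral_prod_left

theorem integrableOn_Cyl_sections {T : ℝ} {F : ℝ × ℝ → ℝ} (h : IntegrableOn F (Cyl T)) :
    ∀ᵐ t ∂volume.restrict (Ioo 0 T), IntegrableOn (fun x => F (x, t)) Om := by
  unfold IntegrableOn at h
  rw [restrict_Cyl] at h
  exact h.prod_left_ae

theorem integrableOn_Cyl_mul {T : ℝ} (F : L2Q T) {φ : ℝ × ℝ → ℝ} (hφ : Continuous φ) :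
    IntegrableOn (fun q => F q * φ q) (Cyl T) :=
  integrable_pair (measurableSet_Cyl T) (isBounded_Cyl T) F hφ

theorem integrableOn_Cyl {T : ℝ} (F : L2Q T) : IntegrableOn (fun q => F q) (Cyl T) := by
  have h := integrableOn_Cyl_mul F (continuous_const (y := (1 : ℝ)))
  simpa only [mul_one] using h

/-- The converse of the section property needs a measurable exceptional set, hence the passage to
measurable representatives. -/
theorem ae_of_ae_sections_symm {T : ℝ} {F G : ℝ × ℝ → ℝ}
    (hF : AEStronglyMeasurable F (volume.restrict (Cyl T)))
    (hG : AEStronglyMeasurable G (volume.restrict (Cyl T)))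
    (h : ∀ᵐ t ∂volume.restrict (Ioo 0 T), ∀ᵐ x ∂volume.restrict Om, F (x, t) = G (x, t)) :
    ∀ᵐ q ∂volume.restrict (Cyl T), F q = G q := by
  obtain ⟨F', mF, eF⟩ := hF
  obtain ⟨G', mG, eG⟩ := hG
  have hm := measurableSet_eq_fun mF.measurable mG.measurable
  have h2 : ∀ᵐ q ∂volume.restrict (Cyl T), F' q = G' q := by
    rw [restrict_Cyl, ← Measure.prod_swap, ae_map_iff measurable_swap.aemeasurable hm]
    refine (Measure.ae_prod_iff_ae_ae (measurable_swap hm)).2 ?_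
    filter_upwards [h, ae_sections_symm eF, ae_sections_symm eG] with t h1 h2 h3
    filter_upwards [h1, h2, h3] with x k1 k2 k3
    simp only [Prod.swap]
    rw [← k2, ← k3, k1]
  filter_upwards [h2, eF, eG] with q k1 k2 k3
  rw [k2, k3, k1]

theorem aestronglyMeasurable_sep {T : ℝ} {g Z : ℝ → ℝ} (hg : Continuous g)
    (hZ : AEStronglyMeasurable Z (volume.restrict (Ioo 0 T))) :
    AEStronglyMeasurable (fun q : ℝ × ℝ => g q.1 * Z q.2) (volume.restrict (Cyl T)) := by
  rw [restrict_Cyl]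
  exact (hg.comp continuous_fst).aestronglyMeasurable.mul hZ.comp_snd

theorem isFiniteMeasure_Cyl (T : ℝ) : IsFiniteMeasure ((volume : Measure (ℝ × ℝ)).restrict (Cyl T)) := by
  rw [restrict_Cyl]
  unfold Om
  infer_instance

theorem memLp_sep {T C : ℝ} {p : ℝ≥0∞} {g Z : ℝ → ℝ} (hg : Continuous g)
    (hZ : AEStronglyMeasurable Z (volume.restrict (Ioo 0 T))) (hC : ∀ t ∈ Ioo 0 T, |Z t| ≤ C) :
    MemLp (fun q : ℝ × ℝ => g q.1 * Z q.2) p (volume.restrict (Cyl T)) := by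
  have := isFiniteMeasure_Cyl T
  obtain ⟨K, hK⟩ := isCompact_Icc.exists_bound_of_continuousOn (hg.continuousOn (s := Icc 0 1))
  refine MemLp.of_bound (aestronglyMeasurable_sep hg hZ) (K * C) ?_
  filter_upwards [ae_restrict_mem (measurableSet_Cyl T)] with q hq
  rw [norm_mul]
  have h1 := hK q.1 (Ioo_subset_Icc_self hq.1)
  exact mul_le_mul h1 (hC _ hq.2) (norm_nonneg _) ((norm_nonneg _).trans h1)

theorem contDiff_slice_fst {φ : ℝ × ℝ → ℝ} (h : ContDiff ℝ ∞ φ) (t : ℝ) :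
    ContDiff ℝ ∞ (fun x => φ (x, t)) :=
  h.comp (contDiff_id.prodMk contDiff_const)

theorem contDiff_slice_snd {φ : ℝ × ℝ → ℝ} (h : ContDiff ℝ ∞ φ) (x : ℝ) :
    ContDiff ℝ ∞ (fun t => φ (x, t)) :=
  h.comp (contDiff_const.prodMk contDiff_id)

theorem deriv_slice_fst {φ : ℝ × ℝ → ℝ} (h : ContDiff ℝ ∞ φ) (t x : ℝ) :
    deriv (fun x => φ (x, t)) x = ddx φ (x, t) := by
  have h1 : HasFDerivAt φ (fderiv ℝ φ (x, t)) (x, t) :=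
    (h.differentiable (by simp) (x, t)).hasFDerivAt
  exact (h1.comp_hasDerivAt x ((hasDerivAt_id x).prodMk (hasDerivAt_const x t))).deriv

theorem deriv_slice_snd {φ : ℝ × ℝ → ℝ} (h : ContDiff ℝ ∞ φ) (x t : ℝ) :
    deriv (fun t => φ (x, t)) t = ddt φ (x, t) := by
  have h1 : HasFDerivAt φ (fderiv ℝ φ (x, t)) (x, t) :=
    (h.differentiable (by simp) (x, t)).hasFDerivAt
  exact (h1.comp_hasDerivAt t ((hasDerivAt_const t x).prodMk (hasDerivAt_id t))).deriv

/-- Only the products have to vanish at the endpoints. This serves both spatial identities of `Y`: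
in the first the function vanishes on the boundary, in the second the test function does. -/
theorem integral_mul_ddx {g : ℝ → ℝ} (hg : ContDiff ℝ ∞ g) {φ : ℝ × ℝ → ℝ} (hφ : ContDiff ℝ ∞ φ)
    (t : ℝ) (h0 : g 0 * φ (0, t) = 0) (h1 : g 1 * φ (1, t) = 0) :
    ∫ x in Om, g x * ddx φ (x, t) = -∫ x in Om, deriv g x * φ (x, t) := by
  have h := (isPrimitive_deriv (T := 1) hg).integral_mul zero_le_one
    (isPrimitive_deriv (contDiff_slice_fst hφ t))
  simp only [deriv_slice_fst hφ, h0, h1, sub_zero, zero_sub] at h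
  exact h

theorem integrableOn_sep_mul {T C : ℝ} {g Z : ℝ → ℝ} (hg : Continuous g)
    (hZ : AEStronglyMeasurable Z (volume.restrict (Ioo 0 T))) (hC : ∀ t ∈ Ioo 0 T, |Z t| ≤ C)
    {ψ : ℝ × ℝ → ℝ} (hψ : Continuous ψ) :
    IntegrableOn (fun q : ℝ × ℝ => g q.1 * Z q.2 * ψ q) (Cyl T) := by
  have hm : MemLp (fun q : ℝ × ℝ => g q.1 * Z q.2) 2 (volume.restrict (Cyl T)) := memLp_sep hg hZ hC
  refine (integrable_pair (measurableSet_Cyl T) (isBounded_Cyl T) hm.toLp hψ).congr ?_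
  filter_upwards [hm.coeFn_toLp] with q hq
  rw [hq]

theorem setIntegral_sep_mul {T C : ℝ} {g Z : ℝ → ℝ} (hg : Continuous g)
    (hZ : AEStronglyMeasurable Z (volume.restrict (Ioo 0 T))) (hC : ∀ t ∈ Ioo 0 T, |Z t| ≤ C)
    {ψ : ℝ × ℝ → ℝ} (hψ : Continuous ψ) :
    ∫ q in Cyl T, g q.1 * Z q.2 * ψ q = ∫ t in Ioo 0 T, Z t * ∫ x in Om, g x * ψ (x, t) := by
  rw [setIntegral_Cyl_symm (integrableOn_sep_mul hg hZ hC hψ)]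
  refine integral_congr_ae (Eventually.of_forall fun t => ?_)
  simp only [← integral_const_mul]
  refine integral_congr_ae (Eventually.of_forall fun x => ?_)
  ring

/-! ### Functions with separated variables -/

/-- `z(x,t) = g(x) Z(t)`, with the corresponding derivatives. -/
structure IsSep {T : ℝ} (z : Y T) (g Z ζ : ℝ → ℝ) : Prop where
  fn_eq : ∀ᵐ q ∂volume.restrict (Cyl T), fn z q = g q.1 * Z q.2
  fnxx_eq : ∀ᵐ q ∂volume.restrict (Cyl T), fnxx z q = deriv (deriv g) q.1 * Z q.2
  fnt_eq : ∀ᵐ q ∂volume.restrict (Cyl T), fnt z q = g q.1 * ζ q.2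

/-- The spatial identities are integrations by parts in `x` at fixed `t`, the temporal one an
integration by parts in `t` at fixed `x`. For the latter absolute continuity of `Z` is enough, so
junctions with kinks are allowed; the bound on `ζ` puts `y_t` in `L²`. -/
theorem exists_isSep {T C : ℝ} (hT : 0 ≤ T) {g : ℝ → ℝ} (hg : ContDiff ℝ ∞ g) (h0 : g 0 = 0)
    (h1 : g 1 = 0) {Z ζ : ℝ → ℝ} (hZ : IsPrimitive T Z ζ) (hC : ∀ t ∈ Ioo 0 T, |ζ t| ≤ C) :
    ∃ z : Y T, IsSep z g Z ζ := by
  have hg1 : ContDiff ℝ ∞ (deriv g) := (contDiff_infty_iff_deriv.1 hg).2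
  have hg2 : ContDiff ℝ ∞ (deriv (deriv g)) := (contDiff_infty_iff_deriv.1 hg1).2
  obtain ⟨K, hK'⟩ := isCompact_Icc.exists_bound_of_continuousOn hZ.continuousOn
  have hK : ∀ t ∈ Ioo 0 T, |Z t| ≤ K := fun t ht => hK' t (Ioo_subset_Icc_self ht)
  have mZ := hZ.integrableOn.aestronglyMeasurable
  have mζ := hZ.1.aestronglyMeasurable
  have m0 : MemLp (fun q : ℝ × ℝ => g q.1 * Z q.2) 2 (volume.restrict (Cyl T)) :=
    memLp_sep hg.continuous mZ hK
  have m1 : MemLp (fun q : ℝ × ℝ => deriv g q.1 * Z q.2) 2 (volume.restrict (Cyl T)) :=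
    memLp_sep hg1.continuous mZ hK
  have m2 : MemLp (fun q : ℝ × ℝ => deriv (deriv g) q.1 * Z q.2) 2 (volume.restrict (Cyl T)) :=
    memLp_sep hg2.continuous mZ hK
  have m3 : MemLp (fun q : ℝ × ℝ => g q.1 * ζ q.2) 2 (volume.restrict (Cyl T)) :=
    memLp_sep hg.continuous mζ hC
  have pair : ∀ {f : ℝ × ℝ → ℝ} (m : MemLp f 2 (volume.restrict (Cyl T))) (ψ : ℝ × ℝ → ℝ),
      ∫ q in Cyl T, m.toLp f q * ψ q = ∫ q in Cyl T, f q * ψ q := fun m ψ => by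
    refine integral_congr_ae ?_
    filter_upwards [m.coeFn_toLp] with q hq
    rw [hq]
  refine ⟨⟨WithLp.toLp 2 ![m0.toLp, m1.toLp, m2.toLp, m3.toLp], fun φ hφ => ⟨?_, fun hb => ?_,
    fun hb => ?_⟩⟩, m0.coeFn_toLp, m2.coeFn_toLp, m3.coeFn_toLp⟩
  · change ∫ q in Cyl T, m0.toLp _ q * ddx φ q = -∫ q in Cyl T, m1.toLp _ q * φ q
    rw [pair, pair, setIntegral_sep_mul hg.continuous mZ hK (continuous_ddx hφ),
      setIntegral_sep_mul hg1.continuous mZ hK hφ.continuous, ← integral_neg]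
    refine integral_congr_ae (Eventually.of_forall fun t => ?_)
    beta_reduce
    rw [integral_mul_ddx hg hφ t (by simp [h0]) (by simp [h1])]
    ring
  · change ∫ q in Cyl T, m1.toLp _ q * ddx φ q = -∫ q in Cyl T, m2.toLp _ q * φ q
    rw [pair, pair, setIntegral_sep_mul hg1.continuous mZ hK (continuous_ddx hφ),
      setIntegral_sep_mul hg2.continuous mZ hK hφ.continuous, ← integral_neg]
    refine integral_congr_ae (Eventually.of_forall fun t => ?_)
    beta_reduce
    rw [integral_mul_ddx hg1 hφ t (by simp [(hb t).1]) (by simp [(hb t).2])]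
    ring
  · change ∫ q in Cyl T, m0.toLp _ q * ddt φ q = -∫ q in Cyl T, m3.toLp _ q * φ q
    rw [pair, pair, setIntegral_Cyl (integrableOn_sep_mul hg.continuous mZ hK (continuous_ddt hφ)),
      setIntegral_Cyl (integrableOn_sep_mul hg.continuous mζ hC hφ.continuous), ← integral_neg]
    refine integral_congr_ae (Eventually.of_forall fun x => ?_)
    have h := hZ.integral_mul hT (isPrimitive_deriv (T := T) (contDiff_slice_snd hφ x))
    simp only [deriv_slice_snd hφ, (hb x).1, (hb x).2, mul_zero, sub_zero, zero_sub] at h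
    simp only [mul_assoc, integral_const_mul, h]
    ring

/-- Integrating `s Z'(s)` by parts gives `T Z(T) - ∫ Z`, so the bracket equals `T Z(T)` and the
formula defining `valueAt` returns the true value. -/
theorem isPrimitive_valueAt {T : ℝ} (hT : 0 < T) {Z ζ : ℝ → ℝ} (h : IsPrimitive T Z ζ) {t : ℝ}
    (ht : t ∈ Icc 0 T) :
    T⁻¹ * (∫ s in Ioo 0 T, (Z s + s * ζ s)) - ∫ s in Ioo t T, ζ s = Z t := by
  have hs : IsPrimitive T (fun s => s) (fun _ => 1) :=
    isPrimitive_of_hasDerivAt countable_empty continuousOn_id (fun t _ => hasDerivAt_id t)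
      (integrable_const _)
  have e := h.integral_mul hT.le hs
  have hsn : IntegrableOn (fun s => s * ζ s) (Ioo 0 T) :=
    (IntegrableOn.continuousOn_mul (g := fun s => s) continuousOn_id
      (integrableOn_Icc_of_Ioo h.1) isCompact_Icc).mono_set Ioo_subset_Icc_self
  simp only [mul_one, mul_zero, sub_zero, mul_comm (ζ _)] at e
  rw [integral_add h.integrableOn hsn, e, h.eq_sub hT.le ht]
  field_simp
  ring

theorem IsSep.valueAt_eq {T : ℝ} (hT : 0 < T) {z : Y T} {g Z ζ : ℝ → ℝ} (h : IsSep z g Z ζ)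
    (hZ : IsPrimitive T Z ζ) {t : ℝ} (ht : t ∈ Icc 0 T) :
    ∀ᵐ x ∂volume.restrict Om, valueAt z t x = g x * Z t := by
  filter_upwards [ae_sections h.fn_eq, ae_sections h.fnt_eq] with x h1 h2
  have e1 : ∫ s in Ioo 0 T, (fn z (x, s) + s * fnt z (x, s)) =
      g x * ∫ s in Ioo 0 T, (Z s + s * ζ s) := by
    rw [← integral_const_mul]
    refine integral_congr_ae ?_
    filter_upwards [h1, h2] with s k1 k2
    rw [k1, k2]
    ring
  have e2 : ∫ s in Ioo t T, fnt z (x, s) = g x * ∫ s in Ioo t T, ζ s := by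
    rw [← integral_const_mul]
    refine integral_congr_ae ?_
    filter_upwards [ae_restrict_of_ae_restrict_of_subset (Ioo_subset_Ioo_left ht.1) h2] with s k2
    rw [k2]
  rw [valueAt, e1, e2, ← isPrimitive_valueAt hT hZ ht]
  ring

/-! ### Spatial moments of elements of `Y` -/

/-- The function `t ↦ ∫ g F(·,t)`. -/
noncomputable def mom {T : ℝ} (g : ℝ → ℝ) (F : L2Q T) (t : ℝ) : ℝ := ∫ x in Om, g x * F (x, t)

theorem integrable_mom {T : ℝ} {g : ℝ → ℝ} (hg : Continuous g) (F : L2Q T) :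
    IntegrableOn (mom g F) (Ioo 0 T) := by
  refine (integrableOn_Cyl_right (integrableOn_Cyl_mul F (hg.comp continuous_fst))).congr
    (Eventually.of_forall fun t => ?_)
  exact integral_congr_ae (Eventually.of_forall fun x => mul_comm _ _)

theorem setIntegral_mom_mul {T : ℝ} {g θ : ℝ → ℝ} (hg : Continuous g) (hθ : Continuous θ)
    (F : L2Q T) :
    ∫ t in Ioo 0 T, mom g F t * θ t = ∫ q in Cyl T, F q * (g q.1 * θ q.2) := by
  have hc : Continuous (fun q : ℝ × ℝ => g q.1 * θ q.2) := by fun_prop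
  rw [setIntegral_Cyl_symm (integrableOn_Cyl_mul F hc)]
  refine integral_congr_ae (Eventually.of_forall fun t => ?_)
  simp only [mom]
  rw [← integral_mul_const]
  exact integral_congr_ae (Eventually.of_forall fun x => by ring)

theorem contDiff_prod_mul {g θ : ℝ → ℝ} (hg : ContDiff ℝ ∞ g) (hθ : ContDiff ℝ ∞ θ) :
    ContDiff ℝ ∞ (fun q : ℝ × ℝ => g q.1 * θ q.2) :=
  (hg.comp contDiff_fst).mul (hθ.comp contDiff_snd)

theorem ddx_prod_mul {g θ : ℝ → ℝ} (hg : ContDiff ℝ ∞ g) (hθ : ContDiff ℝ ∞ θ) (q : ℝ × ℝ) :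
    ddx (fun q : ℝ × ℝ => g q.1 * θ q.2) q = deriv g q.1 * θ q.2 := by
  rw [← deriv_slice_fst (contDiff_prod_mul hg hθ)]
  exact deriv_mul_const (c := g) (hg.differentiable (by simp) q.1) (θ q.2)

theorem ddt_prod_mul {g θ : ℝ → ℝ} (hg : ContDiff ℝ ∞ g) (hθ : ContDiff ℝ ∞ θ) (q : ℝ × ℝ) :
    ddt (fun q : ℝ × ℝ => g q.1 * θ q.2) q = g q.1 * deriv θ q.2 := by
  rw [← deriv_slice_snd (contDiff_prod_mul hg hθ)]
  exact deriv_const_mul (d := θ) (g q.1) (hθ.differentiable (by simp) q.2)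

/-- Two weak integrations by parts against `g(x) η(t)`. The first boundary term drops since `g`
vanishes at the endpoints, the second since the zero trace of `y` is built into the first identity
of `Y`; `g'` need not vanish. -/
theorem mom_fnxx {T : ℝ} (y : Y T) {g : ℝ → ℝ} (hg : ContDiff ℝ ∞ g) (h0 : g 0 = 0)
    (h1 : g 1 = 0) :
    ∀ᵐ t ∂volume.restrict (Ioo 0 T), mom g (y.1 2) t = mom (deriv (deriv g)) (y.1 0) t := by
  have hg1 : ContDiff ℝ ∞ (deriv g) := (contDiff_infty_iff_deriv.1 hg).2
  have hg2 : ContDiff ℝ ∞ (deriv (deriv g)) := (contDiff_infty_iff_deriv.1 hg1).2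
  have i2 := integrable_mom hg.continuous (y.1 2)
  have i0 := integrable_mom hg2.continuous (y.1 0)
  have key := ae_eq_zero_of_integral_smooth (i2.sub i0) fun η hη _ _ => by
    have e1 := (y.2 _ (contDiff_prod_mul hg hη)).2.1 fun t => by simp [h0, h1]
    have e2 := (y.2 _ (contDiff_prod_mul hg1 hη)).1
    simp only [ddx_prod_mul hg hη, ddx_prod_mul hg1 hη] at e1 e2
    rw [← setIntegral_mom_mul hg1.continuous hη.continuous,
      ← setIntegral_mom_mul hg.continuous hη.continuous] at e1
    rw [← setIntegral_mom_mul hg1.continuous hη.continuous,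
      ← setIntegral_mom_mul hg2.continuous hη.continuous] at e2
    have c : ∀ {f : ℝ → ℝ}, IntegrableOn f (Ioo 0 T) → IntegrableOn (fun t => f t * η t) (Ioo 0 T) :=
      fun hf => (IntegrableOn.mul_continuousOn (integrableOn_Icc_of_Ioo hf)
        hη.continuous.continuousOn isCompact_Icc).mono_set Ioo_subset_Icc_self
    simp only [Pi.sub_apply, sub_mul]
    rw [integral_sub (c i2) (c i0)]
    linarith
  filter_upwards [key] with t ht
  exact sub_eq_zero.1 ht

theorem mom_weakDeriv {T : ℝ} (y : Y T) {g : ℝ → ℝ} (hg : ContDiff ℝ ∞ g) {θ : ℝ → ℝ}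
    (hθ : ContDiff ℝ ∞ θ) (h0 : θ 0 = 0) (h1 : θ T = 0) :
    ∫ t in Ioo 0 T, mom g (y.1 0) t * deriv θ t = -∫ t in Ioo 0 T, mom g (y.1 3) t * θ t := by
  have e := (y.2 _ (contDiff_prod_mul hg hθ)).2.2 fun x => by simp [h0, h1]
  simp only [ddt_prod_mul hg hθ] at e
  rw [setIntegral_mom_mul hg.continuous (hθ.continuous_deriv (by simp)),
    setIntegral_mom_mul hg.continuous hθ.continuous, e]

/-- The function `t ↦ ∫ g y(·,t)` for the continuous representative. -/
noncomputable def vmom {T : ℝ} (g : ℝ → ℝ) (y : Y T) (t : ℝ) : ℝ :=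
  ∫ x in Om, g x * valueAt y t x

/-- By Fubini the formula of `valueAt` passes to moments. This is the form of `ae_eq_of_weakDeriv`,
so the moment of the pointwise values is the absolutely continuous representative of `mom`. -/
theorem vmom_eq {T : ℝ} (y : Y T) {g : ℝ → ℝ} (hg : Continuous g) {t : ℝ} (ht : 0 ≤ t) :
    vmom g y t = T⁻¹ * (∫ s in Ioo 0 T, (mom g (y.1 0) s + s * mom g (y.1 3) s)) -
      ∫ s in Ioo t T, mom g (y.1 3) s := by
  have i0 : IntegrableOn (fun q : ℝ × ℝ => g q.1 * (fn y q + q.2 * fnt y q)) (Cyl T) := by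
    refine ((integrableOn_Cyl_mul (y.1 0) (hg.comp continuous_fst)).add
      (integrableOn_Cyl_mul (y.1 3) ((hg.comp continuous_fst).mul continuous_snd))).congr
      (Eventually.of_forall fun q => ?_)
    simp only [fn, fnt, Pi.add_apply, Pi.mul_apply, Function.comp_apply]
    ring
  -- The indicator keeps the domain of integration equal to the whole cylinder, so that Fubini
  -- applies to it unchanged.
  have i3 : IntegrableOn ((univ ×ˢ Ioo t T).indicator fun q : ℝ × ℝ => g q.1 * fnt y q)
      (Cyl T) := by
    refine Integrable.indicator ?_ (MeasurableSet.univ.prod measurableSet_Ioo)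
    exact (integrableOn_Cyl_mul (y.1 3) (hg.comp continuous_fst)).congr (Eventually.of_forall fun q => mul_comm _ _)
  have e3 : ∀ x s, (univ ×ˢ Ioo t T).indicator (fun q : ℝ × ℝ => g q.1 * fnt y q) (x, s) =
      (Ioo t T).indicator (fun s => g x * fnt y (x, s)) s := fun x s => by
    simp [indicator]
  have hsub : Ioo 0 T ∩ Ioo t T = Ioo t T := inter_eq_right.2 (Ioo_subset_Ioo_left ht)
  have a1 := setIntegral_Cyl i0
  rw [setIntegral_Cyl_symm i0] at a1
  have a2 := setIntegral_Cyl i3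
  rw [setIntegral_Cyl_symm i3] at a2
  simp only [e3] at a2
  have l1 : ∫ s in Ioo 0 T, ∫ x in Om, g x * (fn y (x, s) + s * fnt y (x, s)) =
      ∫ s in Ioo 0 T, (mom g (y.1 0) s + s * mom g (y.1 3) s) := by
    refine integral_congr_ae ?_
    filter_upwards [integrableOn_Cyl_sections (integrableOn_Cyl_mul (y.1 0) (hg.comp continuous_fst)),
      integrableOn_Cyl_sections (integrableOn_Cyl_mul (y.1 3) (hg.comp continuous_fst))] with s k0 k3
    simp only [mom]
    rw [← integral_const_mul, ← integral_add]
    · exact integral_congr_ae (Eventually.of_forall fun x => by simp only [fn, fnt]; ring)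
    · exact k0.congr (Eventually.of_forall fun x => mul_comm _ _)
    · exact (k3.congr (Eventually.of_forall fun x => mul_comm _ _)).const_mul s
  have l2 : ∫ s in Ioo 0 T, ∫ x in Om, (Ioo t T).indicator (fun s => g x * fnt y (x, s)) s =
      ∫ s in Ioo t T, mom g (y.1 3) s := by
    rw [← hsub, ← setIntegral_indicator measurableSet_Ioo, hsub]
    refine integral_congr_ae (Eventually.of_forall fun s => ?_)
    by_cases hs : s ∈ Ioo t T
    · simp only [indicator_of_mem hs]
      rfl
    · simp only [indicator_of_notMem hs, integral_zero]
  simp only [setIntegral_indicator measurableSet_Ioo, hsub] at a2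
  rw [← l1, ← l2, a1]
  have a2' : ∫ s in Ioo 0 T, ∫ x in Om, (Ioo t T).indicator (fun s => g x * fnt y (x, s)) s =
    ∫ x in Om, ∫ s in Ioo t T, g x * fnt y (x, s) := a2
  rw [a2', ← integral_const_mul, ← integral_sub]
  · refine integral_congr_ae (Eventually.of_forall fun x => ?_)
    simp only [valueAt, integral_const_mul]
    ring
  · exact (integrableOn_Cyl_left i0).const_mul _
  · refine (integrableOn_Cyl_left i3).congr (Eventually.of_forall fun x => ?_)
    simp only [e3]
    rw [setIntegral_indicator measurableSet_Ioo, hsub]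

theorem isPrimitive_vmom {T : ℝ} (y : Y T) {g : ℝ → ℝ} (hg : Continuous g) :
    IsPrimitive T (vmom g y) (mom g (y.1 3)) := by
  refine ⟨integrable_mom hg _, fun t ht => ?_⟩
  rw [vmom_eq y hg ht.1, vmom_eq y hg le_rfl,
    ← setIntegral_Ioo_add ht (integrable_mom hg (y.1 3))]
  ring

theorem mom_eq_vmom {T : ℝ} (hT : 0 < T) (y : Y T) {g : ℝ → ℝ} (hg : ContDiff ℝ ∞ g) :
    ∀ᵐ t ∂volume.restrict (Ioo 0 T), mom g (y.1 0) t = vmom g y t := by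
  filter_upwards [ae_eq_of_weakDeriv hT (integrable_mom hg.continuous (y.1 0))
    (integrable_mom hg.continuous (y.1 3)) fun θ hθ h0 h1 => mom_weakDeriv y hg hθ h0 h1,
    ae_restrict_mem measurableSet_Ioo] with t ht hm
  rw [ht, vmom_eq y hg.continuous hm.1.le]

theorem L2Q_eq_zero {T : ℝ} {F : L2Q T} (h : ∀ φ : ℝ × ℝ → ℝ, ContDiff ℝ ∞ φ →
    tsupport φ ⊆ Cyl T → ∫ q in Cyl T, F q * φ q = 0) : F = 0 := by
  have ho : IsOpen (Cyl T) := isOpen_Ioo.prod isOpen_Ioo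
  have key := ho.ae_eq_zero_of_integral_contDiff_smul_eq_zero (integrableOn_Cyl F).locallyIntegrableOn
    fun φ h1 _ h3 => by
      rw [← h φ h1 h3, ← setIntegral_eq_integral_of_forall_compl_eq_zero (s := Cyl T)]
      · simp [mul_comm]
      · intro q hq
        rw [image_eq_zero_of_notMem_tsupport (fun h => hq (h3 h)), zero_smul]
  rw [Lp.eq_zero_iff_ae_eq_zero]
  rwa [EventuallyEq, ae_restrict_iff' (measurableSet_Cyl T)]

/-- The derivatives are determined by the function: test functions supported in the open cylinder
satisfy every boundary condition in the three identities. -/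
theorem Y_eq_zero {T : ℝ} {y : Y T} (h : ∀ᵐ q ∂volume.restrict (Cyl T), fn y q = 0) : y = 0 := by
  have h0 : y.1 0 = 0 := (Lp.eq_zero_iff_ae_eq_zero).2 h
  have hb : ∀ {φ : ℝ × ℝ → ℝ}, tsupport φ ⊆ Cyl T → ∀ q, q ∉ Cyl T → φ q = 0 :=
    fun h q hq => image_eq_zero_of_notMem_tsupport fun k => hq (h k)
  have h1 : y.1 1 = 0 := L2Q_eq_zero fun φ hφ _ => by
    have e := (y.2 φ hφ).1
    rw [h0, pair_zero] at e
    linarith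
  have h2 : y.1 2 = 0 := L2Q_eq_zero fun φ hφ hs => by
    have e := (y.2 φ hφ).2.1 fun t => ⟨hb hs _ fun hq => lt_irrefl _ hq.1.1,
      hb hs _ fun hq => lt_irrefl _ hq.1.2⟩
    rw [h1, pair_zero] at e
    linarith
  have h3 : y.1 3 = 0 := L2Q_eq_zero fun φ hφ hs => by
    have e := (y.2 φ hφ).2.2 fun t => ⟨hb hs _ fun hq => lt_irrefl _ hq.2.1,
      hb hs _ fun hq => lt_irrefl _ hq.2.2⟩
    rw [h0, pair_zero] at e
    linarith
  refine Subtype.ext (PiLp.ext fun i => ?_)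
  fin_cases i
  exacts [h0, h1, h2, h3]

end HeatControl

namespace HeatExample
open HeatControl

/-- There are countably many modes, so for almost every `t` all coefficients vanish at once and
completeness applies to the section. -/
theorem ae_eq_zero_of_mom_ek {T : ℝ} {F : L2Q T}
    (h : ∀ k, ∀ᵐ t ∂volume.restrict (Ioo 0 T), mom (ek k) F t = 0) :
    ∀ᵐ q ∂volume.restrict (Cyl T), F q = 0 := by
  refine ae_of_ae_sections_symm (G := fun _ => 0) (Lp.aestronglyMeasurable F)
    aestronglyMeasurable_const ?_
  filter_upwards [ae_all_iff.2 h, integrableOn_Cyl_sections (integrableOn_Cyl F)] with t h1 h2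
  exact ae_eq_zero_of_integral_ek h2 h1

end HeatExample

namespace HeatExample
open HeatControl

/-! ### The functions of time in the example -/

theorem data_T : data.T = 3 := rfl

theorem data_T_pos : 0 < data.T := by norm_num [data_T]

theorem log_two_lt_one : Real.log 2 < 1 := Real.log_two_lt_d9.trans (by norm_num)

theorem half_lt_log_two : 1 / 2 < Real.log 2 := lt_trans (by norm_num) Real.log_two_gt_d9

theorem exp_lt_two {t : ℝ} (h : t < Real.log 2) : Real.exp t < 2 :=
  (Real.lt_log_iff_exp_lt two_pos).1 h

theorem two_le_exp {t : ℝ} (h : Real.log 2 ≤ t) : 2 ≤ Real.exp t :=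
  (Real.log_le_iff_le_exp two_pos).1 h

theorem nine_lt_pi_sq : 9 < Real.pi ^ 2 := by nlinarith [Real.pi_gt_three]

theorem pi_sq_lt : Real.pi ^ 2 < 16 := by nlinarith [Real.pi_pos, Real.pi_lt_four]

theorem cases_time {t : ℝ} (ht : t ∈ Ioo 0 data.T \ {Real.log 2, 1, 2}) :
    t ∈ Ioo 0 (Real.log 2) ∨ t ∈ Ioo (Real.log 2) 1 ∨ t ∈ Ioo 1 2 ∨ t ∈ Ioo 2 3 := by
  obtain ⟨⟨h0, h3⟩, hn⟩ := ht
  rw [data_T] at h3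
  simp only [mem_insert_iff, mem_singleton_iff, not_or] at hn
  obtain ⟨n1, n2, n3⟩ := hn
  rcases lt_or_gt_of_ne n1 with h | h
  · exact Or.inl ⟨h0, h⟩
  rcases lt_or_gt_of_ne n2 with h' | h'
  · exact Or.inr (Or.inl ⟨h, h'⟩)
  rcases lt_or_gt_of_ne n3 with h'' | h''
  · exact Or.inr (Or.inr (Or.inl ⟨h', h''⟩))
  · exact Or.inr (Or.inr (Or.inr ⟨h'', h3⟩))

theorem countable_junctions : ({Real.log 2, 1, 2} : Set ℝ).Countable := (toFinite _).countable

theorem ydhat_of_lt {t : ℝ} (h : t < Real.log 2) : ydhat t = 1.5 * Real.exp t := by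
  simp [ydhat, h]

theorem ydhat_of_lt_one {t : ℝ} (h : Real.log 2 ≤ t) (h' : t < 1) : ydhat t = 3 := by
  simp [ydhat, h.not_gt, h']

theorem ydhat_of_one_le {t : ℝ} (h : 1 ≤ t) : ydhat t = 4 - t := by
  simp [ydhat, h.not_gt, (log_two_lt_one.le.trans h).not_gt]

theorem ybar1_of_lt {t : ℝ} (h : t < Real.log 2) : ybar1 t = Real.exp t := by
  simp [ybar1, h]

theorem ybar1_of_lt_two {t : ℝ} (h : Real.log 2 ≤ t) (h' : t < 2) : ybar1 t = 2 := by
  simp [ybar1, h.not_gt, h']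

theorem ybar1_of_two_le {t : ℝ} (h : 2 ≤ t) : ybar1 t = 4 - t := by
  simp [ybar1, h.not_gt, ((log_two_lt_one.trans one_lt_two).le.trans h).not_gt]

theorem ubar_of_lt {t : ℝ} (h : t < Real.log 2) : ubar t = Real.pi ^ 2 + 1 := by
  simp [ubar, h]

theorem ubar_of_lt_two {t : ℝ} (h : Real.log 2 ≤ t) (h' : t < 2) : ubar t = Real.pi ^ 2 := by
  simp [ubar, h.not_gt, h']

theorem ubar_of_two_le {t : ℝ} (h : 2 ≤ t) : ubar t = Real.pi ^ 2 - 1 / (4 - t) := by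
  simp [ubar, h.not_gt, ((log_two_lt_one.trans one_lt_two).le.trans h).not_gt,
    ydhat_of_one_le (one_le_two.trans h)]

theorem measurable_ydhat : Measurable ydhat :=
  Measurable.ite measurableSet_Iio (by fun_prop)
    (Measurable.ite measurableSet_Iio (by fun_prop) (by fun_prop))

theorem measurable_ubar : Measurable ubar :=
  Measurable.ite measurableSet_Iio (by fun_prop)
    (Measurable.ite measurableSet_Iio (by fun_prop)
      (measurable_const.sub (measurable_const.div measurable_ydhat)))

theorem ydhat_bound {t : ℝ} (ht : t ∈ Ioo 0 data.T) : |ydhat t| ≤ 3 := by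
  have h3 : t < 3 := ht.2
  rw [abs_le]
  rcases lt_or_ge t (Real.log 2) with h | h
  · rw [ydhat_of_lt h]
    constructor <;> linarith [exp_lt_two h, Real.exp_pos t]
  rcases lt_or_ge t 1 with h' | h'
  · rw [ydhat_of_lt_one h h']
    norm_num
  · rw [ydhat_of_one_le h']
    constructor <;> linarith

theorem inv_bound {t : ℝ} (h' : t ≤ 3) : 0 < 1 / (4 - t) ∧ 1 / (4 - t) ≤ 1 := by
  have : 1 ≤ 4 - t := by linarith
  exact ⟨by positivity, by rw [div_le_one (by linarith)]; exact this⟩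

theorem ubar_mem {t : ℝ} (ht : t ≤ 3) : Real.pi ^ 2 - 1 ≤ ubar t ∧ ubar t ≤ Real.pi ^ 2 + 1 := by
  rcases lt_or_ge t (Real.log 2) with h | h
  · rw [ubar_of_lt h]
    constructor <;> linarith
  rcases lt_or_ge t 2 with h' | h'
  · rw [ubar_of_lt_two h h']
    constructor <;> linarith
  · rw [ubar_of_two_le h']
    have := inv_bound ht
    constructor <;> linarith

theorem ubar_le_pi_sq {t : ℝ} (h : Real.log 2 ≤ t) (h' : t ≤ 3) : ubar t ≤ Real.pi ^ 2 := by
  rcases lt_or_ge t 2 with h2 | h2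
  · rw [ubar_of_lt_two h h2]
  · rw [ubar_of_two_le h2]
    linarith [(inv_bound h').1]

/-- Written as a minimum, the piecewise function is visibly continuous and bounded by `2`. -/
theorem ybar1_eq_min (t : ℝ) : ybar1 t = min (Real.exp t) (min 2 (4 - t)) := by
  have := log_two_lt_one
  rcases lt_or_ge t (Real.log 2) with h | h
  · rw [ybar1_of_lt h, min_eq_left (a := (2 : ℝ)) (by linarith), min_eq_left (exp_lt_two h).le]
  rcases lt_or_ge t 2 with h' | h'
  · rw [ybar1_of_lt_two h h', min_eq_left (a := (2 : ℝ)) (by linarith), min_eq_right (two_le_exp h)]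
  · rw [ybar1_of_two_le h', min_eq_right (a := (2 : ℝ)) (by linarith),
      min_eq_right (by linarith [two_le_exp h])]

theorem continuous_ybar1 : Continuous ybar1 := by
  rw [show ybar1 = _ from funext ybar1_eq_min]
  fun_prop

theorem ybar1_mem {t : ℝ} (ht : t ∈ Icc 0 data.T) : 1 ≤ ybar1 t ∧ ybar1 t ≤ 2 := by
  have h3 : t ≤ 3 := ht.2
  rw [ybar1_eq_min]
  exact ⟨le_min (Real.one_le_exp ht.1) (le_min one_le_two (by linarith)),
    (min_le_right _ _).trans (min_le_left _ _)⟩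

theorem ybar1_zero : ybar1 0 = 1 := by
  rw [ybar1_of_lt (by linarith [half_lt_log_two]), Real.exp_zero]

theorem ybar1_three : ybar1 data.T = 1 := by
  rw [data_T, ybar1_of_two_le (by norm_num)]
  norm_num

/-- The derivative of `ybar1`. -/
noncomputable def dybar1 (t : ℝ) : ℝ := if t < Real.log 2 then Real.exp t else if t < 2 then 0 else -1

theorem dybar1_of_lt {t : ℝ} (h : t < Real.log 2) : dybar1 t = Real.exp t := by
  simp [dybar1, h]

theorem dybar1_of_lt_two {t : ℝ} (h : Real.log 2 ≤ t) (h' : t < 2) : dybar1 t = 0 := by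
  simp [dybar1, h.not_gt, h']

theorem dybar1_of_two_le {t : ℝ} (h : 2 ≤ t) : dybar1 t = -1 := by
  simp [dybar1, h.not_gt, ((log_two_lt_one.trans one_lt_two).le.trans h).not_gt]

theorem measurable_dybar1 : Measurable dybar1 :=
  Measurable.ite measurableSet_Iio (by fun_prop)
    (Measurable.ite measurableSet_Iio (by fun_prop) (by fun_prop))

/-- This is the state equation in the first mode: `-c1'' = π² c1` turns it into `y' = (u - π²) y`.
-/
theorem dybar1_eq {t : ℝ} (ht : t ≤ 3) : dybar1 t = (ubar t - Real.pi ^ 2) * ybar1 t := by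
  rcases lt_or_ge t (Real.log 2) with h | h
  · rw [dybar1_of_lt h, ubar_of_lt h, ybar1_of_lt h]
    ring
  rcases lt_or_ge t 2 with h' | h'
  · rw [dybar1_of_lt_two h h', ubar_of_lt_two h h']
    ring
  · rw [dybar1_of_two_le h', ubar_of_two_le h', ybar1_of_two_le h']
    have : (4 - t) ≠ 0 := by linarith
    field_simp
    ring

theorem dybar1_bound (t : ℝ) : |dybar1 t| ≤ 2 := by
  rcases lt_or_ge t (Real.log 2) with h | h
  · rw [dybar1_of_lt h, abs_of_pos (Real.exp_pos t)]
    exact (exp_lt_two h).le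
  rcases lt_or_ge t 2 with h' | h'
  · rw [dybar1_of_lt_two h h']
    simp
  · rw [dybar1_of_two_le h']
    simp

theorem integrableOn_of_bound {a b C : ℝ} {f : ℝ → ℝ} (hf : Measurable f)
    (h : ∀ t ∈ Ioo a b, |f t| ≤ C) : IntegrableOn f (Ioo a b) :=
  Integrable.of_bound hf.aestronglyMeasurable C (by
    filter_upwards [ae_restrict_mem measurableSet_Ioo] with t ht using h t ht)

theorem hasDerivAt_of_eqOn_Ioo {a b t l : ℝ} {f g : ℝ → ℝ} (hg : HasDerivAt g l t)
    (ht : t ∈ Ioo a b) (h : ∀ s ∈ Ioo a b, f s = g s) : HasDerivAt f l t :=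
  hg.congr_of_eventuallyEq (mem_of_superset (Ioo_mem_nhds ht.1 ht.2) h)

theorem hasDerivAt_ybar1 {t : ℝ} (ht : t ∈ Ioo 0 data.T \ {Real.log 2, 1, 2}) :
    HasDerivAt ybar1 (dybar1 t) t := by
  have hl := log_two_lt_one
  rcases cases_time ht with h | h | h | h
  · rw [dybar1_of_lt h.2]
    exact hasDerivAt_of_eqOn_Ioo (Real.hasDerivAt_exp t) h fun s hs => ybar1_of_lt hs.2
  · rw [dybar1_of_lt_two h.1.le (by linarith [h.2])]
    exact hasDerivAt_of_eqOn_Ioo (hasDerivAt_const t 2) h fun s hs =>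
      ybar1_of_lt_two hs.1.le (by linarith [hs.2])
  · rw [dybar1_of_lt_two (by linarith [h.1]) h.2]
    exact hasDerivAt_of_eqOn_Ioo (hasDerivAt_const t 2) h fun s hs =>
      ybar1_of_lt_two (by linarith [hs.1]) hs.2
  · rw [dybar1_of_two_le h.1.le]
    exact hasDerivAt_of_eqOn_Ioo ((hasDerivAt_id t).const_sub 4) h fun s hs =>
      ybar1_of_two_le hs.1.le

theorem isPrimitive_ybar1 : IsPrimitive data.T ybar1 dybar1 :=
  isPrimitive_of_hasDerivAt countable_junctions continuous_ybar1.continuousOn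
    (fun _ ht => hasDerivAt_ybar1 ht) (integrableOn_of_bound measurable_dybar1 fun t _ => dybar1_bound t)

/-- The derivative of `-t ȳ1` is `(ū - π²)(-t ȳ1) - ȳ1`, so `-t ȳ1 c1` is the linearized state for
the control variation `-1`. It is the witness for the qualification condition. -/
theorem isPrimitive_neg_mul_ybar1 :
    IsPrimitive data.T (fun t => -t * ybar1 t) (fun t => -ybar1 t - t * dybar1 t) := by
  refine isPrimitive_of_hasDerivAt countable_junctions
    (continuous_neg.mul continuous_ybar1).continuousOn (fun t ht => ?_)
    (integrableOn_of_bound (C := 8)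
      (continuous_ybar1.measurable.neg.sub (measurable_id.mul measurable_dybar1)) fun t ht => ?_)
  · have h : HasDerivAt (fun t => -t * ybar1 t) (-1 * ybar1 t + -t * dybar1 t) t :=
      (hasDerivAt_id t).neg.mul (hasDerivAt_ybar1 ht)
    exact h.congr_deriv (by ring)
  · have h1 := ybar1_mem (Ioo_subset_Icc_self ht)
    have h2 := abs_le.1 (dybar1_bound t)
    have h3 : t < 3 := ht.2
    have h0 := ht.1
    rw [abs_le]
    constructor <;> nlinarith

/-! ### The multiplier -/

/-- The coefficient of the costate. -/
noncomputable def pcoef (t : ℝ) : ℝ := min ((Real.exp t - 4 * Real.exp (-t)) / 4) 0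

theorem exp_mul_exp_neg (t : ℝ) : Real.exp t * Real.exp (-t) = 1 := by
  rw [← Real.exp_add, add_neg_cancel, Real.exp_zero]

/-- On this interval `ū - π² = 1` and `ŷ_d - ȳ1 = e^t / 2`. The expression is the solution of `p' =
e^t / 2 - p` that vanishes at `log 2`, where the minimum changes branch. -/
theorem pcoef_of_lt {t : ℝ} (h : t < Real.log 2) :
    pcoef t = (Real.exp t - 4 * Real.exp (-t)) / 4 := by
  have h1 := exp_lt_two h
  have h2 := exp_mul_exp_neg t
  have h3 := Real.exp_pos t
  exact min_eq_left (by nlinarith [Real.exp_pos (-t)])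

theorem pcoef_neg {t : ℝ} (h : t < Real.log 2) : pcoef t < 0 := by
  rw [pcoef_of_lt h]
  have h1 := exp_lt_two h
  have h2 := exp_mul_exp_neg t
  have h3 := Real.exp_pos t
  nlinarith [Real.exp_pos (-t)]

theorem pcoef_of_le {t : ℝ} (h : Real.log 2 ≤ t) : pcoef t = 0 := by
  have h1 := two_le_exp h
  have h2 := exp_mul_exp_neg t
  have h3 := Real.exp_pos t
  exact min_eq_right (by nlinarith [Real.exp_pos (-t)])

theorem continuous_pcoef : Continuous pcoef := by
  unfold pcoef
  fun_prop

/-- The density of `dμ` is `1` on `(log 2, 1)`, `2 - t` on `(1,2)`, and `0` elsewhere. -/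
noncomputable def muFun (t : ℝ) : ℝ :=
  -(1 - max (Real.log 2) (min t 1)) - (2 - max 1 (min t 2)) ^ 2 / 2

theorem continuous_muFun : Continuous muFun := by
  unfold muFun
  fun_prop

theorem monotone_muFun : Monotone muFun := by
  intro s t h
  have h1 : max (Real.log 2) (min s 1) ≤ max (Real.log 2) (min t 1) := by gcongr
  have h2 : max 1 (min s 2) ≤ max 1 (min t 2) := by gcongr
  have h3 : max 1 (min t 2) ≤ 2 := max_le one_le_two (min_le_right _ _)
  simp only [muFun]
  nlinarith

/-- The function is continuous, so the measure has no atom, in particular none at `log 2` or at `T`.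
-/
noncomputable def mubar : StieltjesFunction ℝ where
  toFun := muFun
  mono' := monotone_muFun
  right_continuous' := fun _ => continuous_muFun.continuousWithinAt

theorem muFun_of_le {t : ℝ} (h : t ≤ Real.log 2) : muFun t = Real.log 2 - 3 / 2 := by
  have := log_two_lt_one
  rw [muFun, min_eq_left (by linarith), max_eq_left h, min_eq_left (by linarith),
    max_eq_left (by linarith)]
  ring

theorem muFun_of_le_one {t : ℝ} (h : Real.log 2 ≤ t) (h' : t ≤ 1) : muFun t = t - 3 / 2 := by
  rw [muFun, min_eq_left h', max_eq_right h, min_eq_left (by linarith), max_eq_left h']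
  ring

theorem muFun_of_le_two {t : ℝ} (h : 1 ≤ t) (h' : t ≤ 2) : muFun t = -(2 - t) ^ 2 / 2 := by
  rw [muFun, min_eq_right h, max_eq_right log_two_lt_one.le, min_eq_left h', max_eq_right h]
  ring

theorem muFun_of_two_le {t : ℝ} (h : 2 ≤ t) : muFun t = 0 := by
  rw [muFun, min_eq_right (by linarith), max_eq_right log_two_lt_one.le, min_eq_right h,
    max_eq_right one_le_two]
  ring

/-- The derivative of `pcoef + μ`. -/
noncomputable def dsum (t : ℝ) : ℝ :=
  ydhat t - ybar1 t - (ubar t - Real.pi ^ 2) * pcoef t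

theorem dsum_of_lt {t : ℝ} (h : t < Real.log 2) :
    dsum t = (Real.exp t + 4 * Real.exp (-t)) / 4 := by
  rw [dsum, ydhat_of_lt h, ybar1_of_lt h, ubar_of_lt h, pcoef_of_lt h]
  ring

theorem dsum_of_le {t : ℝ} (h : Real.log 2 ≤ t) : dsum t = ydhat t - ybar1 t := by
  rw [dsum, pcoef_of_le h]
  ring

theorem measurable_dsum : Measurable dsum :=
  (measurable_ydhat.sub continuous_ybar1.measurable).sub
    ((measurable_ubar.sub_const _).mul continuous_pcoef.measurable)

theorem pcoef_bound {t : ℝ} (ht : 0 ≤ t) : |pcoef t| ≤ 1 := by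
  rcases lt_or_ge t (Real.log 2) with h | h
  · rw [pcoef_of_lt h, abs_le]
    have h1 := exp_lt_two h
    have h4 := Real.one_le_exp ht
    have h5 : Real.exp (-t) ≤ 1 := Real.exp_le_one_iff.2 (by linarith)
    have h6 := Real.exp_pos (-t)
    constructor <;> linarith
  · simp [pcoef_of_le h]

theorem dsum_bound {t : ℝ} (ht : t ∈ Ioo 0 data.T) : |dsum t| ≤ 6 := by
  have h1 := abs_le.1 (ydhat_bound ht)
  have h2 := ybar1_mem (Ioo_subset_Icc_self ht)
  have h3 := abs_le.1 (pcoef_bound ht.1.le)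
  have h4 := ubar_mem (t := t) ht.2.le
  rw [dsum, abs_le]
  constructor <;> nlinarith

theorem hasDerivAt_sum {t : ℝ} (ht : t ∈ Ioo 0 data.T \ {Real.log 2, 1, 2}) :
    HasDerivAt (fun t => pcoef t + muFun t) (dsum t) t := by
  have hl := log_two_lt_one
  rcases cases_time ht with h | h | h | h
  · rw [dsum_of_lt h.2]
    have hd : HasDerivAt (fun s => (Real.exp s - 4 * Real.exp (-s)) / 4 + (Real.log 2 - 3 / 2))
        ((Real.exp t - 4 * (Real.exp (-t) * -1)) / 4) t :=
      (((Real.hasDerivAt_exp t).sub (((hasDerivAt_id t).neg.exp).const_mul 4)).div_const 4).add_const _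
    convert hasDerivAt_of_eqOn_Ioo hd h (f := fun t => pcoef t + muFun t)
      (fun s hs => by rw [pcoef_of_lt hs.2, muFun_of_le hs.2.le]) using 1
    ring
  · rw [dsum_of_le h.1.le, ydhat_of_lt_one h.1.le h.2, ybar1_of_lt_two h.1.le (by linarith [h.2])]
    convert hasDerivAt_of_eqOn_Ioo ((hasDerivAt_id t).sub_const (3 / 2)) h
      (f := fun t => pcoef t + muFun t)
      (fun s hs => by rw [pcoef_of_le hs.1.le, muFun_of_le_one hs.1.le hs.2.le]; simp) using 1
    norm_num
  · rw [dsum_of_le (by linarith [h.1]), ydhat_of_one_le h.1.le,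
      ybar1_of_lt_two (by linarith [h.1]) h.2]
    have hd : HasDerivAt (fun s : ℝ => -(2 - s) ^ 2 / 2)
        (-((2 : ℕ) * (2 - t) ^ (2 - 1) * (-1)) / 2) t :=
      (((hasDerivAt_id t).const_sub 2).pow 2).neg.div_const 2
    convert hasDerivAt_of_eqOn_Ioo hd h (f := fun t => pcoef t + muFun t)
      (fun s hs => by
        rw [pcoef_of_le (by linarith [hs.1]), muFun_of_le_two hs.1.le hs.2.le, zero_add]) using 1
    norm_num
    ring
  · rw [dsum_of_le (by linarith [h.1]), ydhat_of_one_le (by linarith [h.1]),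
      ybar1_of_two_le h.1.le]
    convert hasDerivAt_of_eqOn_Ioo (hasDerivAt_const t (0 : ℝ)) h
      (f := fun t => pcoef t + muFun t)
      (fun s hs => by
        rw [pcoef_of_le (by linarith [hs.1]), muFun_of_two_le hs.1.le, zero_add]) using 1
    ring

/-- The adjoint equation `-p' = (ū - π²) p + ȳ1 - ŷ_d + μ'` determines the derivative of the sum `p
+ μ`, which is why the two functions are kept together. -/
theorem isPrimitive_sum : IsPrimitive data.T (fun t => pcoef t + muFun t) dsum :=
  isPrimitive_of_hasDerivAt countable_junctions (continuous_pcoef.add continuous_muFun).continuousOn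
    (fun _ ht => hasDerivAt_sum ht) (integrableOn_of_bound measurable_dsum fun _ ht => dsum_bound ht)

theorem sum_three : pcoef data.T + muFun data.T = 0 := by
  rw [data_T, pcoef_of_le (by linarith [log_two_lt_one]), muFun_of_two_le (by norm_num), add_zero]

end HeatExample

namespace HeatExample
open HeatControl

/-! ### The state equation -/

theorem opA_eq (u : ℝ → ℝ) (y z : Y data.T) (q : ℝ × ℝ) :
    opA data u y z q = -fnxx z q - u q.2 * fn z q := by
  simp [opA, data]

theorem B1_eq (y : Y data.T) (q : ℝ × ℝ) : B1 data y q = 0 := by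
  simp [B1, data]

theorem mom_deriv_deriv_ek {T : ℝ} (k : ℕ) (F : L2Q T) (t : ℝ) :
    mom (deriv (deriv (ek k))) F t = -(k * Real.pi) ^ 2 * mom (ek k) F t := by
  simp only [mom, deriv_deriv_ek, ← integral_const_mul]
  exact integral_congr_ae (Eventually.of_forall fun x => by ring)

/-- The coefficient of the control depends on time only, so the modes decouple and each coefficient
sees a scalar first order operator. -/
theorem mom_opA (u : ℝ → ℝ) (y z : Y data.T) (k : ℕ) :
    ∀ᵐ t ∂volume.restrict (Ioo 0 data.T),
      IntegrableOn (fun x => ek k x * (fnt z (x, t) + opA data u y z (x, t))) Om ∧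
      ∫ x in Om, ek k x * (fnt z (x, t) + opA data u y z (x, t)) =
        mom (ek k) (z.1 3) t + ((k * Real.pi) ^ 2 - u t) * mom (ek k) (z.1 0) t := by
  have hc : Continuous fun q : ℝ × ℝ => ek k q.1 := (contDiff_ek k).continuous.comp continuous_fst
  filter_upwards [mom_fnxx z (contDiff_ek k) (ek_zero k) (ek_one k),
    integrableOn_Cyl_sections (integrableOn_Cyl_mul (z.1 0) hc),
    integrableOn_Cyl_sections (integrableOn_Cyl_mul (z.1 2) hc),
    integrableOn_Cyl_sections (integrableOn_Cyl_mul (z.1 3) hc)] with t h2 i0 i2 i3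
  have e : ∀ x, ek k x * (fnt z (x, t) + opA data u y z (x, t)) =
      z.1 3 (x, t) * ek k x - z.1 2 (x, t) * ek k x - u t * (z.1 0 (x, t) * ek k x) := fun x => by
    rw [opA_eq]
    simp only [fn, fnt, fnxx]
    ring
  have m : ∀ F : L2Q data.T, ∫ x in Om, F (x, t) * ek k x = mom (ek k) F t := fun F =>
    integral_congr_ae (Eventually.of_forall fun x => mul_comm _ _)
  have i32 : IntegrableOn (fun x => z.1 3 (x, t) * ek k x - z.1 2 (x, t) * ek k x) Om := i3.sub i2
  simp only [e]
  refine ⟨i32.sub (i0.const_mul _), ?_⟩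
  rw [integral_sub i32 (i0.const_mul _), integral_sub i3 i2, integral_const_mul, m, m, m, h2,
    mom_deriv_deriv_ek]
  ring

theorem coef_bound (k : ℕ) {t : ℝ} (ht : t ∈ Ioo 0 data.T) :
    |ubar t - (k * Real.pi) ^ 2| ≤ 17 + (k * Real.pi) ^ 2 := by
  have h := ubar_mem (t := t) ht.2.le
  have h1 := nine_lt_pi_sq
  have h2 := pi_sq_lt
  have h3 : 0 ≤ (k * Real.pi) ^ 2 := sq_nonneg _
  rw [abs_le]
  constructor <;> linarith

theorem measurable_coef (k : ℕ) : Measurable fun t => ubar t - (k * Real.pi) ^ 2 :=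
  measurable_ubar.sub_const _

/-- The homogeneous linearized equation has only the trivial solution. -/
theorem eq_zero_of_linearized {y z : Y data.T}
    (h : ∀ᵐ q ∂volume.restrict (Cyl data.T), fnt z q + opA data ubar y z q = 0)
    (h0 : ∀ᵐ x ∂volume.restrict Om, valueAt z 0 x = 0) : z = 0 := by
  refine Y_eq_zero (ae_eq_zero_of_mom_ek fun k => ?_)
  have hg := (contDiff_ek k).continuous
  have v0 : vmom (ek k) z 0 = 0 := by
    rw [vmom]
    refine integral_eq_zero_of_ae ?_
    filter_upwards [h0] with x hx
    simp [hx]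
  have e : ∀ᵐ t ∂volume.restrict (Ioo 0 data.T),
      mom (ek k) (z.1 3) t = (ubar t - (k * Real.pi) ^ 2) * mom (ek k) (z.1 0) t := by
    filter_upwards [ae_sections_symm h, mom_opA ubar y z k] with t h1 h2
    have h3 : ∫ x in Om, ek k x * (fnt z (x, t) + opA data ubar y z (x, t)) = 0 := by
      refine integral_eq_zero_of_ae ?_
      filter_upwards [h1] with x hx
      simp [hx]
    linarith [h2.2]
  refine volterra_forward (a := fun t => ubar t - (k * Real.pi) ^ 2) (integrable_mom hg _)
    (measurable_coef k).aestronglyMeasurable (fun t ht => coef_bound k ht) ?_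
  filter_upwards [mom_eq_vmom data_T_pos z (contDiff_ek k), ae_restrict_mem measurableSet_Ioo]
    with t h1 h2
  rw [h1, (isPrimitive_vmom z hg).2 t (Ioo_subset_Icc_self h2), v0, zero_add]
  exact integral_congr_ae (ae_restrict_of_ae_restrict_of_subset (Ioo_subset_Ioo_right h2.2.le) e)

theorem exists_ybar : ∃ y : Y data.T, IsSep y c1 ybar1 dybar1 :=
  exists_isSep data_T_pos.le contDiff_c1 (by simp [c1]) (by simp [c1]) isPrimitive_ybar1
    fun t _ => dybar1_bound t

theorem deriv_deriv_c1 (x : ℝ) : deriv (deriv c1) x = -Real.pi ^ 2 * c1 x := by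
  rw [c1_eq, deriv_deriv_ek]
  simp

variable {yb : Y data.T}

theorem isState_ybar (h : IsSep yb c1 ybar1 dybar1) : IsState data ubar yb := by
  refine ⟨?_, ?_⟩
  · filter_upwards [h.fn_eq, h.fnxx_eq, h.fnt_eq, ae_restrict_mem (measurableSet_Cyl data.T)]
      with q h1 h2 h3 hq
    have hq' : q.2 < 3 := hq.2.2
    rw [h1, h2, h3, deriv_deriv_c1, dybar1_eq hq'.le]
    simp only [data]
    ring
  · filter_upwards [h.valueAt_eq data_T_pos isPrimitive_ybar1 ⟨le_rfl, data_T_pos.le⟩] with x hx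
    rw [hx, ybar1_zero, mul_one]
    rfl

/-- With `γ = 0` and `f = 0` the state equation is linear and homogeneous, and the difference of two
solutions solves the homogeneous linearized equation with zero initial value. -/
theorem isState_iff (h : IsSep yb c1 ybar1 dybar1) (y : Y data.T) :
    IsState data ubar y ↔ y = yb := by
  refine ⟨fun hy => ?_, fun hy => hy ▸ isState_ybar h⟩
  have hb := isState_ybar h
  have key : y + (-1 : ℝ) • yb = 0 := by
    refine eq_zero_of_linearized (y := yb) ?_ ?_
    · filter_upwards [hy.1, hb.1, Lp.coeFn_add (y.1 0) ((-1 : ℝ) • yb.1 0),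
        Lp.coeFn_add (y.1 2) ((-1 : ℝ) • yb.1 2), Lp.coeFn_add (y.1 3) ((-1 : ℝ) • yb.1 3),
        Lp.coeFn_smul (-1 : ℝ) (yb.1 0), Lp.coeFn_smul (-1 : ℝ) (yb.1 2),
        Lp.coeFn_smul (-1 : ℝ) (yb.1 3)] with q e1 e2 a0 a2 a3 s0 s2 s3
      have k0 : fn (y + (-1 : ℝ) • yb) q = fn y q + (-1) * fn yb q := by
        refine a0.trans ?_
        rw [Pi.add_apply, s0]
        rfl
      have k2 : fnxx (y + (-1 : ℝ) • yb) q = fnxx y q + (-1) * fnxx yb q := by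
        refine a2.trans ?_
        rw [Pi.add_apply, s2]
        rfl
      have k3 : fnt (y + (-1 : ℝ) • yb) q = fnt y q + (-1) * fnt yb q := by
        refine a3.trans ?_
        rw [Pi.add_apply, s3]
        rfl
      rw [opA_eq, k0, k2, k3]
      have e1' : fnt y q - fnxx y q + 0 * fn y q ^ 3 = 0 + fn y q * (0 + ubar q.2 * 1) := e1
      have e2' : fnt yb q - fnxx yb q + 0 * fn yb q ^ 3 = 0 + fn yb q * (0 + ubar q.2 * 1) := e2
      linear_combination e1' - e2'
    · filter_upwards [at_zero_add y ((-1 : ℝ) • yb), at_zero_smul (-1 : ℝ) yb, hy.2, hb.2]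
        with x h1 h2 h3 h4
      rw [h1, h2, h3, h4]
      ring
  have h2 := eq_neg_of_add_eq_zero_left key
  simpa using h2

/-- `B¹ = 0` because `f = 0`, `γ = 0` and `b` is constant. The form is thereby reduced to the
variables `(w, h)`. -/
theorem isGoh_iff (w : L2T data.T) (ζ : Y data.T) : IsGoh data ubar yb w ζ ↔ ζ = 0 := by
  refine ⟨fun hz => eq_zero_of_linearized (y := yb) ?_ hz.2, fun hz => ?_⟩
  · filter_upwards [hz.1] with q hq
    rw [hq, B1_eq, zero_mul]
  · have h0 : IsGoh data ubar yb 0 0 := (GohSpace data ubar yb).zero_mem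
    subst hz
    refine ⟨?_, h0.2⟩
    filter_upwards [h0.1] with q hq
    rw [hq, B1_eq, zero_mul, zero_mul]

theorem gfun_eq {z : Y data.T} {Z ζ : ℝ → ℝ} (h : IsSep z c1 Z ζ) (hZ : IsPrimitive data.T Z ζ)
    {t : ℝ} (ht : t ∈ Icc 0 data.T) : ∫ x in Om, data.c x * valueAt z t x = Z t := by
  have e : ∫ x in Om, data.c x * valueAt z t x = ∫ x in Om, c1 x * c1 x * Z t := by
    refine integral_congr_ae ?_
    filter_upwards [h.valueAt_eq data_T_pos hZ ht] with x hx
    rw [hx, mul_assoc]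
    rfl
  rw [e, integral_mul_const, integral_c1_sq, one_mul]

theorem gfun_ybar (h : IsSep yb c1 ybar1 dybar1) {t : ℝ} (ht : t ∈ Icc 0 data.T) :
    gfun data yb t = ybar1 t - 2 := by
  rw [gfun, gfun_eq h isPrimitive_ybar1 ht]
  simp [data, sub_eq_add_neg]

theorem contactC_eq (h : IsSep yb c1 ybar1 dybar1) :
    contactC data yb = Icc (Real.log 2) 2 := by
  have hl := half_lt_log_two
  ext t
  simp only [contactC, stateActive, mem_ofPred_eq]
  constructor
  · rintro ⟨ht, h0⟩
    rw [gfun_ybar h ht] at h0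
    refine ⟨?_, ?_⟩
    · by_contra! hlt
      rw [ybar1_of_lt hlt] at h0
      linarith [exp_lt_two hlt]
    · by_contra! hlt
      rw [ybar1_of_two_le hlt.le] at h0
      linarith
  · intro ht
    have ht' : t ∈ Icc 0 data.T := ⟨by linarith [ht.1], by rw [data_T]; linarith [ht.2]⟩
    refine ⟨ht', ?_⟩
    rw [gfun_ybar h ht']
    rcases lt_or_eq_of_le ht.2 with h2 | h2
    · rw [ybar1_of_lt_two ht.1 h2, sub_self]
    · rw [ybar1_of_two_le h2.ge, h2]
      norm_num

theorem isAdmissible (h : IsSep yb c1 ybar1 dybar1) : IsAdmissible data ubar yb := by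
  have hp := nine_lt_pi_sq
  have hb : ∀ t ∈ Ioo 0 data.T, |ubar t| ≤ 17 := fun t ht => by
    have := ubar_mem (t := t) ht.2.le
    have := pi_sq_lt
    rw [abs_le]
    constructor <;> linarith
  refine ⟨⟨?_, ?_⟩, isState_ybar h, fun t ht => ?_⟩
  · refine MemLp.of_bound measurable_ubar.aestronglyMeasurable 17 ?_
    filter_upwards [ae_restrict_mem measurableSet_Ioo] with t ht using hb t ht
  · filter_upwards [ae_restrict_mem measurableSet_Ioo] with t ht
    have := ubar_mem (t := t) ht.2.le
    exact ⟨by simp only [data]; linarith, this.2⟩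
  · rw [gfun_ybar h ht]
    linarith [(ybar1_mem ht).2]

/-! ### The setting -/

/-- A nonempty open interval has positive measure. This converts almost everywhere activity on an
arc into activity at an actual point. -/
theorem nonempty_of_aeOn {R : ℝ → Prop} {a b c d : ℝ} (h : AEOn R a b) (hcd : c < d)
    (hs : Ioo c d ⊆ Ioo a b) : ∃ t ∈ Ioo c d, R t := by
  by_contra! hn
  have h1 : ∀ᵐ t ∂volume.restrict (Ioo c d), False := by
    filter_upwards [ae_restrict_of_ae_restrict_of_subset hs h, ae_restrict_mem measurableSet_Ioo]
      with t k1 k2 using hn t k2 k1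
  rw [eventually_false_iff_eq_bot, ae_eq_bot, Measure.restrict_eq_zero, Real.volume_Ioo,
    ENNReal.ofReal_eq_zero] at h1
  linarith

theorem not_lowerActive {t : ℝ} (ht : t ≤ 3) : ¬ lowerActive data ubar t := by
  have := (ubar_mem ht).1
  have := nine_lt_pi_sq
  simp only [lowerActive, data]
  intro h
  linarith

theorem upperActive_iff {t : ℝ} (ht : t ≤ 3) : upperActive data ubar t ↔ t < Real.log 2 := by
  simp only [upperActive, data]
  refine ⟨fun h => ?_, ubar_of_lt⟩
  by_contra! hl
  linarith [ubar_le_pi_sq hl ht]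

theorem not_boundArc {a b c d : ℝ} (hcd : c < d) (hs : Ioo c d ⊆ Ioo a b) (hc : Real.log 2 ≤ c)
    (hd : d ≤ 3) : ¬ boundArc data ubar a b := by
  rintro (h | h)
  · obtain ⟨t, ht, h1⟩ := nonempty_of_aeOn h hcd hs
    exact not_lowerActive (by linarith [ht.2]) h1
  · obtain ⟨t, ht, h1⟩ := nonempty_of_aeOn h hcd hs
    rw [upperActive_iff (by linarith [ht.2])] at h1
    linarith [ht.1]

theorem stateActive_iff (h : IsSep yb c1 ybar1 dybar1) {t : ℝ} (ht : t ∈ Icc 0 data.T) :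
    stateActive data yb t ↔ t ∈ Icc (Real.log 2) 2 := by
  rw [← contactC_eq h]
  exact ⟨fun k => ⟨ht, k⟩, fun k => k.2⟩

theorem finiteArcs_lower : FiniteArcsBound data (lowerActive data ubar) := by
  refine ⟨∅, finite_empty, by simp, ?_⟩
  filter_upwards [ae_restrict_mem measurableSet_Icc] with t ht
  simpa using not_lowerActive ht.2

theorem finiteArcs_upper : FiniteArcsBound data (upperActive data ubar) := by
  have hl := log_two_lt_one
  have hl' := half_lt_log_two
  refine ⟨{(0, Real.log 2)}, finite_singleton _, ?_, ?_⟩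
  · rintro I rfl
    refine ⟨le_rfl, by linarith, by rw [data_T]; linarith, ?_, fun a b ha ha' hb hb' hE => ?_⟩
    · refine (ae_restrict_iff' measurableSet_Ioo).2 (Eventually.of_forall fun t ht => ?_)
      exact (upperActive_iff (by linarith [ht.2])).2 ht.2
    · refine ⟨le_antisymm ha' ha, le_antisymm ?_ hb⟩
      by_contra! hlt
      obtain ⟨t, ht, h1⟩ := nonempty_of_aeOn hE hlt (Ioo_subset_Ioo_left (by
        simp only at ha' ⊢; linarith))
      rw [data_T] at hb'
      rw [upperActive_iff (by linarith [ht.2])] at h1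
      simp only at ht
      linarith [ht.1]
  · have h0 : ∀ᵐ t ∂volume.restrict (Icc 0 data.T), t ≠ 0 :=
      ae_restrict_of_ae (Measure.ae_ne volume 0)
    filter_upwards [ae_restrict_mem measurableSet_Icc, h0] with t ht hne
    rw [upperActive_iff ht.2]
    simp only [mem_singleton_iff, exists_eq_left, mem_Ioo]
    exact ⟨fun h => ⟨lt_of_le_of_ne ht.1 (Ne.symm hne), h⟩, fun h => h.2⟩

theorem finiteArcs_state (h : IsSep yb c1 ybar1 dybar1) : FiniteArcsState data yb := by
  have hl := log_two_lt_one
  have hl' := half_lt_log_two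
  refine ⟨{(Real.log 2, 2)}, finite_singleton _, ?_, ?_⟩
  · rintro I rfl
    refine ⟨by linarith, by linarith, by rw [data_T]; norm_num, ?_, fun a b ha ha' hb hb' hE => ?_⟩
    · rw [contactC_eq h]
      exact Ioo_subset_Icc_self
    · simp only [contactC_eq h] at *
      have hab : a < b := by linarith
      -- The contact set is closed, so an open interval inside it has its closure inside it, which
      -- bounds both end points.
      have hcl : Icc a b ⊆ Icc (Real.log 2) 2 := by
        rw [← closure_Ioo hab.ne]
        exact closure_minimal hE isClosed_Icc
      exact ⟨le_antisymm ha' (hcl ⟨le_rfl, hab.le⟩).1, le_antisymm (hcl ⟨hab.le, le_rfl⟩).2 hb⟩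
  · rw [contactC_eq h]
    refine (toFinite {Real.log 2, 2}).subset ?_
    simp only [mem_singleton_iff, iUnion_iUnion_eq_left]
    intro t ht
    simp only [mem_symmDiff, mem_Icc, mem_Ioo, mem_insert_iff, mem_singleton_iff] at ht ⊢
    grind

/-- Take `u' = ū - 1`, which respects the bounds since `π² > 9`. The linearized constraint becomes
`(1 - t) ȳ1 - 2`: it is at most `-1` before `log 2`, equals `-2t < -1` up to `2`, and is less than
`-2` after that. -/
theorem qualified (h : IsSep yb c1 ybar1 dybar1) : ∃ ε > 0, ∃ u' : ℝ → ℝ, Uad data u' ∧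
    ∃ z : Y data.T, IsLin data ubar yb (fun t => u' t - ubar t) z ∧
    ∀ t ∈ Icc 0 data.T, gfun data yb t + (∫ x in Om, data.c x * valueAt z t x) < -ε := by
  have hU := (isAdmissible h).1
  obtain ⟨z, hz⟩ := exists_isSep (C := 8) data_T_pos.le contDiff_c1 (by simp [c1]) (by simp [c1])
    isPrimitive_neg_mul_ybar1 fun t ht => by
      have h1 := ybar1_mem (Ioo_subset_Icc_self ht)
      have h2 := abs_le.1 (dybar1_bound t)
      have h3 : t < 3 := ht.2
      have h0 := ht.1
      rw [abs_le]
      constructor <;> nlinarith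
  refine ⟨1 / 2, by norm_num, fun t => ubar t - 1, ⟨hU.1.sub (memLp_const 1), ?_⟩, z, ⟨?_, ?_⟩, ?_⟩
  · filter_upwards [hU.2, ae_restrict_mem measurableSet_Ioo] with t ht hm
    have h1 := ubar_mem (t := t) hm.2.le
    have := nine_lt_pi_sq
    simp only [data]
    constructor <;> linarith
  · filter_upwards [hz.fn_eq, hz.fnxx_eq, hz.fnt_eq, h.fn_eq,
      ae_restrict_mem (measurableSet_Cyl data.T)] with q h1 h2 h3 h4 hq
    have hq' : q.2 < 3 := hq.2.2
    rw [opA_eq, h1, h2, h3, h4, deriv_deriv_c1, dybar1_eq hq'.le]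
    simp only [data]
    ring
  · filter_upwards [hz.valueAt_eq data_T_pos isPrimitive_neg_mul_ybar1 ⟨le_rfl, data_T_pos.le⟩]
      with x hx
    rw [hx]
    simp
  · intro t ht
    rw [gfun_ybar h ht, gfun_eq hz isPrimitive_neg_mul_ybar1 ht]
    have hl := half_lt_log_two
    have h3 : t ≤ 3 := ht.2
    rcases lt_or_ge t (Real.log 2) with h' | h'
    · rw [ybar1_of_lt h']
      -- `1 - t ≤ e^{-t}` gives `(1 - t) e^t ≤ 1`.
      have e1 := Real.add_one_le_exp (-t)
      have e2 := exp_mul_exp_neg t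
      nlinarith [Real.exp_pos t]
    rcases lt_or_ge t 2 with h'' | h''
    · rw [ybar1_of_lt_two h' h'']
      linarith
    · rw [ybar1_of_two_le h'']
      nlinarith

theorem mfun_eq (h : IsSep yb c1 ybar1 dybar1) {t : ℝ} (ht : t ∈ Icc 0 data.T) :
    Mfun data yb t = ybar1 t := by
  rw [← gfun_eq h isPrimitive_ybar1 ht, Mfun]
  simp [data]

theorem sharp (h : IsSep yb c1 ybar1 dybar1) : ∃ k > 0, ∀ t ∈ Icc 0 data.T,
    gfun data yb t ≤ -k * Metric.infDist t (contactC data yb) := by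
  have hl := log_two_lt_one
  refine ⟨1, one_pos, fun t ht => ?_⟩
  rw [gfun_ybar h ht, contactC_eq h]
  rcases lt_or_ge t (Real.log 2) with h' | h'
  · have hd := Metric.infDist_le_dist_of_mem (x := t) (s := Icc (Real.log 2) 2)
      (left_mem_Icc.2 (by linarith))
    rw [Real.dist_eq, abs_of_neg (by linarith)] at hd
    rw [ybar1_of_lt h']
    -- Convexity gives `2 - e^t ≥ e^t (log 2 - t)`, and `e^t ≥ 1`, so the slope `k = 1` works; after
    -- `t = 2` there is equality.
    have e1 := Real.add_one_le_exp (Real.log 2 - t)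
    rw [Real.exp_sub, Real.exp_log two_pos, le_div_iff₀ (Real.exp_pos t)] at e1
    have := Real.one_le_exp ht.1
    nlinarith
  rcases le_or_gt t 2 with h'' | h''
  · rw [Metric.infDist_zero_of_mem (mem_Icc.2 ⟨h', h''⟩)]
    linarith [(ybar1_mem ht).2]
  · have hd := Metric.infDist_le_dist_of_mem (x := t) (s := Icc (Real.log 2) 2)
      (right_mem_Icc.2 (by linarith))
    rw [Real.dist_eq, abs_of_pos (by linarith)] at hd
    rw [ybar1_of_two_le h''.le]
    linarith

/-! ### Regularity of the data and limits of the control -/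

theorem memLp_restrict_Om {p : ℝ≥0∞} {f : ℝ → ℝ} (hf : Continuous f) :
    MemLp f p (volume.restrict Om) := by
  obtain ⟨C, hC⟩ := isCompact_Icc.exists_bound_of_continuousOn (hf.continuousOn (s := Icc 0 1))
  have : IsFiniteMeasure ((volume : Measure ℝ).restrict Om) := by
    unfold Om
    infer_instance
  refine MemLp.of_bound hf.aestronglyMeasurable C ?_
  filter_upwards [ae_restrict_mem measurableSet_Om] with x hx using hC x (Ioo_subset_Icc_self hx)

theorem integral_mul_deriv_Om {f φ : ℝ → ℝ} (hf : ContDiff ℝ ∞ f) (hφ : ContDiff ℝ ∞ φ)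
    (h0 : f 0 * φ 0 = 0) (h1 : f 1 * φ 1 = 0) :
    ∫ x in Om, f x * deriv φ x = -∫ x in Om, deriv f x * φ x := by
  have h := (isPrimitive_deriv (T := 1) hf).integral_mul zero_le_one (isPrimitive_deriv hφ)
  simp only [h0, h1, sub_zero, zero_sub] at h
  exact h

theorem memW2_of_contDiff {p : ℝ≥0∞} {f : ℝ → ℝ} (hf : ContDiff ℝ ∞ f) : MemW2 p f := by
  have hf1 : ContDiff ℝ ∞ (deriv f) := (contDiff_infty_iff_deriv.1 hf).2
  have hf2 : ContDiff ℝ ∞ (deriv (deriv f)) := (contDiff_infty_iff_deriv.1 hf1).2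
  exact ⟨deriv f, deriv (deriv f), memLp_restrict_Om hf.continuous, memLp_restrict_Om hf1.continuous,
    memLp_restrict_Om hf2.continuous,
    fun φ hφ h0 h1 => integral_mul_deriv_Om hf hφ (by simp [h0]) (by simp [h1]),
    fun φ hφ h0 h1 => integral_mul_deriv_Om hf1 hφ (by simp [h0]) (by simp [h1])⟩

theorem memW10_of_contDiff {p : ℝ≥0∞} {f : ℝ → ℝ} (hf : ContDiff ℝ ∞ f) (h0 : f 0 = 0)
    (h1 : f 1 = 0) : MemW10 p f := by
  have hf1 : ContDiff ℝ ∞ (deriv f) := (contDiff_infty_iff_deriv.1 hf).2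
  exact ⟨deriv f, memLp_restrict_Om hf.continuous, memLp_restrict_Om hf1.continuous,
    fun φ hφ => integral_mul_deriv_Om hf hφ (by simp [h0]) (by simp [h1])⟩

theorem memW2_c1 {p : ℝ≥0∞} : MemW2 p c1 := memW2_of_contDiff contDiff_c1

theorem memW10_c1 {p : ℝ≥0∞} : MemW10 p c1 :=
  memW10_of_contDiff contDiff_c1 (by simp [c1]) (by simp [c1])

theorem limits_of_eqOn {a b τ : ℝ} {f g : ℝ → ℝ} (hg : ContinuousAt g τ) (hab : τ ∈ Icc a b)
    (h : ∀ t ∈ Ioo a b, f t = g t) :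
    (a < τ → Tendsto f (𝓝[<] τ) (𝓝 (g τ))) ∧ (τ < b → Tendsto f (𝓝[>] τ) (𝓝 (g τ))) := by
  refine ⟨fun ha => ?_, fun hb => ?_⟩
  · refine (hg.tendsto.mono_left nhdsWithin_le_nhds).congr' ?_
    filter_upwards [Ioo_mem_nhdsLT ha] with t ht using (h t ⟨ht.1, lt_of_lt_of_le ht.2 hab.2⟩).symm
  · refine (hg.tendsto.mono_left nhdsWithin_le_nhds).congr' ?_
    filter_upwards [Ioo_mem_nhdsGT hb] with t ht using (h t ⟨hab.1.trans_lt ht.1, ht.2⟩).symm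

theorem limits_ubar {τ : ℝ} (hτ : τ ∈ Ioo 0 data.T) :
    (∃ l, Tendsto ubar (𝓝[<] τ) (𝓝 l)) ∧ ∃ l, Tendsto ubar (𝓝[>] τ) (𝓝 l) := by
  have hl := log_two_lt_one
  have hl' := half_lt_log_two
  have h3 : τ < 3 := hτ.2
  have h1 := fun h : τ ∈ Icc 0 (Real.log 2) => limits_of_eqOn (τ := τ) (a := 0) (b := Real.log 2)
    (g := fun _ => Real.pi ^ 2 + 1) continuousAt_const h fun t ht => ubar_of_lt ht.2
  have h2 := fun h : τ ∈ Icc (Real.log 2) 2 => limits_of_eqOn (τ := τ) (a := Real.log 2) (b := 2)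
    (g := fun _ => Real.pi ^ 2) continuousAt_const h fun t ht => ubar_of_lt_two ht.1.le ht.2
  have h4 := fun h : τ ∈ Icc 2 3 => limits_of_eqOn (τ := τ) (a := 2) (b := 3)
    (g := fun t => Real.pi ^ 2 - 1 / (4 - t))
    (continuousAt_const.sub (continuousAt_const.div (by fun_prop) (by linarith))) h
    fun t ht => ubar_of_two_le ht.1.le
  constructor
  · rcases le_or_gt τ (Real.log 2) with h | h
    · exact ⟨_, (h1 ⟨hτ.1.le, h⟩).1 hτ.1⟩
    rcases le_or_gt τ 2 with h' | h'
    · exact ⟨_, (h2 ⟨h.le, h'⟩).1 h⟩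
    · exact ⟨_, (h4 ⟨h'.le, h3.le⟩).1 h'⟩
  · rcases lt_or_ge τ (Real.log 2) with h | h
    · exact ⟨_, (h1 ⟨hτ.1.le, h.le⟩).2 h⟩
    rcases lt_or_ge τ 2 with h' | h'
    · exact ⟨_, (h2 ⟨h, h'.le⟩).2 h'⟩
    · exact ⟨_, (h4 ⟨h', h3.le⟩).2 h3⟩

theorem settingHypothesis (h : IsSep yb c1 ybar1 dybar1) : SettingHypothesis data ubar yb where
  arcs := ⟨finiteArcs_lower, finiteArcs_upper, finiteArcs_state h⟩
  qualified := qualified h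
  card := by
    intro a b hab hs
    obtain ⟨ha, hlt, hb, -⟩ := hab
    have hb' : b ≤ 3 := hb
    refine not_boundArc hlt Subset.rfl ?_ hb'
    -- An arc beginning before `log 2` would contain a point below `log 2` where the state
    -- constraint is active.
    by_contra! hlog
    obtain ⟨t, ht, h1⟩ := nonempty_of_aeOn hs (lt_min hlt hlog) (Ioo_subset_Ioo_right (min_le_left _ _))
    rw [stateActive_iff h ⟨by linarith [ht.1], by rw [data_T]; linarith [ht.2, min_le_left b (Real.log 2)]⟩] at h1
    linarith [h1.1, ht.2, min_le_right b (Real.log 2)]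
  controllable := by
    refine ⟨1, one_pos, fun a b hab _ _ => ?_⟩
    obtain ⟨ha, hlt, hb, -⟩ := hab
    refine (ae_restrict_iff' measurableSet_Ioo).2 (Eventually.of_forall fun t ht => ?_)
    have ht' : t ∈ Icc 0 data.T := ⟨ha.trans ht.1.le, ht.2.le.trans hb⟩
    rw [mfun_eq h ht']
    exact (ybar1_mem ht').1.trans (le_abs_self _)
  sharp := sharp h
  away := by
    refine ⟨1, one_pos, ?_⟩
    filter_upwards [ae_restrict_mem measurableSet_Icc] with t ht _ hu
    rw [upperActive_iff ht.2, not_lt] at hu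
    have h1 := (ubar_mem ht.2).1
    have h2 := ubar_le_pi_sq hu ht.2
    have := nine_lt_pi_sq
    simp only [data]
    exact ⟨by rw [abs_of_nonneg] <;> linarith, by rw [abs_of_nonpos] <;> linarith⟩
  regular := by
    refine ⟨3, by norm_num, memW10_c1, memW2_c1, memW10_c1, memW2_c1, ?_, ?_,
      memW2_of_contDiff contDiff_const, memW2_of_contDiff contDiff_const⟩
    · exact (memLp_sep continuous_c1 measurable_ydhat.aestronglyMeasurable
        fun t ht => ydhat_bound ht).ae_eq (Eventually.of_forall fun q => mul_comm _ _)
    · exact MemLp.zero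
  limits := fun a b _ τ _ hτ => limits_ubar hτ

theorem standing : Standing data :=
  ⟨data_T_pos, le_rfl, by simp only [data]; linarith [nine_lt_pi_sq], memW2_c1, memW10_c1⟩

end HeatExample

namespace HeatControl

/-! ### The space `H¹₀` -/

theorem H10_eq_zero {F : H10} (h : ∀ᵐ x ∂volume.restrict Om, F.1 0 x = 0) : F = 0 := by
  have h0 : F.1 0 = 0 := (Lp.eq_zero_iff_ae_eq_zero).2 h
  have hi : IntegrableOn (fun x => F.1 1 x) Om := by
    have := integrable_pair measurableSet_Om isBounded_Om (F.1 1) (continuous_const (y := (1 : ℝ)))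
    simp only [mul_one] at this
    exact this
  have h1 : F.1 1 = 0 := (Lp.eq_zero_iff_ae_eq_zero).2 <|
    ae_eq_zero_of_integral_smooth hi fun φ hφ _ _ => by
      have e := F.2 φ hφ
      rw [h0, pair_zero] at e
      exact neg_eq_zero.1 e.symm
  refine Subtype.ext (PiLp.ext fun i => ?_)
  fin_cases i
  exacts [h0, h1]

/-- The functional `ψ ↦ ∫ g ψ` on `H¹₀`. -/
theorem exists_pairing {g : ℝ → ℝ} (hg : MemLp g 2 (volume.restrict Om)) :
    ∃ L : H10 →L[ℝ] ℝ, ∀ F : H10, L F = ∫ x in Om, g x * F.1 0 x := by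
  refine ⟨(innerSL ℝ hg.toLp) ∘L (PiLp.proj (𝕜 := ℝ) 2 (fun _ : Fin 2 => L2Om) 0) ∘L H10.subtypeL,
    fun F => ?_⟩
  change inner ℝ hg.toLp (F.1 0) = _
  rw [L2.inner_def]
  refine integral_congr_ae ?_
  filter_upwards [hg.coeFn_toLp] with x hx
  rw [hx]
  simp [mul_comm]

/-- The function `t ↦ ∫ g p(·,t)`. -/
noncomputable def cmom {T : ℝ} (g : ℝ → ℝ) (p : CostateSpace T) (t : ℝ) : ℝ :=
  ∫ x in Om, g x * cval p t x

/-- A costate is a Bochner class with values in `H¹₀`, and the pairing is a continuous functional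
there; measurability in `t` comes from this composition. -/
theorem integrable_cmom {T : ℝ} {g : ℝ → ℝ} (hg : MemLp g 2 (volume.restrict Om))
    (p : CostateSpace T) : IntegrableOn (cmom g p) (Ioo 0 T) := by
  obtain ⟨L, hL⟩ := exists_pairing hg
  have h : Integrable p (volume.restrict (Ioo 0 T)) := (Lp.memLp p).integrable le_top
  exact (L.integrable_comp h).congr (Eventually.of_forall fun t => hL (p t))

theorem integrableOn_mul_cval {T : ℝ} {g : ℝ → ℝ} (hg : Continuous g) (p : CostateSpace T) (t : ℝ) :
    IntegrableOn (fun x => g x * cval p t x) Om :=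
  (integrable_pair measurableSet_Om isBounded_Om ((p t).1 0) hg).congr
    (Eventually.of_forall fun _ => mul_comm _ _)

/-- Integration by parts against `dμ`: since `μ T = 0`, the mass of `(s,T]` is `-μ s`. The closed
interval keeps a possible atom at `0`, which enters through the total mass. -/
theorem setIntegral_primitive_stieltjes {T : ℝ} {Z ζ : ℝ → ℝ} (hZ : IsPrimitive T Z ζ)
    {μ : StieltjesFunction ℝ} (hμ : MemBV0 T μ) :
    ∫ t in Icc 0 T, Z t ∂μ.measure =
      Z 0 * μ.measure.real (Icc 0 T) - ∫ s in Ioo 0 T, ζ s * μ s := by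
  have hc : IntegrableOn (fun _ => (1 : ℝ)) (Icc 0 T) μ.measure :=
    continuousOn_const.integrableOn_compact isCompact_Icc
  have h := integral_mul_primitive μ.measure hZ.1 hc
  have hp : IntegrableOn (fun t => ∫ s in Ioo 0 t, ζ s) (Icc 0 T) μ.measure :=
    (continuousOn_primitive_Ioo hZ.1).integrableOn_compact isCompact_Icc
  have e : ∫ t in Icc 0 T, Z t ∂μ.measure =
      ∫ t in Icc 0 T, (Z 0 * 1 + 1 * ∫ s in Ioo 0 t, ζ s) ∂μ.measure :=
    setIntegral_congr_fun measurableSet_Icc fun t ht => by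
      simp only [mul_one, one_mul]
      exact hZ.2 t ht
  simp only [one_mul] at e h
  rw [e, integral_add (hc.const_mul _) hp, h, sub_eq_add_neg, ← integral_neg]
  congr 1
  · simp [mul_comm]
  · refine setIntegral_congr_fun measurableSet_Ioo fun s hs => ?_
    simp only [setIntegral_const, smul_eq_mul, mul_one, measureReal_def,
      StieltjesFunction.measure_Ioc, hμ.1 T le_rfl]
    rw [ENNReal.toReal_ofReal]
    · ring
    · have := μ.mono hs.2.le
      rw [hμ.1 T le_rfl] at this
      linarith

end HeatControl

namespace HeatExample
open HeatControl

variable {yb : Y data.T}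

/-! ### Fourier coefficients of the costate -/

theorem memLp_ek {p : ℝ≥0∞} (k : ℕ) : MemLp (ek k) p (volume.restrict Om) :=
  memLp_restrict_Om (contDiff_ek k).continuous

theorem memLp_c1 {p : ℝ≥0∞} : MemLp c1 p (volume.restrict Om) := memLp_restrict_Om continuous_c1

theorem integral_costate {p : CostateSpace data.T} {z : Y data.T} {k : ℕ} {Z ζ : ℝ → ℝ}
    (hz : IsSep z (ek k) Z ζ) :
    ∫ t in Ioo 0 data.T, ∫ x in Om, cval p t x * (fnt z (x, t) + opA data ubar yb z (x, t)) =
      ∫ t in Ioo 0 data.T, cmom (ek k) p t * (ζ t + ((k * Real.pi) ^ 2 - ubar t) * Z t) := by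
  refine integral_congr_ae ?_
  filter_upwards [ae_sections_symm hz.fn_eq, ae_sections_symm hz.fnxx_eq,
    ae_sections_symm hz.fnt_eq] with t h1 h2 h3
  rw [cmom, ← integral_mul_const]
  refine integral_congr_ae ?_
  filter_upwards [h1, h2, h3] with x k1 k2 k3
  rw [opA_eq, k1, k2, k3, deriv_deriv_ek]
  ring

theorem tracking_bound {t : ℝ} (ht : t ∈ Ioo 0 data.T) : |ybar1 t - ydhat t| ≤ 5 := by
  have h1 := abs_le.1 (ydhat_bound ht)
  have h2 := ybar1_mem (Ioo_subset_Icc_self ht)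
  rw [abs_le]
  constructor <;> linarith

theorem integrableOn_tracking : IntegrableOn (fun t => ybar1 t - ydhat t) (Ioo 0 data.T) :=
  integrableOn_of_bound (continuous_ybar1.measurable.sub measurable_ydhat)
    fun _ ht => tracking_bound ht

theorem integral_tracking (h : IsSep yb c1 ybar1 dybar1) (z : Y data.T) {W : ℝ → ℝ}
    (hW : ∀ᵐ t ∂volume.restrict (Ioo 0 data.T), ∫ x in Om, c1 x * fn z (x, t) = W t) :
    ∫ q in Cyl data.T, (fn yb q - data.yd q) * fn z q =
      ∫ t in Ioo 0 data.T, (ybar1 t - ydhat t) * W t := by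
  have e : ∀ᵐ q ∂volume.restrict (Cyl data.T),
      (fn yb q - data.yd q) * fn z q = c1 q.1 * (ybar1 q.2 - ydhat q.2) * fn z q := by
    filter_upwards [h.fn_eq] with q hq
    rw [hq]
    simp only [data]
    ring
  have hi : IntegrableOn (fun q => c1 q.1 * (ybar1 q.2 - ydhat q.2) * fn z q) (Cyl data.T) :=
    (memLp_sep continuous_c1 integrableOn_tracking.aestronglyMeasurable
      (fun _ ht => tracking_bound ht) (p := 2)).integrable_mul (Lp.memLp (z.1 0))
  rw [integral_congr_ae e, setIntegral_Cyl_symm hi]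
  refine integral_congr_ae ?_
  filter_upwards [hW] with t ht
  rw [← ht, ← integral_const_mul]
  exact integral_congr_ae (Eventually.of_forall fun x => by ring)

/-- The trajectory ends exactly at the target, so the costate receives no terminal contribution from
the cost. -/
theorem final_cost (h : IsSep yb c1 ybar1 dybar1) (z : Y data.T) :
    ∫ x in Om, (valueAt yb data.T x - data.ydT x) * valueAt z data.T x = 0 := by
  refine integral_eq_zero_of_ae ?_
  filter_upwards [h.valueAt_eq data_T_pos isPrimitive_ybar1 ⟨data_T_pos.le, le_rfl⟩] with x hx
  rw [hx, ybar1_three, mul_one]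
  simp [data]

/-- Only the value at `k = 1` is needed: for the other modes it multiplies a difference of measures
already known to vanish, so orthogonality is not invoked. -/
noncomputable def overlap (k : ℕ) : ℝ := ∫ x in Om, c1 x * ek k x

theorem overlap_one : overlap 1 = 1 := by
  rw [overlap, ← c1_eq, integral_c1_sq]

/-- The integrated form of the costate equation, for the Fourier coefficients of the costate. -/
theorem costate_integral (h : IsSep yb c1 ybar1 dybar1) {p : CostateSpace data.T}
    {μ : StieltjesFunction ℝ} (hμ : MemBV0 data.T μ) (hp : IsCostate data ubar yb 1 p μ) (k : ℕ) :
    ∀ᵐ s ∂volume.restrict (Ioo 0 data.T), cmom (ek k) p s + overlap k * μ s =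
      ∫ t in Ioo s data.T, ((ubar t - (k * Real.pi) ^ 2) * cmom (ek k) p t +
        overlap k * (ybar1 t - ydhat t)) := by
  obtain ⟨p0, hp⟩ := hp
  have ic : IntegrableOn (cmom (ek k) p) (Ioo 0 data.T) := integrable_cmom (memLp_ek k) p
  have iμ : IntegrableOn μ (Ioo 0 data.T) :=
    (μ.mono.monotoneOn _).integrableOn_isCompact isCompact_Icc |>.mono_set Ioo_subset_Icc_self
  have iy := integrableOn_tracking
  have iuc : IntegrableOn (fun t => (ubar t - (k * Real.pi) ^ 2) * cmom (ek k) p t)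
      (Ioo 0 data.T) := by
    refine ic.bdd_mul (c := 17 + (k * Real.pi) ^ 2) (measurable_coef k).aestronglyMeasurable ?_
    filter_upwards [ae_restrict_mem measurableSet_Ioo] with t ht using coef_bound k ht
  have ik : IntegrableOn (fun t => (ubar t - (k * Real.pi) ^ 2) * cmom (ek k) p t +
      overlap k * (ybar1 t - ydhat t)) (Ioo 0 data.T) := iuc.add (iy.const_mul _)
  have ir : IntegrableOn (fun s => ∫ t in Ioo s data.T,
      ((ubar t - (k * Real.pi) ^ 2) * cmom (ek k) p t + overlap k * (ybar1 t - ydhat t)))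
      (Ioo 0 data.T) := by
    refine ((integrable_const (∫ t in Ioo 0 data.T,
      ((ubar t - (k * Real.pi) ^ 2) * cmom (ek k) p t + overlap k * (ybar1 t - ydhat t)))).sub
        ((continuousOn_primitive_Ioo ik).integrableOn_Icc.mono_set Ioo_subset_Icc_self)).congr ?_
    filter_upwards [ae_restrict_mem measurableSet_Ioo] with t ht
    have := setIntegral_Ioo_add (Ioo_subset_Icc_self ht) ik
    simp only [Pi.sub_apply]
    linarith
  have key := ae_eq_zero_of_integral_smooth ((ic.add (iμ.const_mul (overlap k))).sub ir)
    fun η hη _ _ => by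
    -- The test function is `Z(t) e_k(x)`. Because `Z 0 = 0` it vanishes at time `0`, and the
    -- unknown functional `p0` drops out.
    set Z : ℝ → ℝ := fun t => ∫ s in Ioo 0 t, η s with hZd
    have iη : IntegrableOn η (Ioo 0 data.T) :=
      hη.continuous.integrableOn_Icc.mono_set Ioo_subset_Icc_self
    have Z0 : Z 0 = 0 := by simp [hZd]
    have hZ : IsPrimitive data.T Z η := ⟨iη, fun t _ => by rw [Z0, zero_add]⟩
    obtain ⟨K, hK⟩ := isCompact_Icc.exists_bound_of_continuousOn
      (hη.continuous.continuousOn (s := Icc 0 data.T))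
    obtain ⟨z, hz⟩ := exists_isSep data_T_pos.le (contDiff_ek k) (ek_zero k) (ek_one k) hZ
      fun t ht => hK t (Ioo_subset_Icc_self ht)
    have e := hp z 0 (by
      filter_upwards [hz.valueAt_eq data_T_pos hZ ⟨le_rfl, data_T_pos.le⟩,
        Lp.coeFn_zero ℝ 2 (volume.restrict Om)] with x hx h0
      rw [hx, Z0, mul_zero]
      exact h0)
    have e1 : ∫ t in Icc 0 data.T, (∫ x in Om, data.c x * valueAt z t x) ∂μ.measure =
        overlap k * ∫ t in Icc 0 data.T, Z t ∂μ.measure := by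
      rw [← integral_const_mul]
      refine setIntegral_congr_fun measurableSet_Icc fun t ht => ?_
      simp only [overlap]
      rw [← integral_mul_const]
      refine integral_congr_ae ?_
      filter_upwards [hz.valueAt_eq data_T_pos hZ ht] with x hx
      rw [hx, ← mul_assoc]
      rfl
    rw [integral_costate hz, map_zero, add_zero, final_cost h, e1,
      integral_tracking h z (W := fun t => overlap k * Z t) (by
        filter_upwards [ae_sections_symm hz.fn_eq] with t ht
        rw [overlap, ← integral_mul_const]
        refine integral_congr_ae ?_
        filter_upwards [ht] with x hx
        rw [hx, mul_assoc]),
      setIntegral_primitive_stieltjes hZ hμ, Z0] at e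
    -- Fubini trades the primitive `Z` for `η`, so every term becomes an integral against the
    -- arbitrary `η`.
    have sw := integral_mul_primitive_volume (T := data.T) iη ik
    have c : ∀ {f φ : ℝ → ℝ}, IntegrableOn f (Ioo 0 data.T) → ContinuousOn φ (Icc 0 data.T) →
        IntegrableOn (fun t => f t * φ t) (Ioo 0 data.T) := fun hf hφ =>
      (IntegrableOn.mul_continuousOn (integrableOn_Icc_of_Ioo hf) hφ isCompact_Icc).mono_set
        Ioo_subset_Icc_self
    have cη : ContinuousOn η (Icc 0 data.T) := hη.continuous.continuousOn
    have l : ∫ t in Ioo 0 data.T, cmom (ek k) p t * (η t + ((k * Real.pi) ^ 2 - ubar t) * Z t) =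
        (∫ t in Ioo 0 data.T, cmom (ek k) p t * η t) -
          ∫ t in Ioo 0 data.T, ((ubar t - (k * Real.pi) ^ 2) * cmom (ek k) p t) * Z t := by
      rw [← integral_sub (c ic cη) (c iuc hZ.continuousOn)]
      exact integral_congr_ae (Eventually.of_forall fun t => by ring)
    have m : ∫ t in Ioo 0 data.T, (ybar1 t - ydhat t) * (overlap k * Z t) =
        ∫ t in Ioo 0 data.T, (overlap k * (ybar1 t - ydhat t)) * Z t :=
      integral_congr_ae (Eventually.of_forall fun t => by ring)
    have r : ∫ t in Ioo 0 data.T, ((ubar t - (k * Real.pi) ^ 2) * cmom (ek k) p t +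
          overlap k * (ybar1 t - ydhat t)) * Z t =
        (∫ t in Ioo 0 data.T, ((ubar t - (k * Real.pi) ^ 2) * cmom (ek k) p t) * Z t) +
          ∫ t in Ioo 0 data.T, (overlap k * (ybar1 t - ydhat t)) * Z t := by
      rw [← integral_add (c iuc hZ.continuousOn) (c (iy.const_mul _) hZ.continuousOn)]
      exact integral_congr_ae (Eventually.of_forall fun t => by ring)
    have iμη : IntegrableOn (fun s => η s * μ s) (Ioo 0 data.T) :=
      (c iμ cη).congr (Eventually.of_forall fun t => mul_comm _ _)
    have irη := c ir cη
    simp only [Pi.sub_apply, Pi.add_apply]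
    calc _ = ∫ s in Ioo 0 data.T, (cmom (ek k) p s * η s + overlap k * (η s * μ s) -
          (∫ t in Ioo s data.T, ((ubar t - (k * Real.pi) ^ 2) * cmom (ek k) p t +
            overlap k * (ybar1 t - ydhat t))) * η s) :=
          integral_congr_ae (Eventually.of_forall fun t => by ring)
      _ = (∫ t in Ioo 0 data.T, cmom (ek k) p t * η t) +
          overlap k * (∫ s in Ioo 0 data.T, η s * μ s) -
          ∫ s in Ioo 0 data.T, η s * ∫ t in Ioo s data.T,
            ((ubar t - (k * Real.pi) ^ 2) * cmom (ek k) p t + overlap k * (ybar1 t - ydhat t)) := by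
          have i1 : IntegrableOn (fun s => cmom (ek k) p s * η s + overlap k * (η s * μ s))
            (Ioo 0 data.T) := (c ic cη).add (iμη.const_mul _)
          rw [integral_sub i1 irη, integral_add (c ic cη) (iμη.const_mul _), integral_const_mul]
          congr 1
          exact integral_congr_ae (Eventually.of_forall fun t => mul_comm _ _)
      _ = 0 := by
          rw [← sw, r, ← m]
          rw [l] at e
          linarith
  filter_upwards [key] with s hs
  simp only [Pi.sub_apply, Pi.add_apply] at hs
  linarith

end HeatExample

namespace HeatExample
open HeatControl

variable {yb : Y data.T}

/-! ### Existence of the multiplier -/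

theorem exists_c1_H10 : ∃ E : H10, ∀ᵐ x ∂volume.restrict Om, E.1 0 x = c1 x := by
  have h1 : ContDiff ℝ ∞ (deriv c1) := (contDiff_infty_iff_deriv.1 contDiff_c1).2
  have m0 : MemLp c1 2 (volume.restrict Om) := memLp_c1
  have m1 : MemLp (deriv c1) 2 (volume.restrict Om) := memLp_restrict_Om h1.continuous
  refine ⟨⟨WithLp.toLp 2 ![m0.toLp, m1.toLp], fun φ hφ => ?_⟩, m0.coeFn_toLp⟩
  change ∫ x in Om, m0.toLp _ x * deriv φ x = -∫ x in Om, m1.toLp _ x * φ x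
  rw [integral_congr_ae (g := fun x => c1 x * deriv φ x),
    integral_congr_ae (f := fun x => m1.toLp _ x * φ x) (g := fun x => deriv c1 x * φ x)]
  · exact integral_mul_deriv_Om contDiff_c1 hφ (by simp [c1]) (by simp [c1])
  · filter_upwards [m1.coeFn_toLp] with x hx
    rw [hx]
  · filter_upwards [m0.coeFn_toLp] with x hx
    rw [hx]

/-- `p(x,t) = pcoef(t) c₁(x)`. -/
def IsPbar (p : CostateSpace data.T) : Prop :=
  ∀ᵐ t ∂volume.restrict (Ioo 0 data.T), ∀ᵐ x ∂volume.restrict Om, cval p t x = pcoef t * c1 x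

theorem exists_isPbar : ∃ p : CostateSpace data.T, IsPbar p := by
  obtain ⟨E, hE⟩ := exists_c1_H10
  have hm : MemLp (fun t => pcoef t • E) ∞ (volume.restrict (Ioo 0 data.T)) := by
    refine MemLp.of_bound (continuous_pcoef.aestronglyMeasurable.smul_const E) ‖E‖ ?_
    filter_upwards [ae_restrict_mem measurableSet_Ioo] with t ht
    rw [norm_smul]
    exact mul_le_of_le_one_left (norm_nonneg _) (pcoef_bound ht.1.le)
  refine ⟨hm.toLp, ?_⟩
  filter_upwards [hm.coeFn_toLp] with t ht
  filter_upwards [hE, Lp.coeFn_smul (pcoef t) (E.1 0)] with x h1 h2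
  rw [cval, ht]
  change (pcoef t • E.1 0 : L2Om) x = _
  rw [h2, Pi.smul_apply, h1, smul_eq_mul]

theorem memBV0_mubar : MemBV0 data.T mubar := by
  have hl := half_lt_log_two
  refine ⟨fun t ht => muFun_of_two_le ?_, fun s t hs ht => ?_⟩
  · rw [data_T] at ht
    linarith
  · change muFun s = muFun t
    rw [muFun_of_le (by linarith), muFun_of_le (by linarith)]

theorem mubar_measure_real_Icc : mubar.measure.real (Icc 0 data.T) = -muFun 0 := by
  have h : Function.leftLim mubar 0 = muFun 0 :=
    (continuous_muFun.continuousWithinAt (s := Iic 0) (x := 0)).leftLim_eq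
  have h2 : mubar data.T = 0 := memBV0_mubar.1 _ le_rfl
  rw [measureReal_def, StieltjesFunction.measure_Icc, h, h2, zero_sub, ENNReal.toReal_ofReal]
  rw [muFun_of_le (by linarith [half_lt_log_two])]
  linarith [log_two_lt_one]

/-- Only the first coefficient `V` of `z` enters, and the identity is the integration by parts of
`(p + μ) V'`. The terminal term vanishes; the initial term `(p + μ)(0) V(0)` splits into `p0` and
the total mass `-μ(0)`. -/
theorem isCostate_pbar (h : IsSep yb c1 ybar1 dybar1) {p : CostateSpace data.T} (hp : IsPbar p) :
    IsCostate data ubar yb 1 p mubar := by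
  obtain ⟨L, hL⟩ := exists_pairing (memLp_c1 (p := 2))
  refine ⟨pcoef 0 • L, fun z ψ hψ => ?_⟩
  have hV := isPrimitive_vmom z continuous_c1
  have hmV := mom_eq_vmom data_T_pos z contDiff_c1
  have e0 : (pcoef 0 • L) ψ = pcoef 0 * vmom c1 z 0 := by
    change pcoef 0 * L ψ = _
    rw [hL, vmom]
    congr 1
    refine integral_congr_ae ?_
    filter_upwards [hψ] with x hx
    rw [hx]
  have e1 : ∫ t in Ioo 0 data.T, ∫ x in Om, cval p t x *
      (fnt z (x, t) + opA data ubar yb z (x, t)) = ∫ t in Ioo 0 data.T, (pcoef t *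
        mom c1 (z.1 3) t - (ubar t - Real.pi ^ 2) * pcoef t * vmom c1 z t) := by
    refine integral_congr_ae ?_
    filter_upwards [hp, mom_opA ubar yb z 1, hmV] with t h1 h2 h3
    have e : ∫ x in Om, cval p t x * (fnt z (x, t) + opA data ubar yb z (x, t)) =
        pcoef t * ∫ x in Om, c1 x * (fnt z (x, t) + opA data ubar yb z (x, t)) := by
      rw [← integral_const_mul]
      refine integral_congr_ae ?_
      filter_upwards [h1] with x hx
      rw [hx, mul_assoc]
    rw [← c1_eq] at h2
    rw [e, h2.2, h3]
    push_cast
    ring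
  have e2 : ∫ t in Icc 0 data.T, (∫ x in Om, data.c x * valueAt z t x) ∂mubar.measure =
      vmom c1 z 0 * -muFun 0 - ∫ s in Ioo 0 data.T, mom c1 (z.1 3) s * muFun s := by
    rw [← mubar_measure_real_Icc]
    exact setIntegral_primitive_stieltjes hV memBV0_mubar
  have ip := isPrimitive_sum.integral_mul data_T_pos.le hV
  rw [sum_three] at ip
  rw [e0, e1, e2, final_cost h, integral_tracking h z (W := vmom c1 z) hmV]
  have c : ∀ {f φ : ℝ → ℝ}, IntegrableOn f (Ioo 0 data.T) → ContinuousOn φ (Icc 0 data.T) →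
      IntegrableOn (fun t => f t * φ t) (Ioo 0 data.T) := fun hf hφ =>
    (IntegrableOn.mul_continuousOn (integrableOn_Icc_of_Ioo hf) hφ isCompact_Icc).mono_set
      Ioo_subset_Icc_self
  have i1 := c hV.1 continuous_pcoef.continuousOn
  have i2 := c hV.1 continuous_muFun.continuousOn
  have i3 := c isPrimitive_sum.1 hV.continuousOn
  have i4 : IntegrableOn (fun t => (ybar1 t - ydhat t) * vmom c1 z t) (Ioo 0 data.T) :=
    c integrableOn_tracking hV.continuousOn
  have s1 : ∫ t in Ioo 0 data.T, (pcoef t * mom c1 (z.1 3) t -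
      (ubar t - Real.pi ^ 2) * pcoef t * vmom c1 z t) =
      (∫ t in Ioo 0 data.T, mom c1 (z.1 3) t * pcoef t) +
      (∫ t in Ioo 0 data.T, dsum t * vmom c1 z t) +
      ∫ t in Ioo 0 data.T, (ybar1 t - ydhat t) * vmom c1 z t := by
    rw [← integral_add i1 i3, ← integral_add (f := fun t => mom c1 (z.1 3) t * pcoef t +
      dsum t * vmom c1 z t) (i1.add i3) i4]
    refine integral_congr_ae (Eventually.of_forall fun t => ?_)
    simp only [dsum]
    ring
  have s2 : ∫ t in Ioo 0 data.T, (pcoef t + muFun t) * mom c1 (z.1 3) t =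
      (∫ t in Ioo 0 data.T, mom c1 (z.1 3) t * pcoef t) +
      ∫ t in Ioo 0 data.T, mom c1 (z.1 3) t * muFun t := by
    rw [← integral_add i1 i2]
    exact integral_congr_ae (Eventually.of_forall fun t => by ring)
  rw [s2] at ip
  rw [s1]
  linear_combination ip

theorem switching_eq (h : IsSep yb c1 ybar1 dybar1) (p : CostateSpace data.T) {t : ℝ}
    (ht : t ∈ Icc 0 data.T) : switching data yb 1 (cval p) t = ybar1 t * cmom c1 p t := by
  have e : ∫ x in Om, data.b x * valueAt yb t x * cval p t x =
      ∫ x in Om, ybar1 t * (c1 x * cval p t x) := by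
    refine integral_congr_ae ?_
    filter_upwards [h.valueAt_eq data_T_pos isPrimitive_ybar1 ht] with x hx
    rw [hx]
    simp only [data]
    ring
  rw [switching, e, integral_const_mul, cmom]
  simp [data]

theorem cmom_pbar {p : CostateSpace data.T} (hp : IsPbar p) :
    ∀ᵐ t ∂volume.restrict (Ioo 0 data.T), cmom c1 p t = pcoef t := by
  filter_upwards [hp] with t ht
  have e : cmom c1 p t = ∫ x in Om, c1 x * c1 x * pcoef t := by
    refine integral_congr_ae ?_
    filter_upwards [ht] with x hx
    rw [hx]
    ring
  rw [e, integral_mul_const, integral_c1_sq, one_mul]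

theorem switching_pbar (h : IsSep yb c1 ybar1 dybar1) {p : CostateSpace data.T} (hp : IsPbar p) :
    ∀ᵐ t ∂volume.restrict (Ioo 0 data.T),
      switching data yb 1 (cval p) t = ybar1 t * pcoef t := by
  filter_upwards [cmom_pbar hp, ae_restrict_mem measurableSet_Ioo] with t h1 h2
  rw [switching_eq h p (Ioo_subset_Icc_self h2), h1]

theorem setIntegral_gfun (h : IsSep yb c1 ybar1 dybar1) (ν : Measure ℝ) :
    ∫ t in Icc 0 data.T, gfun data yb t ∂ν = ∫ t in Icc 0 data.T, (ybar1 t - 2) ∂ν :=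
  setIntegral_congr_fun measurableSet_Icc fun _ ht => gfun_ybar h ht

theorem mubar_measure_compl : mubar.measure (Icc 0 data.T \ Icc (Real.log 2) 2) = 0 := by
  have h1 : mubar.measure (Ioc (-1) (Real.log 2)) = 0 := by
    rw [StieltjesFunction.measure_Ioc]
    change ENNReal.ofReal (muFun _ - muFun _) = 0
    rw [muFun_of_le le_rfl, muFun_of_le (by linarith [half_lt_log_two])]
    simp
  have h2 : mubar.measure (Ioc 2 3) = 0 := by
    rw [StieltjesFunction.measure_Ioc]
    change ENNReal.ofReal (muFun _ - muFun _) = 0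
    rw [muFun_of_two_le le_rfl, muFun_of_two_le (by norm_num)]
    simp
  refine measure_mono_null (fun t ht => ?_) (measure_union_null h1 h2)
  have h3 : t ≤ 3 := ht.1.2
  have h0 := ht.1.1
  by_cases hlt : t ≤ Real.log 2
  · exact Or.inl ⟨by linarith, hlt⟩
  · refine Or.inr ⟨?_, h3⟩
    by_contra! hle
    exact ht.2 ⟨(not_le.1 hlt).le, hle⟩

theorem isMultiplier_pbar (h : IsSep yb c1 ybar1 dybar1) {p : CostateSpace data.T} (hp : IsPbar p) :
    (p, mubar) ∈ Multipliers data ubar yb := by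
  refine ⟨zero_le_one, memBV0_mubar, ?_, isCostate_pbar h hp, Or.inl one_ne_zero, ?_, ?_⟩
  · refine integral_eq_zero_of_ae ?_
    have h1 : ∀ᵐ t ∂mubar.measure.restrict (Icc 0 data.T), t ∈ Icc (Real.log 2) 2 := by
      rw [ae_restrict_iff' measurableSet_Icc, ae_iff]
      refine measure_mono_null (fun t ht => ?_) mubar_measure_compl
      simp only [mem_ofPred_eq, Classical.not_imp] at ht
      exact ht
    filter_upwards [h1, ae_restrict_mem measurableSet_Icc] with t h2 h3
    exact (stateActive_iff h h3).2 h2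
  · have he : switching data yb 1 (cval p) =ᵐ[volume.restrict (Ioo 0 data.T)]
      fun t => ybar1 t * pcoef t := switching_pbar h hp
    refine (MemLp.of_bound (f := fun t => ybar1 t * pcoef t)
      (continuous_ybar1.mul continuous_pcoef).aestronglyMeasurable 2 ?_).ae_eq
      he.symm
    filter_upwards [ae_restrict_mem measurableSet_Ioo] with t ht
    have h1 := ybar1_mem (Ioo_subset_Icc_self ht)
    have h2 := pcoef_bound ht.1.le
    rw [Real.norm_eq_abs, abs_mul, abs_of_nonneg (by linarith)]
    nlinarith [abs_nonneg (pcoef t)]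
  · intro u' hu
    refine integral_nonneg_of_ae ?_
    filter_upwards [switching_pbar h hp, hu.2, ae_restrict_mem measurableSet_Ioo] with t h1 h2 ht
    rw [h1]
    rcases lt_or_ge t (Real.log 2) with hl | hl
    · have h3 : u' t ≤ Real.pi ^ 2 + 1 := h2.2
      rw [ubar_of_lt hl]
      have h4 := ybar1_mem (Ioo_subset_Icc_self ht)
      exact mul_nonneg_of_nonpos_of_nonpos
        (mul_nonpos_of_nonneg_of_nonpos (by linarith) (pcoef_neg hl).le) (by linarith)
    · simp [pcoef_of_le hl]

/-! ### Uniqueness of the multiplier -/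

/-- The variational inequality is tested with `ū + v`, where `v` opposes the sign of `Ψ`. Beyond
`log 2` the control stays at distance at least `1` from both bounds, so any `|v| ≤ 1` is allowed;
before `log 2` only `v ≤ 0` is. -/
theorem cmom_sign (h : IsSep yb c1 ybar1 dybar1) {p : CostateSpace data.T}
    {μ : StieltjesFunction ℝ} (hm : (p, μ) ∈ Multipliers data ubar yb) :
    ∀ᵐ t ∂volume.restrict (Ioo 0 data.T),
      cmom c1 p t ≤ 0 ∧ (Real.log 2 ≤ t → cmom c1 p t = 0) := by
  obtain ⟨-, -, -, -, -, hL, hv⟩ := hm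
  simp only at hL hv
  set Ψ := switching data yb 1 (cval p) with hΨ
  -- Dividing by `1 + |Ψ|` keeps the sign and ensures `|v| ≤ 1`.
  set v : ℝ → ℝ := fun t => (if t < Real.log 2 then -max (Ψ t) 0 else -Ψ t) / (1 + |Ψ t|) with hvd
  have hd : ∀ t, 0 < 1 + |Ψ t| := fun t => by positivity
  have hv1 : ∀ t, |v t| ≤ 1 := fun t => by
    simp only [hvd]
    rw [abs_div, abs_of_pos (hd t), div_le_one (hd t)]
    split_ifs
    · rw [abs_neg, abs_of_nonneg (le_max_right _ _)]
      exact max_le (by linarith [le_abs_self (Ψ t)]) (by positivity)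
    · rw [abs_neg]
      linarith
  have hΨm : AEMeasurable Ψ (volume.restrict (Ioo 0 data.T)) := hL.1.aemeasurable
  have hvm : AEStronglyMeasurable v (volume.restrict (Ioo 0 data.T)) := by
    obtain ⟨Φ, hΦ, he⟩ := hΨm
    have : Measurable fun t => (if t < Real.log 2 then -max (Φ t) 0 else -Φ t) / (1 + |Φ t|) :=
      (Measurable.ite measurableSet_Iio (hΦ.max measurable_const).neg hΦ.neg).div
        (measurable_const.add hΦ.abs)
    refine this.aestronglyMeasurable.congr ?_
    filter_upwards [he] with t ht
    simp only [hvd, ht]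
  have hvL : MemLp v 2 (volume.restrict (Ioo 0 data.T)) :=
    MemLp.of_bound hvm 1 (Eventually.of_forall hv1)
  have hU := (isAdmissible h).1
  have hadm : Uad data (fun t => ubar t + v t) := by
    refine ⟨hU.1.add hvL, ?_⟩
    filter_upwards [ae_restrict_mem measurableSet_Ioo] with t ht
    have h3 : t ≤ 3 := ht.2.le
    have h1 := ubar_mem h3
    have h2 := abs_le.1 (hv1 t)
    have h9 := nine_lt_pi_sq
    simp only [data]
    refine ⟨by linarith, ?_⟩
    rcases lt_or_ge t (Real.log 2) with hl | hl
    · have : v t ≤ 0 := by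
        simp only [hvd, hl, if_true]
        exact div_nonpos_of_nonpos_of_nonneg (neg_nonpos.2 (le_max_right _ _)) (hd t).le
      linarith
    · linarith [ubar_le_pi_sq hl h3]
  have e := hv _ hadm
  have hsq : ∀ t, Ψ t * (ubar t + v t - ubar t) ≤ 0 := fun t => by
    simp only [hvd, add_sub_cancel_left, mul_div_assoc']
    refine div_nonpos_of_nonpos_of_nonneg ?_ (hd t).le
    split_ifs
    · rcases le_total (Ψ t) 0 with h0 | h0
      · simp [h0]
      · rw [max_eq_left h0]
        nlinarith
    · nlinarith [mul_self_nonneg (Ψ t)]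
  have hint : IntegrableOn (fun t => Ψ t * (ubar t + v t - ubar t)) (Ioo 0 data.T) := by
    have : MemLp Ψ 2 (volume.restrict (Ioo 0 data.T)) := hL.mono_exponent le_top
    refine (this.integrable_mul hvL).congr (Eventually.of_forall fun t => ?_)
    simp
  -- The integrand `Ψ v` is nonpositive and its integral is nonnegative, so it vanishes almost
  -- everywhere.
  have e0 : ∫ t in Ioo 0 data.T, -(Ψ t * (ubar t + v t - ubar t)) = 0 := by
    rw [integral_neg, neg_eq_zero]
    exact le_antisymm (integral_nonpos fun t => hsq t) e
  have e1 := (integral_eq_zero_iff_of_nonneg (fun t => neg_nonneg.2 (hsq t)) hint.neg).1 e0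
  filter_upwards [e1, ae_restrict_mem measurableSet_Ioo] with t ht hm
  have hs : Ψ t = ybar1 t * cmom c1 p t := switching_eq h p (Ioo_subset_Icc_self hm)
  have hy := (ybar1_mem (Ioo_subset_Icc_self hm)).1
  have ht' : Ψ t * v t = 0 := by
    have : -(Ψ t * (ubar t + v t - ubar t)) = 0 := ht
    linear_combination -this
  have hz : Ψ t = 0 → cmom c1 p t = 0 := fun h0 => by
    rw [hs] at h0
    exact (mul_eq_zero.1 h0).resolve_left (by linarith)
  rcases lt_or_ge t (Real.log 2) with hl | hl
  · refine ⟨?_, fun hl' => absurd hl' (not_le.2 hl)⟩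
    rcases mul_eq_zero.1 ht' with h0 | h0
    · exact (hz h0).le
    · simp only [hvd, hl, if_true, div_eq_zero_iff, neg_eq_zero, (hd t).ne', or_false] at h0
      have h1 : Ψ t ≤ 0 := by
        have := le_max_left (Ψ t) 0
        linarith
      rw [hs] at h1
      by_contra! hpos
      nlinarith
  · have h0 : Ψ t = 0 := by
      rcases mul_eq_zero.1 ht' with h0 | h0
      · exact h0
      · simpa only [hvd, not_lt.2 hl, if_false, div_eq_zero_iff, neg_eq_zero, (hd t).ne', or_false]
          using h0
    exact ⟨(hz h0).le, fun _ => hz h0⟩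

/-- Complementarity says `∫ (2 - ȳ1) dμ = 0` with a nonnegative integrand, so `dμ` does not charge
`[0, log 2)`. Negative times are included: they carry the value `μ(0-)`, and `ȳ1(0) = 1` excludes an
atom at `0`. -/
theorem multiplier_const (h : IsSep yb c1 ybar1 dybar1) {p : CostateSpace data.T}
    {μ : StieltjesFunction ℝ} (hm : (p, μ) ∈ Multipliers data ubar yb) :
    ∀ t < Real.log 2, μ t = μ 0 := by
  obtain ⟨-, hB, hg, -⟩ := hm
  simp only at hB hg
  have hl := half_lt_log_two
  rw [setIntegral_gfun h] at hg
  have e0 : ∫ t in Icc 0 data.T, (2 - ybar1 t) ∂μ.measure = 0 := by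
    rw [← neg_eq_zero, ← integral_neg]
    exact (integral_congr_ae (Eventually.of_forall fun t => neg_sub _ _)).trans hg
  have e1 := (setIntegral_eq_zero_iff_of_nonneg_ae (f := fun t => 2 - ybar1 t) (by
    filter_upwards [ae_restrict_mem measurableSet_Icc] with t ht
    have := (ybar1_mem ht).2
    simp only [Pi.zero_apply]
    linarith) ((continuous_const.sub continuous_ybar1).continuousOn.integrableOn_compact
      isCompact_Icc)).1 e0
  have hnull : μ.measure {t | t ∈ Icc 0 data.T ∧ ybar1 t ≠ 2} = 0 := by
    have := (ae_restrict_iff' measurableSet_Icc).1 e1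
    rw [ae_iff] at this
    refine measure_mono_null (fun t ht => ?_) this
    simp only [mem_ofPred_eq, Classical.not_imp] at ht ⊢
    refine ⟨ht.1, fun h0 => ht.2 ?_⟩
    simp only [Pi.zero_apply] at h0
    linarith
  have hIoc : ∀ s t, s ≤ t → (∀ r ∈ Ioc s t, r ∈ Icc 0 data.T ∧ ybar1 r ≠ 2) → μ t = μ s := by
    intro s t hst hr
    have h0 := measure_mono_null hr hnull
    rw [StieltjesFunction.measure_Ioc, ENNReal.ofReal_eq_zero] at h0
    exact le_antisymm (by linarith) (μ.mono hst)
  have hneg : ∀ t < 0, μ t = μ 0 := by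
    intro t ht
    have h0 : μ.measure {0} = 0 := measure_mono_null (by
      rintro _ rfl
      refine ⟨⟨le_rfl, data_T_pos.le⟩, ?_⟩
      rw [ybar1_zero]
      norm_num) hnull
    have hlim : Function.leftLim μ 0 = μ t := by
      refine leftLim_eq_of_tendsto (tendsto_const_nhds.congr' ?_)
      filter_upwards [self_mem_nhdsWithin] with s hs using hB.2 t s ht hs
    rw [StieltjesFunction.measure_singleton, hlim, ENNReal.ofReal_eq_zero] at h0
    exact le_antisymm (μ.mono ht.le) (by linarith)
  intro t ht
  rcases lt_or_ge t 0 with h0 | h0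
  · exact hneg t h0
  · refine hIoc 0 t h0 fun r hr => ⟨⟨hr.1.le, ?_⟩, ?_⟩
    · rw [data_T]
      linarith [hr.2, log_two_lt_one]
    · rw [ybar1_of_lt (by linarith [hr.2])]
      exact (exp_lt_two (by linarith [hr.2])).ne

/-- Right continuity upgrades equality almost everywhere to equality at every point, the left end
point included. -/
theorem stieltjes_eq_zero_of_ae {f : ℝ → ℝ} {a b : ℝ} (hf : ∀ t, ContinuousWithinAt f (Ici t) t)
    (h : ∀ᵐ t ∂volume.restrict (Ioo a b), f t = 0) {t : ℝ} (ht : t ∈ Ico a b) : f t = 0 := by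
  by_contra hne
  have h1 : ∀ᶠ s in 𝓝[≥] t, f s ≠ 0 := (hf t).eventually_ne hne
  rw [Filter.Eventually, mem_nhdsGE_iff_exists_Ico_subset] at h1
  obtain ⟨c, hc, hs⟩ := h1
  have hlt : t < min c b := lt_min hc ht.2
  obtain ⟨s, hs1, hs2⟩ := nonempty_of_aeOn (R := fun t => f t = 0) h hlt fun s hs =>
    ⟨ht.1.trans_lt hs.1, hs.2.trans_le (min_le_right _ _)⟩
  exact hs ⟨hs1.1.le, hs1.2.trans_le (min_le_left _ _)⟩ hs2

/-- The first mode determines `μ`: on `[log 2, 3)` through the adjoint equation, before `log 2` by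
constancy, and at `log 2` by excluding an atom. Once `μ` is known, all modes of the costate follow.
-/
theorem multiplier_unique (h : IsSep yb c1 ybar1 dybar1) {p q : CostateSpace data.T}
    (hq : IsPbar q) {μ : StieltjesFunction ℝ} (hm : (p, μ) ∈ Multipliers data ubar yb) :
    (p, μ) = (q, mubar) := by
  have hl := log_two_lt_one
  have hl' := half_lt_log_two
  have hmq := isMultiplier_pbar h hq
  have hsign := cmom_sign h hm
  have hconst := multiplier_const h hm
  have hB : MemBV0 data.T μ := hm.2.1
  set r : ℕ → ℝ → ℝ := fun k t => cmom (ek k) p t - cmom (ek k) q t with hr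
  have ir : ∀ k, IntegrableOn (r k) (Ioo 0 data.T) := fun k =>
    (integrable_cmom (memLp_ek k) p).sub (integrable_cmom (memLp_ek k) q)
  have iur : ∀ k, IntegrableOn (fun t => (ubar t - (k * Real.pi) ^ 2) * r k t) (Ioo 0 data.T) :=
    fun k => by
      refine (ir k).bdd_mul (c := 17 + (k * Real.pi) ^ 2) (measurable_coef k).aestronglyMeasurable ?_
      filter_upwards [ae_restrict_mem measurableSet_Ioo] with t ht using coef_bound k ht
  have hCE : ∀ k, ∀ᵐ s ∂volume.restrict (Ioo 0 data.T), r k s + overlap k * (μ s - mubar s) =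
      ∫ t in Ioo s data.T, (ubar t - (k * Real.pi) ^ 2) * r k t := fun k => by
    have iy := integrableOn_tracking.const_mul (overlap k)
    have ic : ∀ P : CostateSpace data.T, IntegrableOn (fun t => (ubar t - (k * Real.pi) ^ 2) *
        cmom (ek k) P t + overlap k * (ybar1 t - ydhat t)) (Ioo 0 data.T) := fun P => by
      refine Integrable.add ((integrable_cmom (memLp_ek k) P).bdd_mul (c := 17 + (k * Real.pi) ^ 2)
        (measurable_coef k).aestronglyMeasurable ?_) iy
      filter_upwards [ae_restrict_mem measurableSet_Ioo] with t ht using coef_bound k ht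
    filter_upwards [costate_integral h hB hm.2.2.2.1 k,
      costate_integral h memBV0_mubar hmq.2.2.2.1 k, ae_restrict_mem measurableSet_Ioo]
      with s h1 h2 hs
    have hsub : Ioo s data.T ⊆ Ioo 0 data.T := Ioo_subset_Ioo_left hs.1.le
    have e : ∫ t in Ioo s data.T, (ubar t - (k * Real.pi) ^ 2) * r k t =
        ∫ t in Ioo s data.T, (((ubar t - (k * Real.pi) ^ 2) * cmom (ek k) p t +
          overlap k * (ybar1 t - ydhat t)) - ((ubar t - (k * Real.pi) ^ 2) * cmom (ek k) q t +
          overlap k * (ybar1 t - ydhat t))) :=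
      integral_congr_ae (Eventually.of_forall fun t => by simp only [hr]; ring)
    rw [e, integral_sub ((ic p).mono_set hsub) ((ic q).mono_set hsub), ← h1, ← h2]
    simp only [hr]
    ring
  have hr1 : ∀ᵐ t ∂volume.restrict (Ioo 0 data.T), r 1 t = cmom c1 p t - pcoef t := by
    filter_upwards [cmom_pbar hq] with t ht
    simp only [hr]
    rw [← c1_eq, ht]
  have hr0 : ∀ᵐ t ∂volume.restrict (Ioo 0 data.T), Real.log 2 ≤ t → r 1 t = 0 := by
    filter_upwards [hr1, hsign] with t h1 h2 h3
    rw [h1, h2.2 h3, pcoef_of_le h3, sub_zero]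
  set f : ℝ → ℝ := fun s => ∫ t in Ioo s data.T, (ubar t - ((1 : ℕ) * Real.pi) ^ 2) * r 1 t with hf
  have hf0 : ∀ s, Real.log 2 ≤ s → f s = 0 := fun s hs => by
    refine integral_eq_zero_of_ae ?_
    filter_upwards [ae_restrict_of_ae_restrict_of_subset
      (Ioo_subset_Ioo_left (by linarith : (0 : ℝ) ≤ s)) hr0, ae_restrict_mem measurableSet_Ioo]
      with t h1 h2
    rw [h1 (hs.trans h2.1.le)]
    simp
  have hfc : ContinuousOn f (Icc 0 data.T) := by
    refine (ContinuousOn.sub (f := fun _ => ∫ t in Ioo 0 data.T,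
      (ubar t - ((1 : ℕ) * Real.pi) ^ 2) * r 1 t) continuousOn_const
      (continuousOn_primitive_Ioo (iur 1))).congr fun t ht => ?_
    have := setIntegral_Ioo_add ht (iur 1)
    simp only [hf, Pi.sub_apply]
    linarith
  have hCE1 := hCE 1
  rw [overlap_one] at hCE1
  -- Beyond `log 2` both `r 1` and `f` vanish, and the first costate equation leaves only the
  -- difference of the measures.
  have hright : ∀ t ∈ Ico (Real.log 2) data.T, μ t - mubar t = 0 := fun t ht => by
    refine stieltjes_eq_zero_of_ae (f := fun t => μ t - mubar t)
      (fun t => (μ.right_continuous t).sub (mubar.right_continuous t)) ?_ ht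
    have hsub : Ioo (Real.log 2) data.T ⊆ Ioo 0 data.T := Ioo_subset_Ioo_left (by linarith)
    filter_upwards [ae_restrict_of_ae_restrict_of_subset hsub hCE1,
      ae_restrict_of_ae_restrict_of_subset hsub hr0, ae_restrict_mem measurableSet_Ioo]
      with s h1 h2 h3
    rw [h2 h3.1.le, one_mul, zero_add] at h1
    rw [h1]
    exact hf0 s h3.1.le
  have hT : data.T = 3 := rfl
  have hlog := hright (Real.log 2) ⟨le_rfl, by rw [hT]; linarith⟩
  have hmulog : mubar (Real.log 2) = Real.log 2 - 3 / 2 := muFun_of_le le_rfl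
  -- Before `log 2` the first coefficient of `p` is `pcoef + f + (μ (log 2) - μ 0)`. The first two
  -- terms tend to `0` at `log 2`, so a positive jump would violate the sign condition.
  have hjump : μ (Real.log 2) ≤ μ 0 := by
    by_contra! hlt
    have hL : Ioo 0 (Real.log 2) ⊆ Ioo 0 data.T := Ioo_subset_Ioo_right (by rw [hT]; linarith)
    have hle : AEOn (fun s => pcoef s + f s + (μ (Real.log 2) - μ 0) ≤ 0) 0 (Real.log 2) := by
      filter_upwards [ae_restrict_of_ae_restrict_of_subset hL hCE1,
        ae_restrict_of_ae_restrict_of_subset hL hr1, ae_restrict_of_ae_restrict_of_subset hL hsign,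
        ae_restrict_mem measurableSet_Ioo] with s h1 h2 h3 h4
      have h5 : mubar s = Real.log 2 - 3 / 2 := muFun_of_le h4.2.le
      rw [hconst s h4.2, h2, h5, one_mul] at h1
      change _ = f s at h1
      linarith [h3.1]
    have hcw : Tendsto (fun s => pcoef s + f s + (μ (Real.log 2) - μ 0)) (𝓝[<] (Real.log 2))
        (𝓝 (pcoef (Real.log 2) + f (Real.log 2) + (μ (Real.log 2) - μ 0))) := by
      refine ((continuous_pcoef.tendsto _).mono_left nhdsWithin_le_nhds |>.add ?_).add_const _
      have hmem : Icc 0 data.T ∈ 𝓝 (Real.log 2) := Icc_mem_nhds (by linarith) (by rw [hT]; linarith)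
      exact (hfc.continuousAt hmem).tendsto.mono_left nhdsWithin_le_nhds
    rw [pcoef_of_le le_rfl, hf0 _ le_rfl, zero_add, zero_add] at hcw
    have hev := hcw.eventually (lt_mem_nhds (show (0 : ℝ) < μ (Real.log 2) - μ 0 by linarith))
    rw [Filter.Eventually, mem_nhdsLT_iff_exists_Ioo_subset] at hev
    obtain ⟨c, hc, hs⟩ := hev
    have hc' : max c 0 < Real.log 2 := max_lt hc (by linarith)
    obtain ⟨s, hs1, hs2⟩ := nonempty_of_aeOn hle hc' (Ioo_subset_Ioo_left (le_max_right _ _))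
    have := hs ⟨(le_max_left _ _).trans_lt hs1.1, hs1.2⟩
    simp only [mem_ofPred_eq] at this
    linarith
  have hμ : μ = mubar := by
    refine StieltjesFunction.ext fun t => ?_
    rcases lt_or_ge t (Real.log 2) with h1 | h1
    · have h2 : mubar t = Real.log 2 - 3 / 2 := muFun_of_le h1.le
      rw [hconst t h1, h2]
      have := μ.mono (show (0 : ℝ) ≤ Real.log 2 by linarith)
      linarith
    rcases lt_or_ge t data.T with h2 | h2
    · linarith [hright t ⟨h1, h2⟩]
    · rw [hB.1 t h2, memBV0_mubar.1 t h2]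
  -- With equal measures the source terms cancel, and each coefficient of `p - q` solves a
  -- homogeneous backward Volterra equation.
  have hrk : ∀ k, ∀ᵐ t ∂volume.restrict (Ioo 0 data.T), r k t = 0 := fun k => by
    refine volterra_backward (ir k) (measurable_coef k).aestronglyMeasurable
      (fun t ht => coef_bound k ht) ?_
    filter_upwards [hCE k] with s hs
    rw [← hs, hμ, sub_self, mul_zero, add_zero]
  have hpq : p = q := by
    refine Lp.ext ?_
    filter_upwards [ae_all_iff.2 hrk] with t ht
    rw [← sub_eq_zero]
    refine H10_eq_zero ?_
    have hi : ∀ F : L2Om, IntegrableOn (fun x => F x) Om := fun F => by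
      have := integrable_pair measurableSet_Om isBounded_Om F (continuous_const (y := (1 : ℝ)))
      simp only [mul_one] at this
      exact this
    refine ae_eq_zero_of_integral_ek (hi _) fun k => ?_
    have e := ht k
    simp only [hr, cmom] at e
    rw [← integral_sub (integrableOn_mul_cval (contDiff_ek k).continuous p t)
      (integrableOn_mul_cval (contDiff_ek k).continuous q t)] at e
    refine (integral_congr_ae ?_).trans e
    filter_upwards [Lp.coeFn_sub ((p t).1 0) ((q t).1 0)] with x hx
    rw [← mul_sub]
    congr 1
  rw [hpq, hμ]

theorem multipliers_eq (h : IsSep yb c1 ybar1 dybar1) {p : CostateSpace data.T} (hp : IsPbar p) :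
    Multipliers data ubar yb = {(p, mubar)} :=
  Set.ext fun _ => ⟨fun hm => multiplier_unique h hp hm, fun hm => by
    rw [mem_singleton_iff.1 hm]
    exact isMultiplier_pbar h hp⟩

end HeatExample

namespace HeatControl

/-! ### Legendre forms -/

/-- Lower semicontinuity: `q z ≥ 2⟨Φ x, Φ z⟩ - ‖Φ x‖²`, a weakly continuous affine minorant with
equality at `z = x`. Strong convergence: `‖Φ x - Φ (s n)‖² = q x - 2⟨Φ x, Φ (s n)⟩ + q (s n)` tends
to `0`, and `Φ` is bounded below. -/
theorem isLegendreForm_of_norm_sq {W H : Type*} [NormedAddCommGroup W] [NormedSpace ℝ W]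
    [NormedAddCommGroup H] [InnerProductSpace ℝ H] {q : W → ℝ} (Φ : W →L[ℝ] H) {C : ℝ}
    (hq : ∀ x, q x = ‖Φ x‖ ^ 2) (hC : ∀ x, ‖x‖ ≤ C * ‖Φ x‖) : IsLegendreForm q := by
  have hcont : ∀ x : W, Continuous fun z : WeakSpace ℝ W =>
      inner ℝ (Φ x) (Φ ((toWeakSpace ℝ W).symm z)) := fun x =>
    WeakBilin.eval_continuous (topDualPairing ℝ W).flip ((innerSL ℝ (Φ x)) ∘L Φ)
  refine ⟨⟨(LinearMap.BilinMap.toQuadraticMap (innerₗ H)).comp Φ.toLinearMap, fun x => ?_⟩, ?_, ?_,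
    ?_⟩
  · rw [hq]
    exact real_inner_self_eq_norm_sq (Φ x)
  · intro x a ha
    set x0 := (toWeakSpace ℝ W).symm x with hx0
    have hc : Continuous fun z : WeakSpace ℝ W =>
        2 * inner ℝ (Φ x0) (Φ ((toWeakSpace ℝ W).symm z)) - ‖Φ x0‖ ^ 2 :=
      ((hcont x0).const_mul 2).sub continuous_const
    have hval : a < 2 * inner ℝ (Φ x0) (Φ ((toWeakSpace ℝ W).symm x)) - ‖Φ x0‖ ^ 2 := by
      rw [← hx0, real_inner_self_eq_norm_sq]
      have : a < ‖Φ x0‖ ^ 2 := by rw [← hq]; exact ha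
      linarith
    filter_upwards [hc.continuousAt.eventually (lt_mem_nhds hval)] with z hz
    refine hz.trans_le ?_
    rw [hq]
    have := norm_sub_sq_real (Φ x0) (Φ ((toWeakSpace ℝ W).symm z))
    nlinarith [sq_nonneg ‖Φ x0 - Φ ((toWeakSpace ℝ W).symm z)‖]
  · intro x t _
    rw [hq, hq, map_smul, norm_smul, mul_pow, Real.norm_eq_abs, sq_abs]
  · intro s x hs hqs
    have h1 : Tendsto (fun n => inner ℝ (Φ x) (Φ (s n))) atTop (𝓝 (‖Φ x‖ ^ 2)) := by
      have := ((hcont x).tendsto (toWeakSpace ℝ W x)).comp hs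
      simp only [Function.comp_def, LinearEquiv.symm_apply_apply, real_inner_self_eq_norm_sq] at this
      exact this
    simp only [hq] at hqs
    have h2 : Tendsto (fun n => ‖Φ x - Φ (s n)‖ ^ 2) atTop (𝓝 0) := by
      simp only [norm_sub_sq_real]
      have := (tendsto_const_nhds (x := ‖Φ x‖ ^ 2)).sub (h1.const_mul 2) |>.add hqs
      convert this using 2
      ring
    have h3 : Tendsto (fun n => C * ‖Φ x - Φ (s n)‖) atTop (𝓝 0) := by
      have := (h2.sqrt).const_mul C
      simpa only [Real.sqrt_sq (norm_nonneg _), Real.sqrt_zero, mul_zero] using this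
    rw [tendsto_iff_norm_sub_tendsto_zero]
    refine squeeze_zero (fun n => norm_nonneg _) (fun n => ?_) h3
    rw [norm_sub_rev, ← map_sub]
    exact hC _

/-- Multiplication by a bounded function on `L²`. -/
theorem exists_mul_clm {α : Type*} [MeasurableSpace α] {μ : Measure α} {a : α → ℝ} {C : ℝ}
    (ha : AEStronglyMeasurable a μ) (hC : ∀ᵐ t ∂μ, |a t| ≤ C) :
    ∃ M : Lp ℝ 2 μ →L[ℝ] Lp ℝ 2 μ, ∀ w, ∀ᵐ t ∂μ, M w t = a t * w t := by
  have hm : ∀ w : Lp ℝ 2 μ, MemLp (fun t => a t * w t) 2 μ := fun w =>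
    (Lp.memLp w).of_le_mul (c := C) (ha.mul (Lp.aestronglyMeasurable w)) (by
      filter_upwards [hC] with t ht
      rw [norm_mul]
      exact mul_le_mul_of_nonneg_right ht (norm_nonneg _))
  let M : Lp ℝ 2 μ →ₗ[ℝ] Lp ℝ 2 μ :=
    { toFun := fun w => (hm w).toLp
      map_add' := fun v w => by
        refine Lp.ext ?_
        filter_upwards [(hm (v + w)).coeFn_toLp, (hm v).coeFn_toLp, (hm w).coeFn_toLp,
          Lp.coeFn_add v w, Lp.coeFn_add (hm v).toLp (hm w).toLp] with t h1 h2 h3 h4 h5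
        rw [h1, h5, h4, Pi.add_apply, Pi.add_apply, h2, h3, mul_add]
      map_smul' := fun c w => by
        refine Lp.ext ?_
        filter_upwards [(hm (c • w)).coeFn_toLp, (hm w).coeFn_toLp, Lp.coeFn_smul c w,
          Lp.coeFn_smul c (hm w).toLp] with t h1 h2 h3 h4
        rw [RingHom.id_apply, h1, h4, h3, Pi.smul_apply, Pi.smul_apply, h2, smul_eq_mul,
          smul_eq_mul]
        ring }
  refine ⟨M.mkContinuous C fun w => Lp.norm_le_mul_norm_of_ae_le_mul ?_, fun w =>
    (hm w).coeFn_toLp⟩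
  filter_upwards [hC, (hm w).coeFn_toLp] with t h1 h2
  change ‖(hm w).toLp _ t‖ ≤ _
  rw [h2, norm_mul]
  exact mul_le_mul_of_nonneg_right h1 (norm_nonneg _)

theorem L2_norm_sq_eq {α : Type*} [MeasurableSpace α] {μ : Measure α} (w : Lp ℝ 2 μ) :
    ‖w‖ ^ 2 = ∫ t, w t ^ 2 ∂μ := by
  rw [← real_inner_self_eq_norm_sq, L2.inner_def]
  refine integral_congr_ae (Eventually.of_forall fun t => ?_)
  simp only [real_inner_self_eq_norm_sq, Real.norm_eq_abs, sq_abs]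

theorem Y_ext {T : ℝ} {y z : Y T} (h : ∀ᵐ q ∂volume.restrict (Cyl T), fn y q = fn z q) : y = z := by
  rw [← sub_eq_zero]
  refine Y_eq_zero ?_
  filter_upwards [h, Lp.coeFn_sub (y.1 0) (z.1 0)] with q h1 h2
  refine h2.trans ?_
  rw [Pi.sub_apply]
  exact sub_eq_zero.2 h1

end HeatControl

namespace HeatExample
open HeatControl

variable {yb : Y data.T}

/-! ### Values of the costate and strict complementarity -/

/-- `costateAt` picks some element of `Y` representing `p + c μ`. An element of `Y` is determined by
its function, so the choice must be the separated function with time factor `pcoef + muFun`. -/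
theorem costateAt_eq {p : CostateSpace data.T} (hp : IsPbar p) {t : ℝ} (ht : t ∈ Icc 0 data.T) :
    ∀ᵐ x ∂volume.restrict Om, costateAt data p mubar t x = pcoef t * c1 x := by
  obtain ⟨z, hz⟩ := exists_isSep data_T_pos.le contDiff_c1 (by simp [c1]) (by simp [c1])
    isPrimitive_sum fun t ht => dsum_bound ht
  have hex : IsAltCostate data p mubar z := by
    filter_upwards [hp, ae_sections_symm hz.fn_eq] with t h1 h2
    filter_upwards [h1, h2] with x k1 k2
    rw [k1, k2, mul_add, mul_comm (pcoef t)]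
    rfl
  have huniq : ∀ p1 : Y data.T, IsAltCostate data p mubar p1 → p1 = z := fun p1 h1 => by
    refine Y_ext (ae_of_ae_sections_symm (Lp.aestronglyMeasurable (p1.1 0))
      (Lp.aestronglyMeasurable (z.1 0)) ?_)
    filter_upwards [h1, hex] with t k1 k2
    filter_upwards [k1, k2] with x l1 l2
    exact l1.trans l2.symm
  have hE : ∃ p1 : Y data.T, IsAltCostate data p mubar p1 := ⟨z, hex⟩
  filter_upwards [hz.valueAt_eq data_T_pos isPrimitive_sum ht] with x hx
  rw [costateAt, dif_pos hE, huniq _ hE.choose_spec, hx]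
  change c1 x * (pcoef t + muFun t) - c1 x * muFun t = _
  ring

theorem integral_ybar_costateAt (h : IsSep yb c1 ybar1 dybar1) {p : CostateSpace data.T}
    (hp : IsPbar p) {t : ℝ} (ht : t ∈ Icc 0 data.T) :
    ∫ x in Om, valueAt yb t x * costateAt data p mubar t x = ybar1 t * pcoef t := by
  have e : ∫ x in Om, valueAt yb t x * costateAt data p mubar t x =
      ∫ x in Om, c1 x * c1 x * (ybar1 t * pcoef t) := by
    refine integral_congr_ae ?_
    filter_upwards [h.valueAt_eq data_T_pos isPrimitive_ybar1 ht, costateAt_eq hp ht] with x h1 h2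
    rw [h1, h2]
    ring
  rw [e, integral_mul_const, integral_c1_sq, one_mul]

theorem switching_costateAt (h : IsSep yb c1 ybar1 dybar1) {p : CostateSpace data.T}
    (hp : IsPbar p) {t : ℝ} (ht : t ∈ Icc 0 data.T) :
    switching data yb 1 (costateAt data p mubar) t = ybar1 t * pcoef t := by
  rw [← integral_ybar_costateAt h hp ht, switching]
  simp [data]

theorem sfun_eq (h : IsSep yb c1 ybar1 dybar1) {p : CostateSpace data.T}
    (hp : IsPbar p) {t : ℝ} (ht : t ∈ Icc 0 data.T) :
    Sfun data yb p mubar t = ybar1 t * pcoef t := by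
  rw [← integral_ybar_costateAt h hp ht, Sfun]
  simp [data, mul_comm]

/-- Strict growth on the contact interval means that every neighbourhood of its points is charged,
which is what the support needs. -/
theorem muFun_lt {s t : ℝ} (hs : Real.log 2 ≤ s) (hst : s < t) (ht : t ≤ 2) :
    muFun s < muFun t := by
  have hl := log_two_lt_one
  rcases le_or_gt t 1 with h1 | h1
  · rw [muFun_of_le_one hs (by linarith), muFun_of_le_one (by linarith) h1]
    linarith
  rcases le_or_gt 1 s with h2 | h2
  · rw [muFun_of_le_two h2 (by linarith), muFun_of_le_two h1.le ht]
    nlinarith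
  · rw [muFun_of_le_one hs h2.le, muFun_of_le_two h1.le ht]
    nlinarith

theorem support_mubar : mubar.measure.support = Icc (Real.log 2) 2 := by
  have hl := log_two_lt_one
  ext t
  constructor
  · intro ht
    by_contra hn
    refine (Measure.notMem_support_iff_exists.2 ?_) ht
    rw [mem_Icc, not_and_or, not_le, not_le] at hn
    rcases hn with hn | hn
    · refine ⟨Ioc (t - 1) (Real.log 2), Ioc_mem_nhds (by linarith) hn, ?_⟩
      rw [StieltjesFunction.measure_Ioc]
      change ENNReal.ofReal (muFun _ - muFun _) = 0
      rw [muFun_of_le le_rfl, muFun_of_le (by linarith)]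
      simp
    · refine ⟨Ioc 2 (t + 1), Ioc_mem_nhds hn (by linarith), ?_⟩
      rw [StieltjesFunction.measure_Ioc]
      change ENNReal.ofReal (muFun _ - muFun _) = 0
      rw [muFun_of_two_le le_rfl, muFun_of_two_le (by linarith)]
      simp
  · intro ht
    rw [Measure.mem_support_iff_forall]
    intro U hU
    obtain ⟨ε, hε, hs⟩ := Metric.mem_nhds_iff.1 hU
    rw [Real.ball_eq_Ioo] at hs
    have hlt : max (Real.log 2) (t - ε / 2) < min 2 (t + ε / 2) := by
      rw [max_lt_iff, lt_min_iff, lt_min_iff]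
      refine ⟨⟨?_, ?_⟩, ?_, ?_⟩ <;> linarith [ht.1, ht.2]
    refine lt_of_lt_of_le ?_ (measure_mono (s := Ioc (max (Real.log 2) (t - ε / 2))
      (min 2 (t + ε / 2))) fun s hs' => hs ⟨?_, ?_⟩)
    · rw [StieltjesFunction.measure_Ioc, ENNReal.ofReal_pos]
      exact sub_pos.2 (muFun_lt (le_max_left _ _) hlt (min_le_left _ _))
    · linarith [hs'.1, le_max_right (Real.log 2) (t - ε / 2)]
    · linarith [hs'.2, min_le_right 2 (t + ε / 2)]

theorem strictComplementarity (h : IsSep yb c1 ybar1 dybar1) :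
    StrictComplementarity data ubar yb := by
  have hT : data.T = 3 := rfl
  have hl := log_two_lt_one
  have hl' := half_lt_log_two
  obtain ⟨p, hp⟩ := exists_isPbar
  have hM := multipliers_eq h hp
  have hsub : ∀ {t ε : ℝ}, Ioo (t - ε) (t + ε) ∩ Ioo 0 data.T =
      Ioo (max (t - ε) 0) (min (t + ε) data.T) := Ioo_inter_Ioo
  refine ⟨fun t ht => ?_, fun t ht => ?_, ⟨(p, mubar), isMultiplier_pbar h hp, ?_⟩⟩
  · obtain ⟨ht, ε, hε, hae⟩ := ht
    rw [hsub] at hae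
    have h3 : t ≤ 3 := ht.2
    have hlt : max (t - ε) 0 < min (t + ε) data.T := by
      rw [max_lt_iff, lt_min_iff, lt_min_iff, hT]
      refine ⟨⟨?_, ?_⟩, ?_, ?_⟩ <;> linarith [ht.1]
    obtain ⟨s, hs, hs2⟩ := nonempty_of_aeOn hae hlt Subset.rfl
    -- The lower bound is nowhere active, so this condition is vacuous.
    exact absurd hs2 (not_lowerActive (hs.2.le.trans (min_le_right _ _)))
  · obtain ⟨ht, ε, hε, hae⟩ := ht
    -- The inequality must be strict, since the switching function vanishes at `log 2`; a relative
    -- neighbourhood of `log 2` would meet the inactive side.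
    have hlog : t < Real.log 2 := by
      by_contra! hle
      rw [hsub] at hae
      have h3 : t ≤ 3 := ht.2
      have hlt : max (max (t - ε) 0) (Real.log 2) < min (t + ε) data.T := by
        rw [max_lt_iff, max_lt_iff, lt_min_iff, lt_min_iff, lt_min_iff, hT]
        refine ⟨⟨⟨?_, ?_⟩, ?_, ?_⟩, ?_, ?_⟩ <;> linarith [ht.1]
      obtain ⟨s, hs, hs2⟩ := nonempty_of_aeOn hae hlt (Ioo_subset_Ioo_left (le_max_left _ _))
      rw [upperActive_iff (hs.2.le.trans (min_le_right _ _))] at hs2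
      linarith [hs.1, le_max_right (max (t - ε) 0) (Real.log 2)]
    refine ⟨ybar1 t * pcoef t, ?_, mul_neg_of_pos_of_neg (by linarith [(ybar1_mem ht).1])
      (pcoef_neg hlog)⟩
    rw [hM, image_singleton, switching_costateAt h hp ht]
    exact isLeast_singleton
  · rw [contactC_eq h]
    exact support_mubar

/-! ### The quadratic form -/

/-- The coefficient of `w²` in the quadratic form. -/
noncomputable def qcoef (t : ℝ) : ℝ := if t < Real.log 2 then Real.exp t ^ 2 / 2 else ybar1 t ^ 2

/-- The bounds are chosen as perfect squares, so the square root lies between `1/2` and `2`. -/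
theorem qcoef_mem {t : ℝ} (ht : t ∈ Ioo 0 data.T) : 1 / 4 ≤ qcoef t ∧ qcoef t ≤ 4 := by
  have hy := ybar1_mem (Ioo_subset_Icc_self ht)
  simp only [qcoef]
  split_ifs with h
  · have h1 := exp_lt_two h
    have h2 := Real.one_le_exp ht.1.le
    constructor <;> nlinarith
  · constructor <;> nlinarith

theorem measurable_qcoef : Measurable qcoef :=
  Measurable.ite measurableSet_Iio (by fun_prop) (continuous_ybar1.measurable.pow_const 2)

/-- `S = (e^{2t} - 4) / 4` on the first arc and `0` afterwards, so half of `ȳ1²` survives before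
`log 2` and all of it later. The kink at `log 2` is a null set. -/
theorem deriv_sfun (h : IsSep yb c1 ybar1 dybar1) {p : CostateSpace data.T} (hp : IsPbar p) :
    ∀ᵐ t ∂volume.restrict (Ioo 0 data.T),
      ybar1 t ^ 2 - deriv (Sfun data yb p mubar) t = qcoef t := by
  have hne : ∀ᵐ t ∂volume.restrict (Ioo 0 data.T), t ≠ Real.log 2 :=
    ae_restrict_of_ae (Measure.ae_ne volume _)
  filter_upwards [hne, ae_restrict_mem measurableSet_Ioo] with t hn ht
  have hev : ∀ᶠ s in 𝓝 t, Sfun data yb p mubar s = ybar1 s * pcoef s := by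
    filter_upwards [Ioo_mem_nhds ht.1 ht.2] with s hs using sfun_eq h hp (Ioo_subset_Icc_self hs)
  rcases lt_or_gt_of_ne hn with hl | hl
  · have hd : HasDerivAt (fun s => Real.exp s * ((Real.exp s - 4 * Real.exp (-s)) / 4))
        (Real.exp t * ((Real.exp t - 4 * Real.exp (-t)) / 4) +
          Real.exp t * ((Real.exp t - 4 * (Real.exp (-t) * -1)) / 4)) t :=
      (Real.hasDerivAt_exp t).mul
        (((Real.hasDerivAt_exp t).sub (((hasDerivAt_id t).neg.exp).const_mul 4)).div_const 4)
    have hd' : HasDerivAt (Sfun data yb p mubar) _ t := hd.congr_of_eventuallyEq (by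
      filter_upwards [hev, Iio_mem_nhds hl] with s h1 h2
      rw [h1, ybar1_of_lt h2, pcoef_of_lt h2])
    rw [hd'.deriv, ybar1_of_lt hl, qcoef, if_pos hl]
    ring
  · have hd' : HasDerivAt (Sfun data yb p mubar) 0 t :=
      (hasDerivAt_const t (0 : ℝ)).congr_of_eventuallyEq (by
        filter_upwards [hev, Ioi_mem_nhds hl] with s h1 h2
        rw [h1, pcoef_of_le (le_of_lt h2), mul_zero])
    rw [hd'.deriv, qcoef, if_neg (not_lt.2 hl.le), sub_zero]

/-- The cross terms disappear with `ζ = 0` and `B¹ = 0`. At the final time `p` and `S` vanish and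
`ȳ(T) = c1` has norm one, which leaves `h²`. -/
theorem hatQ_eq (h : IsSep yb c1 ybar1 dybar1) {p : CostateSpace data.T} (hp : IsPbar p)
    {e : Y data.T × L2T data.T × ℝ} (he : IsGoh data ubar yb e.2.1 e.1) :
    hatQ data yb p mubar e = (∫ t in Ioo 0 data.T, qcoef t * e.2.1 t ^ 2) + e.2.2 ^ 2 := by
  obtain ⟨ζ, w, a⟩ := e
  rw [isGoh_iff] at he
  simp only at he
  subst he
  have hz : ∀ᵐ q ∂volume.restrict (Cyl data.T), fn (0 : Y data.T) q = 0 :=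
    Lp.coeFn_zero ℝ 2 (volume.restrict (Cyl data.T))
  rw [hatQ]
  congr 1
  · refine integral_congr_ae ?_
    filter_upwards [ae_sections_symm hz, ae_sections_symm h.fn_eq, deriv_sfun h hp]
      with t h1 h2 h3
    rw [hatqI]
    have e1 : ∫ x in Om, (1 - 6 * data.γ * fn yb (x, t) * cval p t x) *
        (fn (0 : Y data.T) (x, t) + fn yb (x, t) * data.b x * w t) ^ 2 =
        ∫ x in Om, c1 x * c1 x * (ybar1 t ^ 2 * w t ^ 2) := by
      refine integral_congr_ae ?_
      filter_upwards [h1, h2] with x k1 k2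
      rw [k1, k2]
      simp only [data]
      ring
    have e2 : ∫ x in Om, (fn (0 : Y data.T) (x, t) * (-deriv (deriv data.b) x * cval p t x
        - 2 * deriv data.b x * cvalx p t x + data.b x * (fn yb (x, t) - data.yd (x, t)) +
        data.b x * data.c x * deriv mubar t) - data.b x * cval p t x * B1 data yb (x, t) * w t)
        = 0 := by
      refine integral_eq_zero_of_ae ?_
      filter_upwards [h1] with x k1
      rw [k1, B1_eq]
      simp
    change _ - _ + 2 * w t * (∫ x in Om, (fn (0 : Y data.T) (x, t) * _ - _)) = _
    rw [e1, e2, integral_mul_const, integral_c1_sq, ← h3]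
    ring
  · have hv0 : ∀ᵐ x ∂volume.restrict Om, valueAt (0 : Y data.T) data.T x = 0 := by
      filter_upwards [ae_sections hz, ae_sections (show ∀ᵐ q ∂volume.restrict (Cyl data.T),
        fnt (0 : Y data.T) q = 0 from Lp.coeFn_zero ℝ 2 (volume.restrict (Cyl data.T)))]
        with x k1 k2
      have i1 : ∫ s in Ioo 0 data.T, (fn (0 : Y data.T) (x, s) + s * fnt (0 : Y data.T) (x, s))
          = 0 := by
        refine integral_eq_zero_of_ae ?_
        filter_upwards [k1, k2] with s l1 l2
        simp [l1, l2]
      rw [valueAt, i1]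
      simp
    have hTm : data.T ∈ Icc 0 data.T := ⟨data_T_pos.le, le_rfl⟩
    have hpT : pcoef data.T = 0 := pcoef_of_le (by
      rw [data_T]
      linarith [log_two_lt_one])
    rw [hatqT, sfun_eq h hp hTm, hpT]
    have e1 : ∫ x in Om, ((valueAt (0 : Y data.T) data.T x + valueAt yb data.T x * a * data.b x) ^ 2
        + 2 * a * data.b x * costateAt data p mubar data.T x * valueAt (0 : Y data.T) data.T x) =
        ∫ x in Om, c1 x * c1 x * a ^ 2 := by
      refine integral_congr_ae ?_
      filter_upwards [hv0, h.valueAt_eq data_T_pos isPrimitive_ybar1 hTm] with x k1 k2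
      rw [k1, k2, ybar1_three]
      simp only [data]
      ring
    rw [e1, integral_mul_const, integral_c1_sq]
    ring

/-- The quadratic form is the square of a norm of `(w, h)`. -/
theorem exists_mul_sqrt_qcoef : ∃ M : L2T data.T →L[ℝ] L2T data.T,
    (∀ w, ‖M w‖ ^ 2 = ∫ t in Ioo 0 data.T, qcoef t * w t ^ 2) ∧ ∀ w, ‖w‖ ≤ 2 * ‖M w‖ := by
  obtain ⟨M, hM⟩ := exists_mul_clm (μ := volume.restrict (Ioo 0 data.T))
    (a := fun t => √(qcoef t)) (C := 2) measurable_qcoef.sqrt.aestronglyMeasurable (by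
      filter_upwards [ae_restrict_mem measurableSet_Ioo] with t ht
      rw [abs_of_nonneg (Real.sqrt_nonneg _), Real.sqrt_le_left two_pos.le]
      linarith [(qcoef_mem ht).2])
  refine ⟨M, fun w => ?_, fun w => Lp.norm_le_mul_norm_of_ae_le_mul ?_⟩
  · rw [L2_norm_sq_eq]
    refine integral_congr_ae ?_
    filter_upwards [hM w, ae_restrict_mem measurableSet_Ioo] with t h1 h2
    rw [h1, mul_pow, Real.sq_sqrt (by linarith [(qcoef_mem h2).1])]
  · filter_upwards [hM w, ae_restrict_mem measurableSet_Ioo] with t h1 h2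
    have h3 : 1 / 2 ≤ √(qcoef t) := Real.le_sqrt_of_sq_le (by linarith [(qcoef_mem h2).1])
    rw [h1, norm_mul, Real.norm_of_nonneg (Real.sqrt_nonneg _)]
    nlinarith [norm_nonneg (w t)]

theorem legendre (h : IsSep yb c1 ybar1 dybar1) {p : CostateSpace data.T} (hp : IsPbar p) :
    IsLegendreForm (fun e : GohSpace data ubar yb => hatQ data yb p mubar e.1) := by
  obtain ⟨M, hM, hC⟩ := exists_mul_sqrt_qcoef
  -- `Φ` sends `(ζ, w, h)` to `(√qcoef · w, h)` with the Hilbert norm; it is bounded below on this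
  -- space because `ζ = 0`.
  let Φ : GohSpace data ubar yb →L[ℝ] WithLp 2 (L2T data.T × ℝ) :=
    (WithLp.prodContinuousLinearEquiv 2 ℝ (L2T data.T) ℝ).symm.toContinuousLinearMap ∘L
      (M.prodMap (ContinuousLinearMap.id ℝ ℝ)) ∘L
      (ContinuousLinearMap.snd ℝ (Y data.T) (L2T data.T × ℝ)) ∘L (GohSpace data ubar yb).subtypeL
  have hΦ : ∀ e : GohSpace data ubar yb, ‖Φ e‖ ^ 2 = ‖M e.1.2.1‖ ^ 2 + ‖e.1.2.2‖ ^ 2 := fun e =>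
    WithLp.prod_norm_sq_eq_of_L2 (Φ e)
  refine isLegendreForm_of_norm_sq Φ (C := 2) (fun e => ?_) fun e => ?_
  · rw [hatQ_eq h hp e.2, hΦ, hM, Real.norm_eq_abs, sq_abs]
  · have h0 : e.1.1 = 0 := (isGoh_iff _ _).1 e.2
    have h1 : ‖M e.1.2.1‖ ≤ ‖Φ e‖ := by
      refine le_of_sq_le_sq ?_ (norm_nonneg _)
      nlinarith [hΦ e, sq_nonneg ‖e.1.2.2‖]
    have h2 : ‖e.1.2.2‖ ≤ ‖Φ e‖ := by
      refine le_of_sq_le_sq ?_ (norm_nonneg _)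
      nlinarith [hΦ e, sq_nonneg ‖M e.1.2.1‖]
    change ‖e.1‖ ≤ _
    rw [Prod.norm_def, Prod.norm_def, h0, norm_zero]
    refine max_le (by positivity) (max_le ((hC _).trans (by linarith)) ?_)
    linarith [norm_nonneg (Φ e)]

/-- The constant `ρ = 1/4` comes from `‖w‖ ≤ 2 ‖M w‖`. Of the conditions defining the cone only the
equation for `ζ` is used. -/
theorem sufficientCondition (h : IsSep yb c1 ybar1 dybar1) : SufficientCondition data ubar yb := by
  obtain ⟨p, hp⟩ := exists_isPbar
  have hM := multipliers_eq h hp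
  refine ⟨⟨isAdmissible h, _, isMultiplier_pbar h hp⟩, fun m hm => ?_, 1 / 4, by norm_num,
    fun e he => ⟨hatQ data yb p mubar e, ?_, ?_⟩⟩
  · rw [hM, mem_singleton_iff] at hm
    rw [hm]
    exact legendre h hp
  · rw [hM, image_singleton]
    exact isGreatest_singleton
  · obtain ⟨M, hM, hC⟩ := exists_mul_sqrt_qcoef
    rw [hatQ_eq h hp he.goh, ← hM, sq_abs]
    have h1 := hC e.2.1
    nlinarith [norm_nonneg e.2.1, norm_nonneg (M e.2.1), sq_nonneg e.2.2]

end HeatExample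

/-! ### Conclusion -/

theorem mainTheorem7 :
    HeatControl.Standing HeatExample.data ∧
    ∃ ybar : HeatControl.Y HeatExample.data.T,
      (∀ᵐ q ∂MeasureTheory.volume.restrict (HeatControl.Cyl HeatExample.data.T),
        HeatControl.fn ybar q = HeatExample.ybar1 q.2 * HeatExample.c1 q.1) ∧
      (∀ y, HeatControl.IsState HeatExample.data HeatExample.ubar y ↔ y = ybar) ∧
      HeatControl.SettingHypothesis HeatExample.data HeatExample.ubar ybar ∧
      HeatControl.StrictComplementarity HeatExample.data HeatExample.ubar ybar ∧
      (∃! m, m ∈ HeatControl.Multipliers HeatExample.data HeatExample.ubar ybar) ∧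
      (∀ w, ∃! ζ, HeatControl.IsGoh HeatExample.data HeatExample.ubar ybar w ζ) ∧
      HeatControl.SufficientCondition HeatExample.data HeatExample.ubar ybar := by
  obtain ⟨yb, h⟩ := HeatExample.exists_ybar
  obtain ⟨p, hp⟩ := HeatExample.exists_isPbar
  refine ⟨HeatExample.standing, yb, ?_, HeatExample.isState_iff h,
    HeatExample.settingHypothesis h, HeatExample.strictComplementarity h, ?_, fun w => ?_,
    HeatExample.sufficientCondition h⟩
  · filter_upwards [h.fn_eq] with q hq
    rw [hq, mul_comm]
  · exact ⟨(p, HeatExample.mubar), HeatExample.isMultiplier_pbar h hp,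
      fun _ hm => HeatExample.multiplier_unique h hp hm⟩
  · exact ⟨0, (HeatExample.isGoh_iff w 0).2 rfl, fun _ hz => (HeatExample.isGoh_iff w _).1 hz⟩
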